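/- Let $L_1,\dots,L_n$ be pairwise disjoint nondegenerate open line segments (``complete edges'') in $\mathbb R^2$ that form a T-graph: writing $|L|=\bigcup_i L_i$ and $R=\overline{|L|}\setminus |L|$ (the set of root vertices), the set $\overline{|L|}$ is connected (and nonempty), and every point of $R$ lies on the boundary of the unbounded component of $\mathbb R^2\setminus\overline{|L|}$. The tree-graph $G_T$ has as vertices the endpoints of the $L_i$. Its (undirected) edges are the subsegments into which the vertices divide the complete edges. A vertex $v$ in the interior of a complete edge $L_i$ has two outgoing directed edges, to its immediate neighbours $v_1,v_2$ along $L_i$ on either side, with weights that sum to $1$ and are inversely proportional to $|v-v_1|,|v-v_2|$; root vertices have no outgoing edges. An in-directed spanning forest of $G_T$ rooted at $R$ is a set $\mathcal F$ of directed edges without (undirected) cycles, such that every non-root vertex has exactly one outgoing edge in $\mathcal F$ and every component contains exactly one root vertex. Let $\mu_F$ be the probability measure on these forests for which $\mu_F(\mathcal F)$ is proportional to the product of the weights of the edges of $\mathcal F$. Let $C$ be any simple closed curve that passes through all points of $R$ and has $|L|$ in its interior. The faces are the bounded components of $\mathbb R^2\setminus(|L|\cup C)$; a face is outer if its boundary contains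 a point of $C\setminus R$. Fix any outer face $w_0$ (the dual root). The bipartite graph $G_D$ has the complete edges as black vertices and the faces other than $w_0$ as white vertices; a face $F$ is adjacent to $L_i$ if $S_{(F,L_i)}=L_i\cap\partial F$ contains a nondegenerate segment, and the weight of the edge $e=(F,L_i)$ is the length $|S_e|$. Let $\mu$ be the probability measure on perfect matchings of $G_D$ for which $\mu(M)$ is proportional to $\prod_{e\in M}|S_e|$. A marked matching $M'$ is a perfect matching $M$ together with, for each $e\in M$, an edge $S'_e$ of $G_T$ contained in $S_e$; set $\mu(M')=\mu(M)\prod_{e\in M}|S'_e|/|S_e|$, which is proportional to $\prod_{e\in M}|S'_e|$. Let $\mathcal F_{M'}$ be the set of all edges of $G_T$ other than the $S'_e$, $e\in M$, each oriented along the path in this set that leads to a root vertex. Then marked matchings exist, the map $M'\mapsto\mathcal F_{M'}$ is a bijection from the set of marked matchings of $G_D$ onto the set of in-directed spanning forests of $G_T$ rooted at $R$, and it is measure preserving: $\mu(M')=\mu_F(\mathcal F_{M'})$ for every marked matching $M'$. -/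

import Mathlib

noncomputable section

open MeasureTheory

/-- The connected components of a subset `S` of a topological space. -/
def componentsOf {X : Type*} [TopologicalSpace X] (S : Set X) : Set (Set X) :=
  {F | ∃ x ∈ S, F = connectedComponentIn S x}

/-- A simple closed curve in the plane, as a set of points. The plane is `ℂ` with its
Euclidean distance. -/
def IsSimpleClosedCurve (C : Set ℂ) : Prop :=
  ∃ γ : Circle → ℂ, Continuous γ ∧ Function.Injective γ ∧ Set.range γ = C

/-- `n` nondegenerate segments in the plane, given by their endpoints. -/
structure SegmentFamily (n : ℕ) where
  a : Fin n → ℂ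
  b : Fin n → ℂ
  ne : ∀ i, a i ≠ b i

namespace SegmentFamily

variable {n : ℕ} (L : SegmentFamily n)

/-- The `i`-th complete edge: the open segment between its endpoints. -/
def seg (i : Fin n) : Set ℂ := openSegment ℝ (L.a i) (L.b i)

/-- The union of the complete edges. -/
def carrier : Set ℂ := ⋃ i, L.seg i

/-- The root vertices: the limit points of the union that do not belong to the union. -/
def rootSet : Set ℂ := closure L.carrier \ L.carrier

/-- The open segments form a T-graph in the plane: they are disjoint, together they form a
connected figure (the corners, i.e. the root vertices, being counted in: the three open edges of
a triangle form a T-graph), and every limit point that is missing from the union lies on the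
boundary of the infinite component of the complement of the closure. -/
structure IsTGraph : Prop where
  disjoint : Pairwise fun i j => Disjoint (L.seg i) (L.seg j)
  connected : IsConnected (closure L.carrier)
  roots_outer : ∃ U ∈ componentsOf (closure L.carrier)ᶜ,
    ¬ Bornology.IsBounded U ∧ L.rootSet ⊆ frontier U

/-! ### The tree-graph -/

/-- The points that are endpoints of at least one of the segments. -/
def vertexSet : Set ℂ := Set.range L.a ∪ Set.range L.b

/-- The vertices of the tree-graph. -/
abbrev Vert : Type := L.vertexSet

def IsRoot (v : L.Vert) : Prop := (v : ℂ) ∈ L.rootSet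

/-- The tree-graph viewed as an undirected graph: its edges are the subsegments into which the
vertices divide the complete edges. -/
def treeGraph : SimpleGraph L.Vert where
  Adj u v := u ≠ v ∧ (∃ i, openSegment ℝ (u : ℂ) v ⊆ L.seg i) ∧
    ∀ w : L.Vert, (w : ℂ) ∉ openSegment ℝ (u : ℂ) v
  symm := ⟨fun u v h => by
    rw [openSegment_symm ℝ (v : ℂ) u]
    exact ⟨h.1.symm, h.2⟩⟩
  loopless := ⟨fun _ h => h.1 rfl⟩

/-- The directed edges of the tree-graph: from a vertex `u` in the interior of a complete edge to
an immediate neighbour `v` of `u` along this complete edge. -/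
def Out (u v : L.Vert) : Prop :=
  L.treeGraph.Adj u v ∧ ∃ i, (u : ℂ) ∈ L.seg i ∧ openSegment ℝ (u : ℂ) v ⊆ L.seg i

/-- The transition probability from `u` to an out-neighbour `v`: inversely proportional to the
distance, and normalized so that the weights of the edges going out of `u` add up to one. -/
def transition (u v : L.Vert) : ℝ :=
  (dist (u : ℂ) v)⁻¹ / ∑ᶠ w ∈ {w | L.Out u w}, (dist (u : ℂ) w)⁻¹

/-- In-directed spanning forests of the tree-graph, rooted at the root vertices, as sets of
directed edges. (Two opposite directed edges count as a cycle.) -/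
structure IsSpanningForest (F : Set (L.Vert × L.Vert)) : Prop where
  edge : ∀ u v, (u, v) ∈ F → L.Out u v
  out_unique : ∀ u, ¬ L.IsRoot u → ∃! v, (u, v) ∈ F
  no_two_cycle : ∀ u v, (u, v) ∈ F → (v, u) ∉ F
  acyclic : (SimpleGraph.fromRel fun u v => (u, v) ∈ F).IsAcyclic
  root_unique : ∀ u, ∃! r, L.IsRoot r ∧ (SimpleGraph.fromRel fun u v => (u, v) ∈ F).Reachable u r

/-- The weight of a set of directed edges: the product of the transition probabilities. -/
def forestWeight (F : Set (L.Vert × L.Vert)) : ℝ := ∏ᶠ e ∈ F, L.transition e.1 e.2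

/-- The probability of a spanning forest, proportional to its weight. -/
def forestProb (F : Set (L.Vert × L.Vert)) : ℝ :=
  L.forestWeight F / ∑ᶠ F' ∈ {F' | L.IsSpanningForest F'}, L.forestWeight F'

/-- The open subsegment of the plane that is represented by an edge of the tree-graph. -/
def subsegment : Sym2 L.Vert → Set ℂ :=
  Sym2.lift ⟨fun u v => openSegment ℝ (u : ℂ) v, fun u v => openSegment_symm ℝ (u : ℂ) v⟩

/-- The Euclidean length of an edge of the tree-graph. -/
def edgeLength : Sym2 L.Vert → ℝ :=
  Sym2.lift ⟨fun u v => dist (u : ℂ) v, fun u v => dist_comm (u : ℂ) v⟩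

/-! ### Faces and the dimer graph -/

/-- `C` is a simple closed curve that encircles the complete edges (they lie in its interior)
and passes through all the root vertices. -/
structure IsEncircledBy (C : Set ℂ) : Prop where
  curve : IsSimpleClosedCurve C
  roots : L.rootSet ⊆ C
  inside : ∀ x ∈ L.carrier, x ∉ C ∧ Bornology.IsBounded (connectedComponentIn Cᶜ x)

/-- The faces: the bounded components of the complement of the complete edges and `C`. -/
abbrev Face (C : Set ℂ) : Type :=
  {F : Set ℂ // F ∈ componentsOf (L.carrier ∪ C)ᶜ ∧ Bornology.IsBounded F}

variable {L} {C : Set ℂ}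

/-- The outer faces: those adjacent to `C` (elsewhere than at a root vertex). -/
def IsOuter (F : L.Face C) : Prop := (frontier F.1 ∩ (C \ L.rootSet)).Nonempty

/-- The portion of the complete edge `e.2` that borders the face `e.1`. -/
def portion (e : L.Face C × Fin n) : Set ℂ := L.seg e.2 ∩ frontier e.1.1

/-- The weight of an edge of the dimer graph: the Euclidean length of the portion. -/
def edgeWeight (e : L.Face C × Fin n) : ℝ := (μH[1] (portion e)).toReal

/-- The edges of the dimer graph: its white vertices are the faces other than the dual root, its
black vertices are the complete edges, and a face is adjacent to the complete edges of which it
contains a (nondegenerate) portion in its boundary. -/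
def dimerEdges (root : L.Face C) : Set (L.Face C × Fin n) :=
  {e | e.1 ≠ root ∧ ∃ x y : ℂ, x ≠ y ∧ segment ℝ x y ⊆ portion e}

/-- Perfect matchings of the dimer graph: each vertex is contained in exactly one edge. -/
structure IsMatching (root : L.Face C) (M : Set (L.Face C × Fin n)) : Prop where
  subset : M ⊆ dimerEdges root
  black : ∀ i, ∃! e, e ∈ M ∧ e.2 = i
  white : ∀ w, w ≠ root → ∃! e, e ∈ M ∧ e.1 = w

/-- The weight of a matching: the product of the weights of its edges. -/
def matchingWeight (M : Set (L.Face C × Fin n)) : ℝ := ∏ᶠ e ∈ M, edgeWeight e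

/-- The probability of a perfect matching, proportional to its weight. -/
def matchingProb (root : L.Face C) (M : Set (L.Face C × Fin n)) : ℝ :=
  matchingWeight M / ∑ᶠ M' ∈ {M' | IsMatching root M'}, matchingWeight M'

/-- A marked matching: a perfect matching together with, for each edge `e` of it, one of the
subsegments of the portion that belongs to `e`. -/
structure MarkedMatching (root : L.Face C) where
  edges : Set (L.Face C × Fin n)
  isMatching : IsMatching root edges
  mark : edges → Sym2 L.Vert
  mark_mem : ∀ e, mark e ∈ L.treeGraph.edgeSet
  mark_subset : ∀ e, L.subsegment (mark e) ⊆ portion e.1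

namespace MarkedMatching

variable {root : L.Face C} (M : MarkedMatching root)

/-- The probability of a marked matching: choose a random perfect matching and then, for each of
its edges independently, a subsegment with probability proportional to its length. -/
def prob : ℝ :=
  matchingProb root M.edges * ∏ᶠ e : M.edges, L.edgeLength (M.mark e) / edgeWeight e.1

/-- The undirected forest: all edges of the tree-graph except the marked ones. -/
def undirectedForest : SimpleGraph L.Vert := L.treeGraph.deleteEdges (Set.range M.mark)

/-- The forest with each edge oriented towards its root: `(u, v)` belongs to it if there is a
path to a root vertex that starts with the step from `u` to `v`. -/
def forest : Set (L.Vert × L.Vert) :=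
  {e | ∃ (h : M.undirectedForest.Adj e.1 e.2) (r : L.Vert) (p : M.undirectedForest.Walk e.2 r),
    L.IsRoot r ∧ (SimpleGraph.Walk.cons h p).IsPath}

end MarkedMatching

end SegmentFamily

end

noncomputable section
open MeasureTheory

/-! ### Components of the complement of a closed set -/

section Components

open Set

variable {K : Set ℂ} {p q : ℂ}

/-! Forests and marked matchings are both encoded by a selection `σ`: one piece to be removed from
each complete edge. In a spanning forest every inner vertex points to one of its two neighbours, and
two neighbouring vertices on a complete edge never point at each other. Along each complete edge the
arrows thus point away from exactly one piece, the missing one. Conversely, a selection makes every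
inner vertex flow away from the removed piece, and it gives a spanning forest exactly if this flow
always ends at a root (`IsGood`). On the other side, a marked matching is a selection together with
a bijection `φ` from the removed pieces to the faces other than the dual root, where each face lies
at a side of its piece (`IsFaceMatching`). The heart of the proof is that `σ` admits such a `φ` if
and only if it is good, and that `φ` is then unique.

If `σ` is good, the remaining figure is the curve with trees attached to it. It is connected and
does not separate the inside of the curve (`IsGood.hasLogOn_remaining`). The faces, joined across
the removed pieces, therefore form a tree (`IsGood.isTreeLike`), and the edges of a tree can be
matched with the vertices other than a given root in exactly one way, each edge with its end away
from the root (`exists_endMatching_cut`, `endMatching_unique`).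

If `σ` is not good, some orbit runs into a cycle, and the arms flowing into it enclose a bounded
region. In an innermost such region there are only removed pieces (`exists_innermost`), so the faces
there again form a tree and outnumber the removed pieces by one. The dual root is outer and hence
not among them, so they cannot all be matched (`isGood_of_endMatching`).

For the measures, an arrow along a piece has weight proportional to the inverse length of the piece,
with a factor that depends only on its tail. A forest thus has weight a constant times the product
of the removed lengths (`exists_forestWeight_eq`). Marked matchings have the same weights up to a
constant, and expanding products of portion lengths identifies the partition functions
(`sum_matchingWeight_eq`).

Planar separation is handled by continuous logarithms: points `p`, `q` off a closed set, `p` in a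
bounded complementary component, lie in the same component if and only if `(z - p) / (z - q)` has a
continuous logarithm on the set (`hasLogOn_div_of_mem_component`, `mem_component_of_hasLogOn`). -/

lemma isOpen_component_compl (hK : IsClosed K) (p : ℂ) : IsOpen (connectedComponentIn Kᶜ p) :=
  hK.isOpen_compl.connectedComponentIn

/-- A frontier point outside `K` would have an open component of its own that meets the given one,
hence equals it; but an open set contains none of its frontier points. -/
lemma frontier_component_subset (hK : IsClosed K) (p : ℂ) :
    frontier (connectedComponentIn Kᶜ p) ⊆ K := by
  intro x hx
  by_contra hxK
  have hU := isOpen_component_compl hK p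
  have hV := isOpen_component_compl hK x
  have hxV : x ∈ connectedComponentIn Kᶜ x := mem_connectedComponentIn hxK
  obtain ⟨y, hyV, hyU⟩ := mem_closure_iff.1 hx.1 _ hV hxV
  have h1 := connectedComponentIn_eq hyV
  have h2 := connectedComponentIn_eq hyU
  rw [h1, ← h2] at hxV
  exact hx.2 (by rwa [hU.interior_eq])

lemma closure_component_subset (hK : IsClosed K) (p : ℂ) :
    closure (connectedComponentIn Kᶜ p) ⊆ connectedComponentIn Kᶜ p ∪ K := by
  rw [closure_eq_self_union_frontier]
  exact union_subset_union_right _ (frontier_component_subset hK p)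

lemma subset_component_of_inter {S A : Set ℂ} (hA : IsPreconnected A) (hAS : A ⊆ S)
    (h : (A ∩ connectedComponentIn S p).Nonempty) : A ⊆ connectedComponentIn S p := by
  obtain ⟨x, hxA, hx⟩ := h
  rw [connectedComponentIn_eq hx]
  exact hA.subset_connectedComponentIn hxA hAS

lemma isPreconnected_compl_closedBall (R : ℝ) : IsPreconnected (Metric.closedBall (0 : ℂ) R)ᶜ := by
  rcases lt_or_ge R 0 with hR | hR
  · rw [Metric.closedBall_eq_empty.2 hR, compl_empty]
    exact isPreconnected_univ
  have h : (Metric.closedBall (0 : ℂ) R)ᶜ =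
      (fun x : ℝ × ℝ => (x.1 : ℂ) * Complex.exp (x.2 * Complex.I)) '' (Ioi R ×ˢ univ) := by
    ext z
    simp only [mem_compl_iff, Metric.mem_closedBall, dist_zero_right, not_le, mem_image, mem_prod,
      mem_Ioi, mem_univ, and_true, Prod.exists]
    constructor
    · intro hz
      exact ⟨‖z‖, z.arg, hz, Complex.norm_mul_exp_arg_mul_I z⟩
    · rintro ⟨r, t, hr, rfl⟩
      rw [norm_mul, Complex.norm_exp_ofReal_mul_I, mul_one, Complex.norm_real]
      exact lt_of_lt_of_le hr (le_abs_self r)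
  rw [h]
  refine (isPreconnected_Ioi.prod isPreconnected_univ).image _ (Continuous.continuousOn ?_)
  fun_prop

/-- The outside of a large disc is connected and avoids `K`, so every unbounded component contains
all of it. -/
lemma mem_component_of_unbounded (hK : Bornology.IsBounded K)
    (hp : ¬ Bornology.IsBounded (connectedComponentIn Kᶜ p))
    (hq : ¬ Bornology.IsBounded (connectedComponentIn Kᶜ q)) :
    connectedComponentIn Kᶜ p = connectedComponentIn Kᶜ q := by
  obtain ⟨R, hR⟩ := hK.subset_closedBall (0 : ℂ)
  have key : ∀ x, ¬ Bornology.IsBounded (connectedComponentIn Kᶜ x) →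
      (Metric.closedBall (0 : ℂ) R)ᶜ ⊆ connectedComponentIn Kᶜ x := by
    intro x hx
    apply subset_component_of_inter (isPreconnected_compl_closedBall R) (compl_subset_compl.2 hR)
    by_contra hne
    apply hx
    apply (Metric.isBounded_closedBall (x := (0 : ℂ)) (r := R)).subset
    intro y hy
    by_contra hyR
    exact hne ⟨y, hyR, hy⟩
  have hne : ((Metric.closedBall (0 : ℂ) R)ᶜ).Nonempty := by
    by_contra h
    rw [not_nonempty_iff_eq_empty, compl_empty_iff] at h
    exact NormedSpace.unbounded_univ ℝ ℂ (h ▸ Metric.isBounded_closedBall)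
  obtain ⟨y, hy⟩ := hne
  rw [connectedComponentIn_eq (key p hp hy), connectedComponentIn_eq (key q hq hy)]

/-- What lies outside one component is `K` together with the closures of the other components, and
each of these closures meets the connected set `K` in a frontier point. -/
lemma isPreconnected_compl_component (hK : IsClosed K) (hc : IsConnected K) (p : ℂ) :
    IsPreconnected (connectedComponentIn Kᶜ p)ᶜ := by
  obtain ⟨x, hx⟩ := hc.nonempty
  have hKU : K ⊆ (connectedComponentIn Kᶜ p)ᶜ := fun y hy hyU =>
    connectedComponentIn_subset _ _ hyU hy
  have hUo := isOpen_component_compl hK p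
  refine isPreconnected_of_forall x fun y hy => ?_
  by_cases hyK : y ∈ K
  · exact ⟨K, hKU, hx, hyK, hc.isPreconnected⟩
  have hyV : y ∈ connectedComponentIn Kᶜ y := mem_connectedComponentIn hyK
  have hVU : connectedComponentIn Kᶜ y ⊆ (connectedComponentIn Kᶜ p)ᶜ := by
    intro z hz hzU
    apply hy
    rw [connectedComponentIn_eq hzU, ← connectedComponentIn_eq hz]
    exact hyV
  have hclos := hUo.isClosed_compl.closure_subset_iff.2 hVU
  refine ⟨K ∪ closure (connectedComponentIn Kᶜ y), union_subset hKU hclos, Or.inl hx,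
    Or.inr (subset_closure hyV), ?_⟩
  have hfr : (frontier (connectedComponentIn Kᶜ y)).Nonempty := by
    rw [nonempty_frontier_iff]
    refine ⟨⟨y, hyV⟩, fun h => ?_⟩
    exact connectedComponentIn_subset _ _ (h ▸ mem_univ x : x ∈ connectedComponentIn Kᶜ y) hx
  obtain ⟨w, hw⟩ := hfr
  exact hc.isPreconnected.union w (frontier_component_subset hK y hw) hw.1
    isPreconnected_connectedComponentIn.closure

lemma compl_component_subset_component (hK : IsClosed K) (hc : IsConnected K) {P : Set ℂ}
    (hP : P ⊆ connectedComponentIn Kᶜ p) {x : ℂ} (hx : x ∉ connectedComponentIn Kᶜ p) :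
    (connectedComponentIn Kᶜ p)ᶜ ⊆ connectedComponentIn Pᶜ x :=
  (isPreconnected_compl_component hK hc p).subset_connectedComponentIn hx
    (compl_subset_compl.2 hP)

/-- What surrounds a bounded complementary component is connected to infinity outside of it. -/
lemma not_isBounded_component_of_notMem (hK : IsClosed K) (hc : IsConnected K) {P : Set ℂ}
    (hU : Bornology.IsBounded (connectedComponentIn Kᶜ p))
    (hP : P ⊆ connectedComponentIn Kᶜ p) {x : ℂ} (hx : x ∉ connectedComponentIn Kᶜ p) :
    ¬ Bornology.IsBounded (connectedComponentIn Pᶜ x) := by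
  intro hb
  have h := hU.union (hb.subset (compl_component_subset_component hK hc hP hx))
  rw [union_compl_self] at h
  exact NormedSpace.unbounded_univ ℝ ℂ h

end Components

/-! ### Continuous logarithms -/

/-- The function `f` has a continuous logarithm on `K`. -/
def HasLogOn (K : Set ℂ) (f : ℂ → ℂ) : Prop :=
  ∃ g : ℂ → ℂ, ContinuousOn g K ∧ ∀ z ∈ K, Complex.exp (g z) = f z

section Logarithms

open Set Topology

variable {K : Set ℂ} {p q : ℂ} {f f₁ f₂ : ℂ → ℂ}

lemma HasLogOn.congr (h : HasLogOn K f₁) (hf : ∀ z ∈ K, f₁ z = f₂ z) : HasLogOn K f₂ := by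
  obtain ⟨g, hg, hgf⟩ := h
  exact ⟨g, hg, fun z hz => (hgf z hz).trans (hf z hz)⟩

lemma HasLogOn.mul (h₁ : HasLogOn K f₁) (h₂ : HasLogOn K f₂) :
    HasLogOn K fun z => f₁ z * f₂ z := by
  obtain ⟨g₁, hg₁, hgf₁⟩ := h₁
  obtain ⟨g₂, hg₂, hgf₂⟩ := h₂
  exact ⟨fun z => g₁ z + g₂ z, hg₁.add hg₂, fun z hz => by
    rw [Complex.exp_add, hgf₁ z hz, hgf₂ z hz]⟩

lemma HasLogOn.inv (h : HasLogOn K f) : HasLogOn K fun z => (f z)⁻¹ := by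
  obtain ⟨g, hg, hgf⟩ := h
  exact ⟨fun z => -g z, hg.neg, fun z hz => by rw [Complex.exp_neg, hgf z hz]⟩

lemma hasLogOn_of_mem_slitPlane (hf : ContinuousOn f K) (h : ∀ z ∈ K, f z ∈ Complex.slitPlane) :
    HasLogOn K f :=
  ⟨fun z => Complex.log (f z), hf.clog h, fun z hz =>
    Complex.exp_log (Complex.slitPlane_ne_zero (h z hz))⟩

/-- Two continuous logarithms on a preconnected set differ by a constant. -/
lemma sub_eq_sub_of_exp_eq {X : Type*} [TopologicalSpace X] {S : Set X} (hS : IsPreconnected S)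
    {g₁ g₂ : X → ℂ} (h₁ : ContinuousOn g₁ S) (h₂ : ContinuousOn g₂ S)
    (h : ∀ z ∈ S, Complex.exp (g₁ z) = Complex.exp (g₂ z)) {x y : X} (hx : x ∈ S) (hy : y ∈ S) :
    g₁ x - g₂ x = g₁ y - g₂ y := by
  refine hS.induction₂ (fun x y => g₁ x - g₂ x = g₁ y - g₂ y) ?_
    -- It suffices that the difference is locally constant: it takes values in the multiples of
    -- `2πi`, so two values at distance less than `π` coincide.
    (fun x y z _ _ _ h h' => h.trans h') (fun x y _ _ h => h.symm) hx hy
  intro x hx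
  have hc : ContinuousWithinAt (fun y => g₁ y - g₂ y) S x := (h₁ x hx).sub (h₂ x hx)
  filter_upwards [hc (Metric.ball_mem_nhds _ Real.pi_pos), self_mem_nhdsWithin] with y hy hyS
  obtain ⟨m, hm⟩ := Complex.exp_eq_exp_iff_exists_int.1 (h x hx)
  obtain ⟨k, hk⟩ := Complex.exp_eq_exp_iff_exists_int.1 (h y hyS)
  have hm' : g₁ x - g₂ x = m * (2 * Real.pi * Complex.I) := by rw [hm]; ring
  have hk' : g₁ y - g₂ y = k * (2 * Real.pi * Complex.I) := by rw [hk]; ring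
  rw [hm', hk']
  have hd : dist (g₁ y - g₂ y) (g₁ x - g₂ x) < Real.pi := hy
  rw [hm', hk', dist_eq_norm, ← sub_mul, norm_mul] at hd
  have h2 : ‖(2 * Real.pi * Complex.I : ℂ)‖ = 2 * Real.pi := by
    simp [abs_of_pos Real.pi_pos]
  rw [h2, ← Int.cast_sub, Complex.norm_intCast] at hd
  have h3 : |((k - m : ℤ) : ℝ)| < 1 := by
    have := Real.pi_pos
    nlinarith
  have h4 : k - m = 0 := by
    rw [← Int.cast_abs] at h3
    exact Int.abs_lt_one_iff.1 (by exact_mod_cast h3)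
  rw [show k = m by omega]

/-- A continuous logarithm extends over sets which meet in at most one point. -/
lemma HasLogOn.union {K₁ K₂ : Set ℂ} (h₁ : HasLogOn K₁ f) (h₂ : HasLogOn K₂ f)
    (hK₁ : IsClosed K₁) (hK₂ : IsClosed K₂) (x : ℂ) (hx : K₁ ∩ K₂ ⊆ {x}) :
    HasLogOn (K₁ ∪ K₂) f := by
  classical
  obtain ⟨g₁, hg₁, hf₁⟩ := h₁
  obtain ⟨g₂, hg₂, hf₂⟩ := h₂
  by_cases hx' : x ∈ K₁ ∩ K₂
  -- Both logarithms exponentiate to `f x` at the common point, so shifting `g₂` by `g₁ x - g₂ x`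
  -- keeps it a logarithm and makes the two agree there.
  · refine ⟨fun z => if z ∈ K₁ then g₁ z else g₂ z + (g₁ x - g₂ x), ?_, ?_⟩
    · have e₁ : EqOn (fun z => if z ∈ K₁ then g₁ z else g₂ z + (g₁ x - g₂ x)) g₁ K₁ :=
        fun z hz => by simp [hz]
      have e₂ : EqOn (fun z => if z ∈ K₁ then g₁ z else g₂ z + (g₁ x - g₂ x))
          (fun z => g₂ z + (g₁ x - g₂ x)) K₂ := fun z hz => by
        by_cases hz₁ : z ∈ K₁
        · have : z = x := hx ⟨hz₁, hz⟩
          subst this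
          simp [hz₁]
        · simp [hz₁]
      exact (hg₁.congr e₁).union_of_isClosed ((hg₂.add continuousOn_const).congr e₂) hK₁ hK₂
    · intro z hz
      by_cases hz₁ : z ∈ K₁
      · simp [hz₁, hf₁]
      · have hz₂ : z ∈ K₂ := hz.resolve_left hz₁
        simp only [hz₁, if_false]
        rw [Complex.exp_add, Complex.exp_sub, hf₁ x hx'.1, hf₂ x hx'.2, hf₂ z hz₂,
          div_self, mul_one]
        rw [← hf₁ x hx'.1]
        exact Complex.exp_ne_zero _
  · have hemp : ∀ z, z ∈ K₁ → z ∉ K₂ := fun z hz hz' => hx' (by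
      have : z = x := hx ⟨hz, hz'⟩
      exact this ▸ ⟨hz, hz'⟩)
    refine ⟨fun z => if z ∈ K₁ then g₁ z else g₂ z, ?_, ?_⟩
    · have e₁ : EqOn (fun z => if z ∈ K₁ then g₁ z else g₂ z) g₁ K₁ := fun z hz => by simp [hz]
      have e₂ : EqOn (fun z => if z ∈ K₁ then g₁ z else g₂ z) g₂ K₂ := fun z hz => by
        have : z ∉ K₁ := fun h => hemp z h hz
        simp [this]
      exact (hg₁.congr e₁).union_of_isClosed (hg₂.congr e₂) hK₁ hK₂
    · rintro z (hz | hz)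
      · simp [hz, hf₁]
      · have : z ∉ K₁ := fun h => hemp z h hz
        simp [this, hf₂ z hz]

/-- A nowhere vanishing function on a simply connected space has a continuous logarithm. -/
lemma exists_continuous_log {X : Type*} [TopologicalSpace X] [SimplyConnectedSpace X]
    [LocallyPathConnectedSpace X] {f : X → ℂ} (hf : Continuous f) (h0 : ∀ x, f x ≠ 0) :
    ∃ g : X → ℂ, Continuous g ∧ ∀ x, Complex.exp (g x) = f x := by
  obtain ⟨x₀⟩ : Nonempty X := inferInstance
  obtain ⟨g, ⟨-, hg⟩, -⟩ := Complex.isCoveringMapOn_exp.existsUnique_continuousMap_lifts ⟨f, hf⟩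
    (Complex.exp_log (h0 x₀)) h0
  exact ⟨g, g.continuous, fun x => congrFun hg x⟩

/-- A nowhere vanishing function on a closed segment has a continuous logarithm. -/
lemma hasLogOn_segment {u v : ℂ} (huv : u ≠ v) (hf : ContinuousOn f (segment ℝ u v))
    (h0 : ∀ z ∈ segment ℝ u v, f z ≠ 0) : HasLogOn (segment ℝ u v) f := by
  have hr : ∀ t : ℝ, AffineMap.lineMap u v (projIcc (0 : ℝ) 1 zero_le_one t : ℝ) ∈ segment ℝ u v := by
    intro t
    rw [segment_eq_image_lineMap]
    exact mem_image_of_mem _ (projIcc (0 : ℝ) 1 zero_le_one t).2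
  obtain ⟨g, hg, hgf⟩ := exists_continuous_log
    (f := fun t : ℝ => f (AffineMap.lineMap u v (projIcc (0 : ℝ) 1 zero_le_one t : ℝ)))
    (hf.comp_continuous (by
      have : Continuous fun t : ℝ => ((projIcc (0 : ℝ) 1 zero_le_one t : Icc (0 : ℝ) 1) : ℝ) :=
        continuous_subtype_val.comp continuous_projIcc
      exact (AffineMap.lineMap_continuous (R := ℝ) (p := u) (q := v)).comp this) hr)
    (fun t => h0 _ (hr t))
  have hvu : v - u ≠ 0 := sub_ne_zero.2 huv.symm
  -- The real part of `(z - u) / (v - u)` recovers the parameter of a point of the segment and is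
  -- defined on the whole plane.
  refine ⟨fun z => g ((z - u) / (v - u)).re, Continuous.continuousOn (by fun_prop), ?_⟩
  intro z hz
  rw [segment_eq_image_lineMap] at hz
  obtain ⟨t, ht, rfl⟩ := hz
  have h1 : ((AffineMap.lineMap u v t - u) / (v - u)) = (t : ℂ) := by
    rw [AffineMap.lineMap_apply_module']
    rw [add_sub_cancel_right, Complex.real_smul, mul_div_cancel_right₀ _ hvu]
  simp only [h1, Complex.ofReal_re]
  rw [hgf, projIcc_of_mem _ ht]

/-- Two points in the same complementary component have a quotient with a logarithm. -/
lemma hasLogOn_div_of_mem_component (hK : IsClosed K) (hp : p ∉ K)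
    (hq : q ∈ connectedComponentIn Kᶜ p) : HasLogOn K fun z => (z - p) / (z - q) := by
  have hsub := connectedComponentIn_subset Kᶜ p
  have hne : ∀ {x z : ℂ}, x ∈ connectedComponentIn Kᶜ p → z ∈ K → z - x ≠ 0 := by
    intro x z hx hz h
    exact hsub hx (sub_eq_zero.1 h ▸ hz)
  refine isPreconnected_connectedComponentIn.induction₂
    (fun p q => HasLogOn K fun z => (z - p) / (z - q)) ?_ ?_ ?_ (mem_connectedComponentIn hp) hq
  · intro x hx
    obtain ⟨ε, hε, hball⟩ := Metric.isOpen_iff.1 hK.isOpen_compl x (hsub hx)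
    filter_upwards [mem_nhdsWithin_of_mem_nhds (Metric.ball_mem_nhds x (half_pos hε)),
      self_mem_nhdsWithin] with y hy hyU
    apply hasLogOn_of_mem_slitPlane
    · exact ContinuousOn.div (by fun_prop) (by fun_prop) fun z hz => hne hyU hz
    · intro z hz
      -- For `y` within `ε / 2` of `x` this quotient differs from `1` by less than `1`, so the
      -- principal logarithm applies.
      have h1 : (z - x) / (z - y) = 1 + (y - x) / (z - y) := by
        have := hne hyU hz
        field_simp
        ring
      rw [h1]
      apply Complex.mem_slitPlane_of_norm_lt_one
      rw [norm_div, div_lt_one (norm_pos_iff.2 (hne hyU hz))]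
      have hzx : ε ≤ dist z x := by
        by_contra h
        exact hball (not_le.1 h) hz
      rw [← dist_eq_norm, ← dist_eq_norm]
      have := dist_triangle z y x
      have hy' : dist y x < ε / 2 := hy
      linarith
  · intro x y w hx hy hw h1 h2
    refine (h1.mul h2).congr fun z hz => ?_
    have := hne hy hz
    have := hne hw hz
    field_simp
  · intro x y hx hy h
    refine h.inv.congr fun z hz => ?_
    rw [inv_div]

/-- If a product of powers of `z - p` and `z - q` has a logarithm on `K`, the complementary
component of `p` is bounded and does not contain `q`, then the exponent of `z - p` vanishes. -/
lemma eq_zero_of_hasLogOn (hK : IsClosed K) (hp : p ∉ K) (hqK : q ∉ K)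
    (hb : Bornology.IsBounded (connectedComponentIn Kᶜ p))
    (hq : q ∉ connectedComponentIn Kᶜ p) {l k : ℤ}
    (h : HasLogOn K fun z => (z - p) ^ l * (z - q) ^ k) : l = 0 := by
  classical
  set U := connectedComponentIn Kᶜ p with hU
  have hUo : IsOpen U := isOpen_component_compl hK p
  have hpU : p ∈ U := mem_connectedComponentIn hp
  obtain ⟨g, hg, hgf⟩ := h
  -- The Tietze theorem extends the logarithm to the plane. Gluing its exponential, corrected by a
  -- power of `z - q`, inside `U` with `(z - p) ^ l` outside gives a continuous nowhere vanishing
  -- function on the plane.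
  obtain ⟨G, hG⟩ := ContinuousMap.exists_restrict_eq hK ⟨K.domRestrict g, hg.domRestrict⟩
  have hGg : ∀ z ∈ K, G z = g z := fun z hz => by simpa using congr($hG ⟨z, hz⟩)
  have hqcl : ∀ z ∈ closure U, z - q ≠ 0 := by
    intro z hz h0
    rcases closure_component_subset hK p hz with h' | h'
    · exact hq (sub_eq_zero.1 h0 ▸ h')
    · exact hqK (sub_eq_zero.1 h0 ▸ h')
  have hpcl : ∀ z ∈ closure Uᶜ, z - p ≠ 0 := by
    intro z hz h0
    rw [hUo.isClosed_compl.closure_eq] at hz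
    exact hz (sub_eq_zero.1 h0 ▸ hpU)
  set F : ℂ → ℂ := U.piecewise (fun z => Complex.exp (G z) * (z - q) ^ (-k)) (fun z => (z - p) ^ l)
    with hF
  have hFc : Continuous F := by
    apply continuous_piecewise
    · intro z hz
      have hzK : z ∈ K := frontier_component_subset hK p hz
      rw [hGg z hzK, hgf z hzK, mul_assoc, ← zpow_add₀ (hqcl z hz.1)]
      simp
    · apply ContinuousOn.mul (by fun_prop)
      exact ContinuousOn.zpow₀ (by fun_prop) _ fun z hz => Or.inl (hqcl z hz)
    · exact ContinuousOn.zpow₀ (by fun_prop) _ fun z hz => Or.inl (hpcl z hz)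
  have hF0 : ∀ z, F z ≠ 0 := by
    intro z
    by_cases hz : z ∈ U
    · rw [hF, piecewise_eq_of_mem _ _ _ hz]
      exact mul_ne_zero (Complex.exp_ne_zero _) (zpow_ne_zero _ (hqcl z (subset_closure hz)))
    · rw [hF, piecewise_eq_of_notMem _ _ _ hz]
      exact zpow_ne_zero _ (hpcl z (subset_closure hz))
  obtain ⟨H, hH, hHF⟩ := exists_continuous_log hFc hF0
  obtain ⟨R, hR⟩ := hb.subset_ball p
  have hR0 : 0 < R := by
    have := hR hpU
    simpa using this
  have hout : ∀ t : ℝ, p + R * Complex.exp (t * Complex.I) ∉ U := by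
    intro t ht
    have := hR ht
    rw [Metric.mem_ball, dist_eq_norm, add_sub_cancel_left, norm_mul,
      Complex.norm_exp_ofReal_mul_I, mul_one, Complex.norm_real, Real.norm_eq_abs,
      abs_of_pos hR0] at this
    exact lt_irrefl _ this
  have hexp : ∀ t : ℝ, Complex.exp (H (p + R * Complex.exp (t * Complex.I))) =
      Complex.exp (l * (Real.log R + t * Complex.I)) := by
    intro t
    rw [hHF, hF, piecewise_eq_of_notMem _ _ _ (hout t), Complex.exp_int_mul, Complex.exp_add,
      ← Complex.ofReal_exp, Real.exp_log hR0, add_sub_cancel_left]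
  -- On a circle about `p` that avoids `U` the glued function is `(z - p) ^ l`, which winds `l`
  -- times; a function with a global logarithm does not wind.
  have := sub_eq_sub_of_exp_eq (X := ℝ) isPreconnected_univ
    (g₁ := fun t : ℝ => H (p + R * Complex.exp (t * Complex.I)))
    (g₂ := fun t : ℝ => l * (Real.log R + t * Complex.I))
    (Continuous.continuousOn (by fun_prop)) (Continuous.continuousOn (by fun_prop))
    (fun t _ => hexp t) (mem_univ 0) (mem_univ (2 * Real.pi))
  simp only [Complex.ofReal_zero, zero_mul, Complex.exp_zero, Complex.ofReal_mul,
    Complex.ofReal_ofNat, Complex.exp_two_pi_mul_I, add_zero] at this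
  have h2 : (l : ℂ) * (2 * Real.pi * Complex.I) = 0 := by linear_combination this
  rcases mul_eq_zero.1 h2 with h3 | h3
  · exact_mod_cast h3
  · exact absurd h3 Complex.two_pi_I_ne_zero

/-- A function on a simple closed curve is determined by a function of the parameter. -/
lemma exists_continuousMap_comp_circle {γ : Circle → ℂ} (hγ : Continuous γ)
    (hinj : Function.Injective γ) {h : ℝ → ℂ} (hh : Continuous h)
    (hper : ∀ t, h (t + 2 * Real.pi) = h t) :
    ∃ g : ℂ → ℂ, Continuous g ∧ ∀ t, g (γ (Circle.exp t)) = h t := by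
  have hq : Topology.IsQuotientMap Circle.exp :=
    Circle.isCoveringMap_exp.isQuotientMap Circle.exp_surjective
  have hperZ : ∀ (m : ℤ) t, h (t + m * (2 * Real.pi)) = h t := fun m t =>
    (show Function.Periodic h (2 * Real.pi) from hper).int_mul m t
  have hfac : ∀ s t, Circle.exp s = Circle.exp t → h s = h t := by
    intro s t hst
    obtain ⟨m, rfl⟩ := Circle.exp_eq_exp.1 hst
    exact hperZ m t
  let hb : Circle → ℂ := fun z => h (Function.surjInv Circle.exp_surjective z)
  have hbe : hb ∘ Circle.exp = h := by
    ext t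
    exact hfac _ _ (Function.surjInv_eq Circle.exp_surjective _)
  have hbc : Continuous hb := by
    rw [hq.continuous_iff, hbe]
    exact hh
  obtain ⟨g, hg⟩ := ContinuousMap.exists_extension' (hγ.isClosedEmbedding hinj) ⟨hb, hbc⟩
  refine ⟨g, g.continuous, fun t => ?_⟩
  have h1 := congrFun hg (Circle.exp t)
  have h2 := congrFun hbe t
  simp only [Function.comp_apply, ContinuousMap.coe_mk] at h1 h2
  rw [h1, h2]

/-- A nowhere vanishing function on a closed curve has a degree. -/
lemma exists_degree {γ : Circle → ℂ} (hγ : Continuous γ) {f : ℂ → ℂ}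
    (hf : ContinuousOn f (range γ)) (h0 : ∀ z ∈ range γ, f z ≠ 0) :
    ∃ (d : ℤ) (H : ℝ → ℂ), Continuous H ∧ (∀ t, Complex.exp (H t) = f (γ (Circle.exp t))) ∧
      ∀ t, H (t + 2 * Real.pi) = H t + d * (2 * Real.pi * Complex.I) := by
  obtain ⟨H, hH, hHf⟩ := exists_continuous_log (f := fun t : ℝ => f (γ (Circle.exp t)))
    (hf.comp_continuous (by fun_prop) fun t => mem_range_self _) (fun t => h0 _ (mem_range_self _))
  have hper : ∀ t, Complex.exp (H (t + 2 * Real.pi)) = Complex.exp (H t) := by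
    intro t
    rw [hHf, hHf]
    congr 2
    rw [Circle.exp_eq_exp]
    exact ⟨1, by simp⟩
  obtain ⟨d, hd⟩ := Complex.exp_eq_exp_iff_exists_int.1 (hper 0)
  refine ⟨d, H, hH, hHf, fun t => ?_⟩
  have := sub_eq_sub_of_exp_eq (X := ℝ) isPreconnected_univ
    (g₁ := fun t : ℝ => H (t + 2 * Real.pi)) (g₂ := H)
    (Continuous.continuousOn (by fun_prop)) hH.continuousOn (fun t _ => hper t) (mem_univ t)
    (mem_univ 0)
  rw [hd] at this
  linear_combination this

/-- The inside of a simple closed curve is connected. -/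
lemma IsSimpleClosedCurve.mem_component {C : Set ℂ} (hC : IsSimpleClosedCurve C) {p q : ℂ}
    (hp : p ∉ C) (hq : q ∉ C) (hpb : Bornology.IsBounded (connectedComponentIn Cᶜ p))
    (hqb : Bornology.IsBounded (connectedComponentIn Cᶜ q)) :
    q ∈ connectedComponentIn Cᶜ p := by
  obtain ⟨γ, hγ, hinj, rfl⟩ := hC
  have hcl : IsClosed (range γ) := (isCompact_range hγ).isClosed
  by_contra hqp
  have hne : ∀ {x}, x ∉ range γ → ∀ z ∈ range γ, z - x ≠ 0 := fun hx z hz h0 =>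
    hx (sub_eq_zero.1 h0 ▸ hz)
  obtain ⟨d, H, hH, hHf, hd⟩ := exists_degree hγ (f := fun z => z - p) (by fun_prop) (hne hp)
  obtain ⟨e, J, hJ, hJf, he⟩ := exists_degree hγ (f := fun z => z - q) (by fun_prop) (hne hq)
  -- With `d` and `e` the degrees of `z - p` and `z - q`, the exponents `e` and `-d` make the total
  -- degree zero, so the logarithm along the parameter closes up.
  have hlog : HasLogOn (range γ) fun z => (z - p) ^ e * (z - q) ^ (-d) := by
    obtain ⟨g, hg, hgh⟩ := exists_continuousMap_comp_circle hγ hinj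
      (h := fun t => e * H t + (-d : ℤ) * J t) (by fun_prop) (fun t => by
        rw [hd, he]
        push_cast
        ring)
    refine ⟨g, hg.continuousOn, ?_⟩
    rintro _ ⟨ζ, rfl⟩
    obtain ⟨t, rfl⟩ := Circle.exp_surjective ζ
    rw [hgh, Complex.exp_add, Complex.exp_int_mul, Complex.exp_int_mul, hHf, hJf]
  have he0 : e = 0 := eq_zero_of_hasLogOn hcl hp hq hpb hqp hlog
  -- Since `e = 0`, the factor `z - q` alone has a logarithm. The same criterion with `p` and `q`
  -- exchanged then forces the exponent `1` to vanish.
  have hlogq : HasLogOn (range γ) fun z => (z - q) ^ (1 : ℤ) * (z - p) ^ (0 : ℤ) := by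
    obtain ⟨g, hg, hgh⟩ := exists_continuousMap_comp_circle hγ hinj hJ (fun t => by
        rw [he, he0]
        simp)
    refine ⟨g, hg.continuousOn, ?_⟩
    rintro _ ⟨ζ, rfl⟩
    obtain ⟨t, rfl⟩ := Circle.exp_surjective ζ
    rw [hgh, hJf]
    simp
  refine one_ne_zero (eq_zero_of_hasLogOn hcl hq hp hqb (fun h => hqp ?_) hlogq)
  rw [← connectedComponentIn_eq h]
  exact mem_connectedComponentIn hq

/-- Otherwise `eq_zero_of_hasLogOn` with exponents `1` and `-1` would give `1 = 0`. -/
lemma mem_component_of_hasLogOn (hK : IsClosed K) (hp : p ∉ K) (hq : q ∉ K)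
    (hb : Bornology.IsBounded (connectedComponentIn Kᶜ p))
    (h : HasLogOn K fun z => (z - p) / (z - q)) : q ∈ connectedComponentIn Kᶜ p := by
  by_contra hqp
  refine one_ne_zero (eq_zero_of_hasLogOn (l := 1) (k := -1) hK hp hq hb hqp (h.congr ?_))
  intro z _
  rw [zpow_one, zpow_neg_one, div_eq_mul_inv]

end Logarithms

/-! ### The two sides of an edge -/

section Sides

open Set Topology

lemma mem_openSegment_iff_exists {u v z : ℂ} :
    z ∈ openSegment ℝ u v ↔ ∃ a ∈ Ioo (0 : ℝ) 1, u + a * (v - u) = z := by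
  rw [openSegment_eq_image']
  simp only [mem_image, Complex.real_smul]

lemma union_openSegment_eq {Q : Set ℂ} {u v : ℂ} (hu : u ∈ Q) (hv : v ∈ Q) :
    Q ∪ openSegment ℝ u v = Q ∪ segment ℝ u v := by
  apply Subset.antisymm (union_subset_union_right _ (openSegment_subset_segment ℝ u v))
  rw [← insert_endpoints_openSegment]
  rintro x (hx | rfl | rfl | hx)
  exacts [Or.inl hx, Or.inl hu, Or.inl hv, Or.inr hx]

lemma isClosed_segment (u v : ℂ) : IsClosed (segment ℝ u v) := by
  rw [segment_eq_image']
  exact (isCompact_Icc.image (by fun_prop)).isClosed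

/-- The two sides of a segment whose ends are joined by a closed connected set lie in different
complementary components. -/
lemma notMem_component_of_crossing {Q : Set ℂ} (hQ : IsClosed Q) (hQc : IsPreconnected Q)
    {u v m : ℂ} (hu : u ∈ Q) (hv : v ∈ Q) (huv : u ≠ v) {a δ : ℝ} (ha : a ∈ Ioo (0 : ℝ) 1)
    (hm : m = u + a * (v - u)) (hδ : 0 < δ)
    (hseg : ∀ t : ℝ, |t| ≤ δ → m + t * Complex.I * (v - u) ∉ Q) :
    m - δ * Complex.I * (v - u) ∉
      connectedComponentIn (Q ∪ openSegment ℝ u v)ᶜ (m + δ * Complex.I * (v - u)) := by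
  -- If the two points could be joined, the quotient `ζ` below would have a logarithm `g` on the
  -- figure. Off the crossing point `m` it agrees with the principal logarithm up to one constant,
  -- because the punctured figure is still connected through `Q`. Comparing the limits at `m` from
  -- the two sides gives a contradiction.
  intro hmem
  have hd : v - u ≠ 0 := sub_ne_zero.2 huv.symm
  have hcl : IsClosed (Q ∪ openSegment ℝ u v) := by
    rw [union_openSegment_eq hu hv]
    exact hQ.union (isClosed_segment u v)
  have hp : m + δ * Complex.I * (v - u) ∉ Q ∪ openSegment ℝ u v := fun h => by
    have := connectedComponentIn_nonempty_iff.1 ⟨_, hmem⟩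
    exact this h
  obtain ⟨g, hg, hgf⟩ := hasLogOn_div_of_mem_component hcl hp hmem
  set ζ : ℂ → ℂ := fun z => (z - (m + δ * Complex.I * (v - u))) / (z - (m - δ * Complex.I * (v - u)))
    with hζ
  -- the coordinate along the segment
  have hcoord : ∀ x y : ℝ, ζ (m + x * (v - u) + y * Complex.I * (v - u)) =
      (x + (y - δ) * Complex.I) / (x + (y + δ) * Complex.I) := by
    intro x y
    rw [hζ]
    have e1 : m + x * (v - u) + y * Complex.I * (v - u) - (m + δ * Complex.I * (v - u)) =
      (x + (y - δ) * Complex.I) * (v - u) := by ring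
    have e2 : m + x * (v - u) + y * Complex.I * (v - u) - (m - δ * Complex.I * (v - u)) =
      (x + (y + δ) * Complex.I) * (v - u) := by ring
    simp only [e1, e2]
    rw [mul_div_mul_right _ _ hd]
  -- The quotient is a nonpositive real or undefined only on the cross segment `x = 0`, `|y| ≤ δ`,
  -- which meets the figure in `m` alone.
  have hslit : ∀ x y : ℝ, (x ≠ 0 ∨ δ < |y|) →
      (x + (y - δ) * Complex.I) / (x + (y + δ) * Complex.I) ∈ Complex.slitPlane := by
    intro x y hxy
    have hN : 0 < x * x + (y + δ) * (y + δ) := by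
      rcases hxy with hx | hy
      · have := mul_self_pos.2 hx
        nlinarith [mul_self_nonneg (y + δ)]
      · have : y + δ ≠ 0 := by
          intro h0
          rw [show y = -δ by linarith, abs_neg, abs_of_pos hδ] at hy
          exact lt_irrefl _ hy
        nlinarith [mul_self_pos.2 this, mul_self_nonneg x]
    rw [Complex.mem_slitPlane_iff]
    rw [Complex.div_re, Complex.div_im, Complex.normSq_apply]
    simp only [Complex.add_re, Complex.ofReal_re, Complex.mul_re, Complex.sub_re, Complex.I_re,
      mul_zero, Complex.sub_im, Complex.ofReal_im, sub_self, Complex.I_im, mul_one, add_zero,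
      Complex.add_im, Complex.mul_im, zero_add]
    by_cases hx : x = 0
    · left
      have hy := hxy.resolve_left (not_not.2 hx)
      subst hx
      simp only [mul_zero, zero_div, zero_add] at hN ⊢
      apply div_pos _ hN
      have : δ * δ < y * y := by
        rw [← abs_mul_abs_self y]
        exact mul_self_lt_mul_self hδ.le hy
      nlinarith
    · right
      rw [← sub_div, div_ne_zero_iff]
      refine ⟨?_, hN.ne'⟩
      have : (y - δ) * x - x * (y + δ) = -(2 * (δ * x)) := by ring
      rw [this]
      exact neg_ne_zero.2 (mul_ne_zero two_ne_zero (mul_ne_zero hδ.ne' hx))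
  have hrep : ∀ z : ℂ, ∃ x y : ℝ, z = m + x * (v - u) + y * Complex.I * (v - u) := by
    intro z
    refine ⟨((z - m) / (v - u)).re, ((z - m) / (v - u)).im, ?_⟩
    have := Complex.re_add_im ((z - m) / (v - u))
    rw [eq_div_iff hd, add_mul] at this
    rw [add_assoc, this]
    ring
  -- the punctured set
  set S₁ : Set ℂ := (fun t : ℝ => u + t * (v - u)) '' Ico 0 a with hS₁
  set S₂ : Set ℂ := (fun t : ℝ => u + t * (v - u)) '' Ioc a 1 with hS₂
  have hS₁Q : S₁ ⊆ Q ∪ openSegment ℝ u v := by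
    rintro _ ⟨t, ht, rfl⟩
    rcases eq_or_lt_of_le ht.1 with h0 | h0
    · left; simpa [← h0] using hu
    · exact Or.inr (mem_openSegment_iff_exists.2 ⟨t, ⟨h0, ht.2.trans ha.2⟩, rfl⟩)
  have hS₂Q : S₂ ⊆ Q ∪ openSegment ℝ u v := by
    rintro _ ⟨t, ht, rfl⟩
    rcases eq_or_lt_of_le ht.2 with h0 | h0
    · left; simpa [h0] using hv
    · exact Or.inr (mem_openSegment_iff_exists.2 ⟨t, ⟨ha.1.trans ht.1, h0⟩, rfl⟩)
  have hTsub : Q ∪ S₁ ∪ S₂ ⊆ Q ∪ openSegment ℝ u v :=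
    union_subset (union_subset subset_union_left hS₁Q) hS₂Q
  have hTc : IsPreconnected (Q ∪ S₁ ∪ S₂) := by
    have h1 : IsPreconnected S₁ := isPreconnected_Ico.image _ (by fun_prop)
    have h2 : IsPreconnected S₂ := isPreconnected_Ioc.image _ (by fun_prop)
    have hu1 : u ∈ S₁ := ⟨0, ⟨le_rfl, ha.1⟩, by simp⟩
    have hv2 : v ∈ S₂ := ⟨1, ⟨ha.2, le_rfl⟩, by simp⟩
    exact (hQc.union u hu hu1 h1).union v (Or.inl hv) hv2 h2
  have hTslit : ∀ z ∈ Q ∪ S₁ ∪ S₂, ζ z ∈ Complex.slitPlane := by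
    rintro z ((hz | ⟨t, ht, rfl⟩) | ⟨t, ht, rfl⟩)
    · obtain ⟨x, y, rfl⟩ := hrep z
      rw [hcoord]
      apply hslit
      by_contra hxy
      push Not at hxy
      apply hseg y hxy.2
      simpa [hxy.1] using hz
    · have : u + t * (v - u) = m + ((t - a : ℝ) : ℂ) * (v - u) +
          ((0 : ℝ) : ℂ) * Complex.I * (v - u) := by
        rw [hm]; push_cast; ring
      simp only [this]
      rw [hcoord]
      exact hslit _ _ (Or.inl (sub_ne_zero.2 ht.2.ne))
    · have : u + t * (v - u) = m + ((t - a : ℝ) : ℂ) * (v - u) +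
          ((0 : ℝ) : ℂ) * Complex.I * (v - u) := by
        rw [hm]; push_cast; ring
      simp only [this]
      rw [hcoord]
      exact hslit _ _ (Or.inl (sub_ne_zero.2 ht.1.ne'))
  have hTζ : ContinuousOn ζ (Q ∪ S₁ ∪ S₂) := by
    refine ContinuousOn.div (by fun_prop) (by fun_prop) fun z hz h0 => ?_
    have := Complex.slitPlane_ne_zero (hTslit z hz)
    rw [hζ] at this
    simp [h0] at this
  -- Reflection in `m` inverts `ζ` on the segment, so the principal logarithms at the two points are
  -- opposite and their difference is twice one of them.
  have hdiff : ∀ x : ℝ, 0 < x → x < a → x < 1 - a →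
      2 * Complex.log (ζ (m + x * (v - u))) = g (m + x * (v - u)) - g (m - x * (v - u)) := by
    intro x hx0 hxa hxa'
    have h1 : m + x * (v - u) ∈ Q ∪ S₁ ∪ S₂ :=
      Or.inr ⟨a + x, ⟨by linarith, by linarith⟩, by rw [hm]; push_cast; ring⟩
    have h2 : m - x * (v - u) ∈ Q ∪ S₁ ∪ S₂ :=
      Or.inl (Or.inr ⟨a - x, ⟨by linarith, by linarith⟩, by rw [hm]; push_cast; ring⟩)
    have h := sub_eq_sub_of_exp_eq hTc (hg.mono hTsub) (hTζ.clog hTslit)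
      (fun z hz => by
        rw [hgf z (hTsub hz), Complex.exp_log (Complex.slitPlane_ne_zero (hTslit z hz))]) h1 h2
    have h3 : ζ (m - x * (v - u)) = (ζ (m + x * (v - u)))⁻¹ := by
      have e1 := hcoord x 0
      have e2 := hcoord (-x) 0
      simp only [Complex.ofReal_zero, zero_mul, add_zero, zero_sub, zero_add, Complex.ofReal_neg,
        neg_mul, ← sub_eq_add_neg] at e1 e2
      rw [e1, e2, inv_div, ← neg_div_neg_eq]
      congr 1 <;> ring
    rw [h3, Complex.log_inv _ (Complex.mem_slitPlane_iff_arg.1 (hTslit _ h1)).1] at h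
    linear_combination -h
  -- the limit at the puncture
  have hmem' : m ∈ Q ∪ openSegment ℝ u v := Or.inr (mem_openSegment_iff_exists.2 ⟨a, ha, hm.symm⟩)
  have hlim : ∀ s : ℝ, Filter.Tendsto (fun x : ℝ => g (m + (s * x : ℝ) * (v - u)))
      (𝓝[>] 0) (𝓝 (g m)) ∨ ¬ |s| = 1 := by
    intro s
    by_cases hs : |s| = 1
    swap
    · exact Or.inr hs
    left
    have hc : ContinuousWithinAt g (Q ∪ openSegment ℝ u v) m := hg m hmem'
    refine hc.tendsto.comp (tendsto_nhdsWithin_iff.2 ⟨?_, ?_⟩)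
    · have : Continuous fun x : ℝ => m + (s * x : ℝ) * (v - u) := by fun_prop
      have h := this.tendsto 0
      simp only [mul_zero, Complex.ofReal_zero, zero_mul, add_zero] at h
      exact h.mono_left nhdsWithin_le_nhds
    · have hmin : 0 < min a (1 - a) := lt_min ha.1 (sub_pos.2 ha.2)
      filter_upwards [Ioo_mem_nhdsGT hmin] with x hx
      refine Or.inr (mem_openSegment_iff_exists.2 ⟨a + s * x, ?_, by rw [hm]; push_cast; ring⟩)
      have h1 := lt_min_iff.1 hx.2
      have h2 : |s * x| = x := by rw [abs_mul, hs, one_mul, abs_of_pos hx.1]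
      have h3 := abs_le.1 h2.le
      exact ⟨by linarith [h3.1], by linarith [h3.2]⟩
  have hl1 := (hlim 1).resolve_right (by simp)
  have hl2 := (hlim (-1)).resolve_right (by simp)
  have hlog0 : Filter.Tendsto (fun x : ℝ => 2 * Complex.log (ζ (m + x * (v - u)))) (𝓝[>] 0)
      (𝓝 0) := by
    have h := hl1.sub hl2
    rw [sub_self] at h
    refine h.congr' ?_
    have hmin : 0 < min a (1 - a) := lt_min ha.1 (sub_pos.2 ha.2)
    filter_upwards [Ioo_mem_nhdsGT hmin] with x hx
    have h1 := lt_min_iff.1 hx.2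
    rw [hdiff x hx.1 h1.1 h1.2]
    congr 2
    · simp
    · push_cast; ring
  have hζ1 : Filter.Tendsto (fun x : ℝ => ζ (m + x * (v - u))) (𝓝[>] 0) (𝓝 1) := by
    have h := (hlog0.const_mul (1 / 2)).cexp
    rw [mul_zero, Complex.exp_zero] at h
    refine h.congr' ?_
    filter_upwards [self_mem_nhdsWithin] with x hx
    have hx' : (0 : ℝ) < x := hx
    rw [← mul_assoc, one_div, inv_mul_cancel₀ two_ne_zero, one_mul, Complex.exp_log]
    have e1 := hcoord x 0
    have := hslit x 0 (Or.inl hx'.ne')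
    rw [← e1] at this
    simpa using Complex.slitPlane_ne_zero this
  have hζ2 : Filter.Tendsto (fun x : ℝ => ζ (m + x * (v - u))) (𝓝[>] 0) (𝓝 (-1)) := by
    have hform : ∀ x : ℝ, ζ (m + x * (v - u)) = (x - δ * Complex.I) / (x + δ * Complex.I) := by
      intro x
      have e1 := hcoord x 0
      simpa [← sub_eq_add_neg] using e1
    simp only [hform]
    have hδ' : (δ : ℂ) * Complex.I ≠ 0 := mul_ne_zero (by exact_mod_cast hδ.ne') Complex.I_ne_zero
    have hc : ContinuousAt (fun x : ℝ => ((x : ℂ) - δ * Complex.I) / (x + δ * Complex.I)) 0 := by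
      apply ContinuousAt.div (by fun_prop) (by fun_prop)
      simpa using hδ'
    have h := hc.tendsto
    simp only [Complex.ofReal_zero, zero_sub, zero_add, neg_div, div_self hδ'] at h
    exact h.mono_left nhdsWithin_le_nhds
  -- Continuity of `g` at `m` forces the limit `1`, whereas the formula for `ζ` gives `-1`.
  have := tendsto_nhds_unique hζ1 hζ2
  norm_num at this

/-- An edge of a figure has two sides: connected strips in the complement that accumulate on the
edge, fill up a neighbourhood of it, and are separated by any closed connected part of the figure
that contains the ends of the edge, together with the edge. -/
lemma exists_sides {T : Set ℂ} (hT : IsClosed T) {u v : ℂ} (hu : u ∈ T) (hv : v ∈ T) (huv : u ≠ v)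
    (hdisj : Disjoint (openSegment ℝ u v) T) :
    ∃ A B : Set ℂ, IsConnected A ∧ IsConnected B ∧
      A ⊆ (T ∪ openSegment ℝ u v)ᶜ ∧ B ⊆ (T ∪ openSegment ℝ u v)ᶜ ∧
      openSegment ℝ u v ⊆ closure A ∧ openSegment ℝ u v ⊆ closure B ∧
      (∀ m ∈ openSegment ℝ u v, ∃ ρ > 0, Metric.ball m ρ ⊆ openSegment ℝ u v ∪ A ∪ B) ∧
      ∃ p ∈ A, ∃ q ∈ B, ∀ Q ⊆ T, IsClosed Q → IsPreconnected Q → u ∈ Q → v ∈ Q →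
        q ∉ connectedComponentIn (Q ∪ openSegment ℝ u v)ᶜ p := by
  have hd : v - u ≠ 0 := sub_ne_zero.2 huv.symm
  have hn : 0 < ‖v - u‖ := norm_pos_iff.2 hd
  have hTne : T.Nonempty := ⟨u, hu⟩
  set m : ℝ → ℂ := fun a => u + a * (v - u) with hm
  set D : ℝ → ℝ := fun a => Metric.infDist (m a) T with hD
  have hmc : Continuous m := by fun_prop
  have hDc : Continuous D := (Metric.continuous_infDist_pt T).comp hmc
  have hDpos : ∀ a ∈ Ioo (0 : ℝ) 1, 0 < D a := by
    intro a ha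
    refine (hT.notMem_iff_infDist_pos hTne).1 fun h => ?_
    exact disjoint_left.1 hdisj (mem_openSegment_iff_exists.2 ⟨a, ha, rfl⟩) h
  have hfar : ∀ a (t : ℝ), |t| * ‖v - u‖ < D a → m a + t * Complex.I * (v - u) ∉ T := by
    intro a t ht hmem
    have h1 := Metric.infDist_le_dist_of_mem (x := m a) hmem
    rw [dist_eq_norm, sub_add_cancel_left, norm_neg, norm_mul, norm_mul, Complex.norm_I, mul_one,
      Complex.norm_real, Real.norm_eq_abs] at h1
    exact absurd (h1.trans_lt ht) (lt_irrefl _)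
  -- The strip on side `s = ±1` consists of the points at distance `θ * D a` perpendicularly off `m
  -- a`, with `0 < θ < 1`; as `D a` is the distance to `T`, it avoids `T`.
  set Φ : ℝ → ℝ × ℝ → ℂ := fun s x => m x.1 + (s * x.2 * (D x.1 / ‖v - u‖) : ℝ) * Complex.I * (v - u)
    with hΦ
  have hΦc : ∀ s, Continuous (Φ s) := by
    intro s
    have : Continuous fun x : ℝ × ℝ => D x.1 := hDc.comp continuous_fst
    fun_prop
  set W : ℝ → Set ℂ := fun s => Φ s '' (Ioo (0 : ℝ) 1 ×ˢ Ioo (0 : ℝ) 1) with hW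
  have hWc : ∀ s, IsConnected (W s) := fun s =>
    ((isConnected_Ioo one_pos).prod (isConnected_Ioo one_pos)).image _ (hΦc s).continuousOn
  have hcoef : ∀ s : ℝ, |s| = 1 → ∀ a ∈ Ioo (0 : ℝ) 1, ∀ θ : ℝ, 0 ≤ θ →
      |s * θ * (D a / ‖v - u‖)| * ‖v - u‖ = θ * D a := by
    intro s hs a ha θ hθ
    rw [abs_mul, abs_mul, hs, one_mul, abs_of_nonneg hθ, abs_of_nonneg (div_nonneg (hDpos a ha).le hn.le),
      mul_assoc, div_mul_cancel₀ _ hn.ne']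
  have hWsub : ∀ s, |s| = 1 → W s ⊆ (T ∪ openSegment ℝ u v)ᶜ := by
    rintro s hs _ ⟨⟨a, θ⟩, ⟨ha, hθ⟩, rfl⟩ (hmem | hmem)
    · refine hfar a _ ?_ hmem
      rw [hcoef s hs a ha θ hθ.1.le]
      nlinarith [hDpos a ha, hθ.2]
    · obtain ⟨b, -, hb⟩ := mem_openSegment_iff_exists.1 hmem
      have h1 : ((b : ℂ) - a - (s * θ * (D a / ‖v - u‖) : ℝ) * Complex.I) * (v - u) = 0 := by
        simp only [hΦ, hm] at hb
        linear_combination hb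
      have h2 := (mul_eq_zero.1 h1).resolve_right hd
      have h3 := congrArg Complex.im h2
      simp only [Complex.sub_im, Complex.ofReal_im, Complex.mul_im, Complex.ofReal_re,
        Complex.I_im, mul_one, Complex.I_re, mul_zero, add_zero, sub_self, zero_sub,
        Complex.zero_im, neg_eq_zero] at h3
      have h4 := hcoef s hs a ha θ hθ.1.le
      rw [h3, abs_zero, zero_mul] at h4
      exact (mul_pos hθ.1 (hDpos a ha)).ne h4
  have hWcl : ∀ s, openSegment ℝ u v ⊆ closure (W s) := by
    intro s x hx
    obtain ⟨a, ha, rfl⟩ := mem_openSegment_iff_exists.1 hx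
    have h1 : Filter.Tendsto (fun θ : ℝ => Φ s (a, θ)) (𝓝[>] 0) (𝓝 (m a)) := by
      have hc : Continuous fun θ : ℝ => Φ s (a, θ) := (hΦc s).comp (by fun_prop)
      have h := hc.tendsto 0
      simp only [hΦ, mul_zero, zero_mul, Complex.ofReal_zero, add_zero] at h
      exact h.mono_left nhdsWithin_le_nhds
    refine mem_closure_of_tendsto h1 ?_
    filter_upwards [Ioo_mem_nhdsGT one_pos] with θ hθ
    exact ⟨(a, θ), ⟨ha, hθ⟩, rfl⟩
  have hnear : ∀ x ∈ openSegment ℝ u v, ∃ ρ > 0,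
      Metric.ball x ρ ⊆ openSegment ℝ u v ∪ W 1 ∪ W (-1) := by
    intro x hx
    obtain ⟨a, ha, rfl⟩ := mem_openSegment_iff_exists.1 hx
    -- Moving by less than `D a / 2` along the segment leaves a distance to `T` larger than `D a /
    -- 2`, so the perpendicular offset still fits into the strip.
    refine ⟨D a / 2, half_pos (hDpos a ha), fun z hz => ?_⟩
    set w := (z - m a) / (v - u) with hw
    have hwn : ‖w‖ * ‖v - u‖ < D a / 2 := by
      rw [hw, norm_div, div_mul_cancel₀ _ hn.ne', ← dist_eq_norm]
      exact hz
    have hre : |w.re| * ‖v - u‖ < D a / 2 :=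
      (mul_le_mul_of_nonneg_right (Complex.abs_re_le_norm w) hn.le).trans_lt hwn
    have him : |w.im| * ‖v - u‖ < D a / 2 :=
      (mul_le_mul_of_nonneg_right (Complex.abs_im_le_norm w) hn.le).trans_lt hwn
    have hz' : z = m (a + w.re) + w.im * Complex.I * (v - u) := by
      have h1 := Complex.re_add_im w
      have h2 : w * (v - u) = z - m a := by rw [hw, div_mul_cancel₀ _ hd]
      simp only [hm] at h2 ⊢
      push_cast
      linear_combination -h2 - (v - u) * h1
    have hDu : D a ≤ a * ‖v - u‖ := by
      have h := Metric.infDist_le_dist_of_mem (x := m a) hu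
      rwa [dist_eq_norm, hm, add_sub_cancel_left, norm_mul, Complex.norm_real, Real.norm_eq_abs,
        abs_of_pos ha.1] at h
    have hDv : D a ≤ (1 - a) * ‖v - u‖ := by
      have h := Metric.infDist_le_dist_of_mem (x := m a) hv
      have e : m a - v = ((-(1 - a) : ℝ) : ℂ) * (v - u) := by
        rw [hm]; push_cast; ring
      rwa [dist_eq_norm, e, norm_mul, Complex.norm_real, Real.norm_eq_abs, abs_neg,
        abs_of_pos (sub_pos.2 ha.2)] at h
    have hDa := hDpos a ha
    have hb : a + w.re ∈ Ioo (0 : ℝ) 1 := by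
      have h1 := abs_lt.1 (show |w.re| < a by
        by_contra h
        nlinarith [not_lt.1 h])
      have h2 := abs_lt.1 (show |w.re| < 1 - a by
        by_contra h
        nlinarith [not_lt.1 h])
      exact ⟨by linarith [h1.1], by linarith [h2.2]⟩
    have hDb : D a / 2 < D (a + w.re) := by
      have h := Metric.infDist_le_infDist_add_dist (x := m a) (y := m (a + w.re)) (s := T)
      have e : m a - m (a + w.re) = ((-w.re : ℝ) : ℂ) * (v - u) := by
        rw [hm]; push_cast; ring
      rw [dist_eq_norm, e, norm_mul, Complex.norm_real, Real.norm_eq_abs, abs_neg] at h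
      linarith
    have hDb0 := hDpos _ hb
    have hstrip : ∀ s : ℝ, |s| = 1 → s * |w.im| = w.im → w.im ≠ 0 → z ∈ W s := by
      intro s hs hsw hne
      refine ⟨(a + w.re, |w.im| * ‖v - u‖ / D (a + w.re)), ⟨hb, ?_, ?_⟩, ?_⟩
      · exact div_pos (mul_pos (abs_pos.2 hne) hn) hDb0
      · rw [div_lt_one hDb0]
        exact him.trans hDb
      · rw [hz']
        simp only [hΦ]
        congr 4
        field_simp
        linarith
    rcases lt_trichotomy w.im 0 with h | h | h
    · exact Or.inr (hstrip (-1) (by simp) (by rw [abs_of_neg h]; ring) h.ne)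
    · refine Or.inl (Or.inl (mem_openSegment_iff_exists.2 ⟨_, hb, ?_⟩))
      rw [hz', h]
      simp [hm]
    · exact Or.inl (Or.inr (hstrip 1 (by simp) (by rw [abs_of_pos h]; ring) h.ne'))
  have h2 : (1 / 2 : ℝ) ∈ Ioo (0 : ℝ) 1 := by constructor <;> norm_num
  refine ⟨W 1, W (-1), hWc _, hWc _, hWsub _ (by simp), hWsub _ (by simp), hWcl _, hWcl _, hnear,
    Φ 1 (1 / 2, 1 / 2), ⟨_, ⟨h2, h2⟩, rfl⟩, Φ (-1) (1 / 2, 1 / 2), ⟨_, ⟨h2, h2⟩, rfl⟩, ?_⟩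
  intro Q hQT hQ hQc huQ hvQ
  have hD2 := hDpos _ h2
  have h := notMem_component_of_crossing hQ hQc huQ hvQ huv h2 (m := m (1 / 2)) rfl
    (δ := 1 / 2 * (D (1 / 2) / ‖v - u‖)) (by positivity) (fun t ht hmem => by
      refine hfar (1 / 2) t ?_ (hQT hmem)
      calc |t| * ‖v - u‖ ≤ 1 / 2 * (D (1 / 2) / ‖v - u‖) * ‖v - u‖ :=
            mul_le_mul_of_nonneg_right ht hn.le
        _ = D (1 / 2) / 2 := by field_simp
        _ < D (1 / 2) := half_lt_self hD2)
  convert h using 2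
  · simp only [hΦ]
    push_cast
    ring_nf
  · simp only [hΦ]
    push_cast
    ring_nf

end Sides

/-! ### Matching the edges of a tree with its vertices -/

section TreeMatching

open Set

/-- A multigraph, given by the ends of its edges, that is a tree: it is connected, and each edge
is the only one that leaves some set of vertices. -/
structure IsTreeLike {W I : Type*} (l r : I → W) : Prop where
  connected : ∀ A : Set W, A.Nonempty → (∀ i, l i ∈ A ↔ r i ∈ A) → A = univ
  bridge : ∀ i, ∃ A : Set W, l i ∈ A ∧ r i ∉ A ∧ ∀ j, j ≠ i → (l j ∈ A ↔ r j ∈ A)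

/-- The edges are assigned to ends of theirs, distinct from each other and from `w₀`. -/
structure IsEndMatching {W I : Type*} (l r : I → W) (w₀ : W) (φ : I → W) : Prop where
  mem_ends : ∀ i, φ i = l i ∨ φ i = r i
  injective : Function.Injective φ
  ne_root : ∀ i, φ i ≠ w₀

variable {W I : Type*} {l r : I → W}

/-- The root and all ends of edges form a set that no edge leaves. -/
lemma IsTreeLike.finite [Finite I] (h : IsTreeLike l r) (w₀ : W) : Finite W := by
  have hA : ({w₀} ∪ (range l ∪ range r) : Set W) = univ := by
    apply h.connected _ ⟨w₀, Or.inl rfl⟩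
    intro i
    exact ⟨fun _ => Or.inr (Or.inr ⟨i, rfl⟩), fun _ => Or.inr (Or.inl ⟨i, rfl⟩)⟩
  rw [← finite_univ_iff, ← hA]
  exact (finite_singleton w₀).union ((finite_range l).union (finite_range r))

/-- A connected graph has at most one vertex more than edges; passing to a simple graph can only
lose edges. -/
lemma IsTreeLike.card_le [Finite I] (h : IsTreeLike l r) (w₀ : W) :
    Nat.card W ≤ Nat.card I + 1 := by
  classical
  have := h.finite w₀
  let G : SimpleGraph W := SimpleGraph.fromEdgeSet (range fun i => s(l i, r i))
  have hadj : ∀ i, G.Reachable (l i) (r i) := by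
    intro i
    by_cases hi : l i = r i
    · rw [hi]
    · exact SimpleGraph.Adj.reachable ((SimpleGraph.fromEdgeSet_adj _).2 ⟨⟨i, rfl⟩, hi⟩)
  have hG : G.Connected := by
    rw [SimpleGraph.connected_iff_exists_forall_reachable]
    refine ⟨w₀, fun w => ?_⟩
    have : {w | G.Reachable w₀ w} = univ := by
      apply h.connected _ ⟨w₀, SimpleGraph.Reachable.refl _⟩
      intro i
      exact ⟨fun hi => hi.trans (hadj i), fun hi => hi.trans (hadj i).symm⟩
    exact (this ▸ mem_univ w : w ∈ {w | G.Reachable w₀ w})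
  have h1 := hG.card_vert_le_card_edgeSet_add_one
  have h2 : Nat.card G.edgeSet ≤ Nat.card I := by
    have hsub : G.edgeSet ⊆ range fun i => s(l i, r i) := by
      rw [SimpleGraph.edgeSet_fromEdgeSet]
      exact sdiff_subset
    calc Nat.card G.edgeSet ≤ Nat.card (range fun i => s(l i, r i)) :=
          Nat.card_mono (finite_range _) hsub
      _ ≤ Nat.card I := Finite.card_range_le _
  omega

/-- The cuts of a tree, oriented away from the vertex `w₀`. -/
lemma IsTreeLike.exists_cut (h : IsTreeLike l r) (w₀ : W) (i : I) :
    ∃ (A : Set W) (x : W), w₀ ∉ A ∧ x ∈ A ∧ (x = l i ∨ x = r i) ∧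
      (∀ y, (y = l i ∨ y = r i) → y ∈ A → y = x) ∧ ∀ j, j ≠ i → (l j ∈ A ↔ r j ∈ A) := by
  obtain ⟨A, hl, hr, hA⟩ := h.bridge i
  by_cases hw : w₀ ∈ A
  · refine ⟨Aᶜ, r i, fun h => h hw, hr, Or.inr rfl, ?_, ?_⟩
    · rintro y (rfl | rfl) hy
      exacts [absurd hl hy, rfl]
    · intro j hj
      exact not_congr (hA j hj)
  · refine ⟨A, l i, hw, hl, Or.inl rfl, ?_, hA⟩
    rintro y (rfl | rfl) hy
    exacts [rfl, absurd hy hr]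

/-- Each edge is assigned its end away from `w₀`. If distinct edges `i` and `j` had the same value,
each would have both ends in the cut set of the other, so no edge would leave `A i ∪ A j`; this
union would be everything, but it misses `w₀`. -/
lemma IsTreeLike.exists_endMatching_cut (h : IsTreeLike l r) (w₀ : W) :
    ∃ (φ : I → W) (A : I → Set W), IsEndMatching l r w₀ φ ∧ ∀ i, w₀ ∉ A i ∧ φ i ∈ A i ∧
      (∀ y, (y = l i ∨ y = r i) → y ∈ A i → y = φ i) ∧ ∀ j, j ≠ i → (l j ∈ A i ↔ r j ∈ A i) := by
  choose A φ hw hφA hφ huniq hcut using h.exists_cut w₀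
  refine ⟨φ, A, ⟨hφ, ?_, fun i hi => hw i (hi ▸ hφA i)⟩,
    fun i => ⟨hw i, hφA i, huniq i, hcut i⟩⟩
  intro i j hij
  by_contra hne
  have hends : ∀ i', l i' ∈ A i ∪ A j ↔ r i' ∈ A i ∪ A j := by
    intro i'
    by_cases h1 : i' = i
    · subst h1
      have h2 := hcut j i' hne
      have h3 : φ i' ∈ A j := hij ▸ hφA j
      have h4 : l i' ∈ A j ∧ r i' ∈ A j := by
        rcases hφ i' with h5 | h5
        · exact ⟨h5 ▸ h3, h2.1 (h5 ▸ h3)⟩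
        · exact ⟨h2.2 (h5 ▸ h3), h5 ▸ h3⟩
      exact ⟨fun _ => Or.inr h4.2, fun _ => Or.inr h4.1⟩
    · by_cases h1' : i' = j
      · subst h1'
        have h2 := hcut i i' h1
        have h3 : φ i' ∈ A i := hij ▸ hφA i
        have h4 : l i' ∈ A i ∧ r i' ∈ A i := by
          rcases hφ i' with h5 | h5
          · exact ⟨h5 ▸ h3, h2.1 (h5 ▸ h3)⟩
          · exact ⟨h2.2 (h5 ▸ h3), h5 ▸ h3⟩
        exact ⟨fun _ => Or.inl h4.2, fun _ => Or.inl h4.1⟩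
      · exact or_congr (hcut i i' h1) (hcut j i' h1')
  have := h.connected (A i ∪ A j) ⟨_, Or.inl (hφA i)⟩ hends
  rcases (this ▸ mem_univ w₀ : w₀ ∈ A i ∪ A j) with h' | h'
  exacts [hw i h', hw j h']

lemma IsTreeLike.exists_endMatching (h : IsTreeLike l r) (w₀ : W) :
    ∃ φ : I → W, IsEndMatching l r w₀ φ :=
  let ⟨φ, _, hφ, _⟩ := h.exists_endMatching_cut w₀
  ⟨φ, hφ⟩

lemma IsEndMatching.card_le [Finite W] {w₀ : W} {φ : I → W} (h : IsEndMatching l r w₀ φ) :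
    Nat.card I + 1 ≤ Nat.card W := by
  have : Finite I := Finite.of_injective φ h.injective
  rw [← Finite.card_option]
  refine Nat.card_le_card_of_injective (fun o : Option I => o.elim w₀ φ) ?_
  rintro (_ | i) (_ | j) hij
  · rfl
  · exact absurd hij.symm (h.ne_root j)
  · exact absurd hij (h.ne_root i)
  · exact congrArg some (h.injective hij)

lemma IsTreeLike.card_eq [Finite I] (h : IsTreeLike l r) (w₀ : W) :
    Nat.card W = Nat.card I + 1 := by
  have := h.finite w₀
  obtain ⟨φ, hφ⟩ := h.exists_endMatching w₀
  exact le_antisymm (h.card_le w₀) hφ.card_le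

lemma IsEndMatching.surjOn [Finite I] (h : IsTreeLike l r) {w₀ : W} {φ : I → W}
    (hφ : IsEndMatching l r w₀ φ) {w : W} (hw : w ≠ w₀) : ∃ i, φ i = w := by
  have := h.finite w₀
  have hinj : Function.Injective (fun o : Option I => o.elim w₀ φ) := by
    rintro (_ | i) (_ | j) hij
    · rfl
    · exact absurd hij.symm (hφ.ne_root j)
    · exact absurd hij (hφ.ne_root i)
    · exact congrArg some (hφ.injective hij)
  have hcard : Nat.card (Option I) = Nat.card W := by
    rw [Finite.card_option, h.card_eq w₀]
  obtain ⟨o, ho⟩ := ((Nat.bijective_iff_injective_and_card _).2 ⟨hinj, hcard⟩).2 w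
  cases o with
  | none => exact absurd ho.symm hw
  | some i => exact ⟨i, ho⟩

/-- Any matching is compared with the one given by the cuts, by counting the vertices of a cut set
`A i` on which the two disagree. -/
lemma IsTreeLike.endMatching_unique [Finite I] (h : IsTreeLike l r) {w₀ : W} {φ ψ : I → W}
    (hφ : IsEndMatching l r w₀ φ) (hψ : IsEndMatching l r w₀ ψ) : φ = ψ := by
  have := h.finite w₀
  obtain ⟨x, A, hx, hA⟩ := h.exists_endMatching_cut w₀
  suffices key : ∀ φ : I → W, IsEndMatching l r w₀ φ → ∀ i, φ i = x i by
    ext i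
    rw [key φ hφ, key ψ hψ]
  intro φ hφ i
  by_contra hne
  obtain ⟨hw, hxA, huniq, hcut⟩ := hA i
  have hφA : φ i ∉ A i := fun hmem => hne (huniq _ (hφ.mem_ends i) hmem)
  set J : Set I := {j | j ≠ i ∧ l j ∈ A i} with hJ
  -- If `φ i` lies outside `A i`, the vertices of `A i` are all used by the edges `J` inside it,
  -- whereas `x` injects `J` and the additional edge `i` into `A i`.
  have h1 : A i ⊆ φ '' J := by
    intro a ha
    obtain ⟨j, rfl⟩ := hφ.surjOn h (w := a) (fun h0 => hw (h0 ▸ ha))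
    have hji : j ≠ i := fun h0 => hφA (h0 ▸ ha)
    refine ⟨j, ⟨hji, ?_⟩, rfl⟩
    rcases hφ.mem_ends j with h0 | h0
    · exact h0 ▸ ha
    · exact (hcut j hji).2 (h0 ▸ ha)
  have h2 : x '' insert i J ⊆ A i := by
    rintro _ ⟨j, rfl | hj, rfl⟩
    · exact hxA
    · rcases hx.mem_ends j with h0 | h0
      · exact h0 ▸ hj.2
      · exact h0 ▸ (hcut j hj.1).1 hj.2
  have h3 : (insert i J).ncard ≤ J.ncard := by
    rw [← ncard_image_of_injective (insert i J) hx.injective]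
    exact (ncard_le_ncard h2).trans ((ncard_le_ncard h1).trans (ncard_image_le))
  rw [ncard_insert_of_notMem (fun h0 => h0.1 rfl)] at h3
  omega

end TreeMatching

/-! ### The subdivision of the complete edges -/

namespace SegmentFamily

open Set

variable {n : ℕ} (L : SegmentFamily n)

/-- The affine parametrization of a complete edge. -/
def line (i : Fin n) (t : ℝ) : ℂ := L.a i + t * (L.b i - L.a i)

@[simp] lemma line_zero (i : Fin n) : L.line i 0 = L.a i := by simp [line]

@[simp] lemma line_one (i : Fin n) : L.line i 1 = L.b i := by simp [line]

lemma line_injective (i : Fin n) : Function.Injective (L.line i) := by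
  intro s t h
  have h1 := mul_right_cancel₀ (sub_ne_zero.2 (L.ne i).symm) (add_left_cancel h)
  exact_mod_cast h1

lemma continuous_line (i : Fin n) : Continuous (L.line i) := by
  unfold line
  fun_prop

lemma openSegment_line (i : Fin n) {s t : ℝ} (h : s < t) :
    openSegment ℝ (L.line i s) (L.line i t) = L.line i '' Ioo s t := by
  ext z
  rw [mem_openSegment_iff_exists]
  constructor
  · rintro ⟨c, hc, rfl⟩
    refine ⟨s + c * (t - s), ⟨?_, ?_⟩, ?_⟩
    · nlinarith [hc.1]
    · nlinarith [hc.2]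
    · simp only [line]
      push_cast
      ring
  · rintro ⟨x, hx, rfl⟩
    have hts : (t - s : ℝ) ≠ 0 := (sub_pos.2 h).ne'
    have hts' : (t - s : ℂ) ≠ 0 := by exact_mod_cast hts
    refine ⟨(x - s) / (t - s), ⟨div_pos (sub_pos.2 hx.1) (sub_pos.2 h), ?_⟩, ?_⟩
    · rw [div_lt_one (sub_pos.2 h)]
      linarith [hx.2]
    · simp only [line]
      push_cast
      field_simp
      ring

lemma segment_line (i : Fin n) {s t : ℝ} (h : s < t) :
    segment ℝ (L.line i s) (L.line i t) = L.line i '' Icc s t := by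
  rw [← insert_endpoints_openSegment, openSegment_line L i h, ← Ioc_insert_left h.le,
    ← Ioo_insert_right h, image_insert_eq, image_insert_eq]

lemma seg_eq (i : Fin n) : L.seg i = L.line i '' Ioo 0 1 := by
  have := L.openSegment_line i (s := 0) (t := 1) one_pos
  rwa [line_zero, line_one] at this

lemma segment_eq (i : Fin n) : segment ℝ (L.a i) (L.b i) = L.line i '' Icc 0 1 := by
  have := L.segment_line i (s := 0) (t := 1) one_pos
  rwa [line_zero, line_one] at this

lemma line_mem_seg_iff {i : Fin n} {t : ℝ} : L.line i t ∈ L.seg i ↔ t ∈ Ioo (0 : ℝ) 1 := by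
  rw [seg_eq, (L.line_injective i).mem_set_image]

lemma closure_carrier : closure L.carrier = ⋃ i, segment ℝ (L.a i) (L.b i) := by
  rw [carrier, closure_iUnion_of_finite]
  congr 1
  ext1 i
  rw [seg, closure_openSegment]

lemma finite_vertexSet : L.vertexSet.Finite := (finite_range _).union (finite_range _)

instance : Finite L.Vert := L.finite_vertexSet

lemma vertexSet_subset_closure : L.vertexSet ⊆ closure L.carrier := by
  rw [closure_carrier]
  rintro _ (⟨i, rfl⟩ | ⟨i, rfl⟩)
  · exact mem_iUnion.2 ⟨i, left_mem_segment _ _ _⟩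
  · exact mem_iUnion.2 ⟨i, right_mem_segment _ _ _⟩

lemma isRoot_iff {v : L.Vert} : L.IsRoot v ↔ (v : ℂ) ∉ L.carrier :=
  ⟨fun h => h.2, fun h => ⟨L.vertexSet_subset_closure v.2, h⟩⟩

/-- The positions of the vertices on each of the complete edges, in increasing order. -/
structure Subdivision where
  k : Fin n → ℕ
  pos : ∀ i, Fin (k i + 2) → ℝ
  strictMono : ∀ i, StrictMono (pos i)
  pos_zero : ∀ i, pos i 0 = 0
  pos_last : ∀ i, pos i (Fin.last _) = 1
  mem_iff : ∀ i, ∀ t ∈ Icc (0 : ℝ) 1, L.line i t ∈ L.vertexSet ↔ t ∈ range (pos i)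

lemma nonempty_subdivision : Nonempty L.Subdivision := by
  classical
  have key : ∀ i, ∃ (k : ℕ) (pos : Fin (k + 2) → ℝ), StrictMono pos ∧ pos 0 = 0 ∧
      pos (Fin.last _) = 1 ∧
      ∀ t ∈ Icc (0 : ℝ) 1, L.line i t ∈ L.vertexSet ↔ t ∈ range pos := by
    intro i
    have hfin : {t ∈ Icc (0 : ℝ) 1 | L.line i t ∈ L.vertexSet}.Finite :=
      (L.finite_vertexSet.preimage (L.line_injective i).injOn).subset fun t ht => ht.2
    set P := hfin.toFinset with hP
    have hmem : ∀ t, t ∈ P ↔ t ∈ Icc (0 : ℝ) 1 ∧ L.line i t ∈ L.vertexSet := fun t => by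
      simp [hP]
    have h0 : (0 : ℝ) ∈ P := (hmem 0).2 ⟨by simp, by rw [line_zero]; exact Or.inl ⟨i, rfl⟩⟩
    have h1 : (1 : ℝ) ∈ P := (hmem 1).2 ⟨by simp, by rw [line_one]; exact Or.inr ⟨i, rfl⟩⟩
    -- Both ends are among the positions, so subtracting two and adding it back loses nothing.
    have hcard : P.card = (P.card - 2) + 2 := by
      have : 1 < P.card := Finset.one_lt_card.2 ⟨0, h0, 1, h1, zero_ne_one⟩
      omega
    have hr : ∀ t, t ∈ P ↔ t ∈ range (P.orderEmbOfFin hcard) := fun t => by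
      rw [Finset.range_orderEmbOfFin, Finset.mem_coe]
    have hI : ∀ j, P.orderEmbOfFin hcard j ∈ Icc (0 : ℝ) 1 := fun j =>
      ((hmem _).1 ((hr _).2 ⟨j, rfl⟩)).1
    have hm : StrictMono (P.orderEmbOfFin hcard) := (P.orderEmbOfFin hcard).strictMono
    refine ⟨P.card - 2, P.orderEmbOfFin hcard, hm, ?_, ?_, ?_⟩
    · obtain ⟨j, hj⟩ := (hr 0).1 h0
      refine le_antisymm ?_ (hI 0).1
      rw [← hj]
      exact hm.monotone (Fin.zero_le _)
    · obtain ⟨j, hj⟩ := (hr 1).1 h1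
      refine le_antisymm (hI _).2 ?_
      rw [← hj]
      exact hm.monotone (Fin.le_last _)
    · intro t ht
      rw [← hr, hmem]
      exact ⟨fun h => ⟨ht, h⟩, fun h => h.2⟩
  choose k pos h1 h2 h3 h4 using key
  exact ⟨⟨k, pos, h1, h2, h3, h4⟩⟩

namespace Subdivision

variable {L} (D : L.Subdivision)

lemma pos_mem (i : Fin n) (j : Fin (D.k i + 2)) : D.pos i j ∈ Icc (0 : ℝ) 1 := by
  rw [← D.pos_zero i, ← D.pos_last i]
  exact ⟨(D.strictMono i).monotone (Fin.zero_le _), (D.strictMono i).monotone (Fin.le_last _)⟩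

/-- The vertices on a complete edge, in order, the ends included. -/
def pt (i : Fin n) (j : Fin (D.k i + 2)) : L.Vert :=
  ⟨L.line i (D.pos i j), (D.mem_iff i _ (D.pos_mem i j)).2 ⟨j, rfl⟩⟩

/-- The vertices in the interior of the complete edges. -/
abbrev Inner : Type := Σ i, Fin (D.k i)

/-- The pieces into which the vertices divide the complete edges. -/
abbrev Piece : Type := Σ i, Fin (D.k i + 1)

/-- The shift by one skips the end at position `0`: inner vertex `j` has position `j + 1`, between
the pieces `j` and `j + 1`. -/
def inner (x : D.Inner) : L.Vert := D.pt x.1 x.2.succ.castSucc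

/-- The edge of the tree-graph that belongs to a piece. -/
def edge (e : D.Piece) : Sym2 L.Vert := s(D.pt e.1 e.2.castSucc, D.pt e.1 e.2.succ)

/-- The open segment of a piece. -/
def piece (e : D.Piece) : Set ℂ :=
  openSegment ℝ (D.pt e.1 e.2.castSucc : ℂ) (D.pt e.1 e.2.succ)

lemma subsegment_edge (e : D.Piece) : L.subsegment (D.edge e) = D.piece e := rfl

lemma coe_pt (i : Fin n) (j : Fin (D.k i + 2)) : (D.pt i j : ℂ) = L.line i (D.pos i j) := rfl

lemma pt_injective (i : Fin n) : Function.Injective (D.pt i) := by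
  intro j j' h
  exact (D.strictMono i).injective (L.line_injective i (congrArg Subtype.val h))

lemma pos_castSucc_lt_succ (i : Fin n) (j : Fin (D.k i + 1)) :
    D.pos i j.castSucc < D.pos i j.succ := D.strictMono i Fin.castSucc_lt_succ

lemma pt_castSucc_ne_pt_succ (e : D.Piece) :
    (D.pt e.1 e.2.castSucc : ℂ) ≠ D.pt e.1 e.2.succ := fun h =>
  (D.pos_castSucc_lt_succ e.1 e.2).ne (L.line_injective _ h)

lemma piece_eq (e : D.Piece) :
    D.piece e = L.line e.1 '' Ioo (D.pos e.1 e.2.castSucc) (D.pos e.1 e.2.succ) :=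
  L.openSegment_line e.1 (D.pos_castSucc_lt_succ e.1 e.2)

lemma piece_nonempty (e : D.Piece) : (D.piece e).Nonempty := by
  rw [piece_eq]
  exact (nonempty_Ioo.2 (D.pos_castSucc_lt_succ _ _)).image _

lemma isPreconnected_piece (e : D.Piece) : IsPreconnected (D.piece e) :=
  (convex_openSegment _ _).isPreconnected

lemma piece_subset_seg (e : D.Piece) : D.piece e ⊆ L.seg e.1 := by
  rw [piece_eq, seg_eq]
  exact image_mono (Ioo_subset_Ioo (D.pos_mem _ _).1 (D.pos_mem _ _).2)

lemma piece_subset_carrier (e : D.Piece) : D.piece e ⊆ L.carrier :=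
  (D.piece_subset_seg e).trans (subset_iUnion L.seg e.1)

lemma exists_pt_eq {i : Fin n} {v : L.Vert} (h : (v : ℂ) ∈ segment ℝ (L.a i) (L.b i)) :
    ∃ j, v = D.pt i j := by
  rw [segment_eq] at h
  obtain ⟨t, ht, htv⟩ := h
  obtain ⟨j, hj⟩ := (D.mem_iff i t ht).1 (htv ▸ v.2)
  exact ⟨j, Subtype.ext (by rw [← htv, ← hj, coe_pt])⟩

lemma pos_notMem_Ioo (i : Fin n) (j : Fin (D.k i + 1)) (j' : Fin (D.k i + 2)) :
    D.pos i j' ∉ Ioo (D.pos i j.castSucc) (D.pos i j.succ) := by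
  rintro ⟨h1, h2⟩
  have h1' := (D.strictMono i).lt_iff_lt.1 h1
  have h2' := (D.strictMono i).lt_iff_lt.1 h2
  rw [Fin.lt_def] at h1' h2'
  simp only [Fin.val_castSucc, Fin.val_succ] at h1' h2'
  omega

lemma seg_index_unique (hL : L.IsTGraph) {i j : Fin n} {x : ℂ} (hi : x ∈ L.seg i)
    (hj : x ∈ L.seg j) : i = j := by
  by_contra h
  exact disjoint_left.1 (hL.disjoint h) hi hj

lemma vert_notMem_piece (v : L.Vert) (e : D.Piece) : (v : ℂ) ∉ D.piece e := by
  intro h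
  have h1 := openSegment_subset_segment ℝ _ _ (D.piece_subset_seg e h)
  obtain ⟨j, rfl⟩ := D.exists_pt_eq h1
  rw [piece_eq, coe_pt, (L.line_injective _).mem_set_image] at h
  exact D.pos_notMem_Ioo _ _ _ h

lemma disjoint_piece (hL : L.IsTGraph) {e e' : D.Piece} (h : e ≠ e') :
    Disjoint (D.piece e) (D.piece e') := by
  rw [disjoint_left]
  intro x hx hx'
  apply h
  obtain ⟨i, j⟩ := e
  obtain ⟨i', j'⟩ := e'
  obtain rfl : i = i' :=
    seg_index_unique hL (D.piece_subset_seg _ hx) (D.piece_subset_seg _ hx')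
  rw [piece_eq] at hx hx'
  obtain ⟨t, ht, rfl⟩ := hx
  rw [(L.line_injective _).mem_set_image] at hx'
  have h1 := (D.strictMono i).lt_iff_lt.1 (ht.1.trans hx'.2)
  have h2 := (D.strictMono i).lt_iff_lt.1 (hx'.1.trans ht.2)
  rw [Fin.castSucc_lt_succ_iff] at h1 h2
  exact congrArg (Sigma.mk i) (le_antisymm h1 h2)

lemma exists_mem_of_mem_seg {i : Fin n} {x : ℂ} (hx : x ∈ L.seg i) :
    (∃ j, x ∈ D.piece ⟨i, j⟩) ∨ ∃ j, x = D.inner ⟨i, j⟩ := by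
  classical
  rw [seg_eq] at hx
  obtain ⟨t, ht, rfl⟩ := hx
  have hex : ∃ j : Fin (D.k i + 2), t < D.pos i j := ⟨Fin.last _, by rw [D.pos_last]; exact ht.2⟩
  -- Take the first vertex strictly beyond `t`; then `t` is either its predecessor or in the piece
  -- between them.
  obtain ⟨j, hj, hmin⟩ := WellFounded.has_min (wellFounded_lt (α := Fin (D.k i + 2)))
    {j | t < D.pos i j} hex
  have hj0 : j ≠ 0 := by
    rintro rfl
    rw [mem_ofPred_eq, D.pos_zero] at hj
    exact absurd ht.1 (not_lt.2 hj.le)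
  obtain ⟨j, rfl⟩ := Fin.exists_succ_eq.2 hj0
  have hle : D.pos i j.castSucc ≤ t := by
    by_contra h
    exact hmin _ (not_le.1 h) Fin.castSucc_lt_succ
  rcases eq_or_lt_of_le hle with h | h
  · right
    have hj0 : j ≠ 0 := by
      rintro rfl
      rw [Fin.castSucc_zero, D.pos_zero] at h
      exact absurd ht.1 (not_lt.2 h.ge)
    obtain ⟨j, rfl⟩ := Fin.exists_succ_eq.2 hj0
    exact ⟨j, by rw [← h]; rfl⟩
  · left
    refine ⟨j, ?_⟩
    rw [piece_eq, (L.line_injective _).mem_set_image]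
    exact ⟨h, hj⟩

lemma inner_mem_seg (x : D.Inner) : (D.inner x : ℂ) ∈ L.seg x.1 := by
  rw [inner, coe_pt, line_mem_seg_iff]
  constructor
  · rw [← D.pos_zero x.1]
    apply D.strictMono
    rw [Fin.lt_def]
    simp
  · rw [← D.pos_last x.1]
    apply D.strictMono
    rw [Fin.lt_def]
    simp

lemma not_isRoot_iff {v : L.Vert} : ¬ L.IsRoot v ↔ ∃ x, v = D.inner x := by
  rw [isRoot_iff, not_not]
  constructor
  · intro h
    obtain ⟨i, hi⟩ := mem_iUnion.1 h
    rcases D.exists_mem_of_mem_seg hi with ⟨j, hj⟩ | ⟨j, hj⟩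
    · exact absurd hj (D.vert_notMem_piece v _)
    · exact ⟨⟨i, j⟩, Subtype.ext hj⟩
  · rintro ⟨x, rfl⟩
    exact mem_iUnion.2 ⟨x.1, D.inner_mem_seg x⟩

lemma not_isRoot_inner (x : D.Inner) : ¬ L.IsRoot (D.inner x) := by
  rw [isRoot_iff, not_not]
  exact mem_iUnion.2 ⟨x.1, D.inner_mem_seg x⟩

lemma inner_injective (hL : L.IsTGraph) : Function.Injective D.inner := by
  rintro ⟨i, j⟩ ⟨i', j'⟩ h
  have h1 := D.inner_mem_seg ⟨i, j⟩
  rw [h] at h1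
  obtain rfl : i = i' := seg_index_unique hL h1 (D.inner_mem_seg ⟨i', j'⟩)
  have h2 := D.pt_injective i h
  simpa using h2

lemma edge_injective (hL : L.IsTGraph) : Function.Injective D.edge := by
  intro e e' h
  by_contra hne
  have h1 : D.piece e = D.piece e' := by rw [← subsegment_edge, ← subsegment_edge, h]
  obtain ⟨x, hx⟩ := D.piece_nonempty e
  exact disjoint_left.1 (D.disjoint_piece hL hne) hx (h1 ▸ hx)

lemma adj_pt (e : D.Piece) :
    L.treeGraph.Adj (D.pt e.1 e.2.castSucc) (D.pt e.1 e.2.succ) :=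
  ⟨fun h => D.pt_castSucc_ne_pt_succ e (congrArg Subtype.val h), ⟨e.1, D.piece_subset_seg e⟩,
    fun w => D.vert_notMem_piece w e⟩

lemma openSegment_pt {i : Fin n} {j j' : Fin (D.k i + 2)} (h : j < j') :
    openSegment ℝ (D.pt i j : ℂ) (D.pt i j') = L.line i '' Ioo (D.pos i j) (D.pos i j') :=
  L.openSegment_line i (D.strictMono i h)

lemma exists_pt_of_openSegment_subset {u v : L.Vert} {i : Fin n}
    (h : openSegment ℝ (u : ℂ) v ⊆ L.seg i) :
    (∃ j, u = D.pt i j) ∧ ∃ j, v = D.pt i j := by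
  have hcl : segment ℝ (u : ℂ) v ⊆ segment ℝ (L.a i) (L.b i) := by
    rw [← closure_openSegment, ← closure_openSegment]
    exact closure_mono h
  exact ⟨D.exists_pt_eq (hcl (left_mem_segment _ _ _)),
    D.exists_pt_eq (hcl (right_mem_segment _ _ _))⟩

lemma consecutive_of_adj {i : Fin n} {j j' : Fin (D.k i + 2)}
    (h : ∀ w : L.Vert, (w : ℂ) ∉ openSegment ℝ (D.pt i j : ℂ) (D.pt i j')) (hlt : j < j') :
    ∃ m : Fin (D.k i + 1), j = m.castSucc ∧ j' = m.succ := by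
  have hj : (j : ℕ) < D.k i + 1 := by
    have := j'.2
    rw [Fin.lt_def] at hlt
    omega
  refine ⟨⟨j, hj⟩, rfl, ?_⟩
  by_contra hne
  have h2 : (⟨j, hj⟩ : Fin (D.k i + 1)).succ < j' := by
    rw [Fin.lt_def] at hlt ⊢
    have : (j' : ℕ) ≠ j + 1 := fun h => hne (Fin.ext (by simpa using h))
    simp only [Fin.val_succ]
    omega
  -- The vertex directly after `j` would lie strictly between the two.
  apply h (D.pt i (⟨j, hj⟩ : Fin (D.k i + 1)).succ)
  rw [D.openSegment_pt hlt, coe_pt, (L.line_injective _).mem_set_image]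
  exact ⟨D.strictMono i (by rw [Fin.lt_def]; simp), D.strictMono i h2⟩

lemma adj_pt_iff {u v : L.Vert} {i : Fin n} :
    (L.treeGraph.Adj u v ∧ openSegment ℝ (u : ℂ) v ⊆ L.seg i) ↔
      ∃ j : Fin (D.k i + 1), (u = D.pt i j.castSucc ∧ v = D.pt i j.succ) ∨
        (u = D.pt i j.succ ∧ v = D.pt i j.castSucc) := by
  constructor
  · rintro ⟨hadj, hsub⟩
    obtain ⟨⟨j, rfl⟩, ⟨j', rfl⟩⟩ := D.exists_pt_of_openSegment_subset hsub
    rcases lt_trichotomy j j' with h | h | h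
    · obtain ⟨m, rfl, rfl⟩ := D.consecutive_of_adj hadj.2.2 h
      exact ⟨m, Or.inl ⟨rfl, rfl⟩⟩
    · exact absurd (congrArg _ h) hadj.1
    · obtain ⟨m, rfl, rfl⟩ := D.consecutive_of_adj hadj.symm.2.2 h
      exact ⟨m, Or.inr ⟨rfl, rfl⟩⟩
  · rintro ⟨j, ⟨rfl, rfl⟩ | ⟨rfl, rfl⟩⟩
    · exact ⟨D.adj_pt ⟨i, j⟩, D.piece_subset_seg ⟨i, j⟩⟩
    · refine ⟨(D.adj_pt ⟨i, j⟩).symm, ?_⟩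
      rw [openSegment_symm]
      exact D.piece_subset_seg ⟨i, j⟩

lemma mem_edgeSet_iff {s : Sym2 L.Vert} :
    s ∈ L.treeGraph.edgeSet ↔ ∃ e, D.edge e = s := by
  induction s with
  | _ u v =>
    rw [SimpleGraph.mem_edgeSet]
    constructor
    · intro h
      obtain ⟨i, hi⟩ := h.2.1
      obtain ⟨j, ⟨rfl, rfl⟩ | ⟨rfl, rfl⟩⟩ := (D.adj_pt_iff).1 ⟨h, hi⟩
      · exact ⟨⟨i, j⟩, rfl⟩
      · exact ⟨⟨i, j⟩, Sym2.eq_swap⟩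
    · rintro ⟨e, he⟩
      rw [← SimpleGraph.mem_edgeSet, ← he]
      exact D.adj_pt e

lemma out_inner_iff (hL : L.IsTGraph) {x : D.Inner} {w : L.Vert} :
    L.Out (D.inner x) w ↔ w = D.pt x.1 x.2.castSucc.castSucc ∨ w = D.pt x.1 x.2.succ.succ := by
  constructor
  · rintro ⟨hadj, i, hi, hsub⟩
    obtain rfl := seg_index_unique hL hi (D.inner_mem_seg x)
    obtain ⟨j, ⟨h1, rfl⟩ | ⟨h1, rfl⟩⟩ := (D.adj_pt_iff).1 ⟨hadj, hsub⟩
    · have h2 := D.pt_injective _ h1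
      right
      rw [← Fin.castSucc_injective _ h2]
    · have h2 := D.pt_injective _ h1
      left
      rw [← Fin.succ_castSucc] at h2
      rw [← Fin.succ_injective _ h2]
  · rintro (rfl | rfl)
    · have h := (D.adj_pt_iff).2 ⟨x.2.castSucc, Or.inr ⟨rfl, rfl⟩⟩
      exact ⟨h.1, x.1, D.inner_mem_seg x, h.2⟩
    · have h := (D.adj_pt_iff).2 ⟨x.2.succ, Or.inl ⟨rfl, rfl⟩⟩
      exact ⟨h.1, x.1, D.inner_mem_seg x, h.2⟩

lemma Out.not_isRoot {u v : L.Vert} (h : L.Out u v) : ¬ L.IsRoot u := by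
  obtain ⟨-, i, hi, -⟩ := h
  rw [isRoot_iff, not_not]
  exact mem_iUnion.2 ⟨i, hi⟩

end Subdivision
end SegmentFamily

/-! ### Spanning forests as selections of one piece on each complete edge -/

namespace SegmentFamily

open Set

namespace Subdivision

variable {n : ℕ} {L : SegmentFamily n} (D : L.Subdivision)

/-- A choice of one piece on each complete edge: the one to be removed. -/
abbrev Selection : Type := ∀ i, Fin (D.k i + 1)

variable {D}

namespace Selection

variable (σ : D.Selection)

/-- The neighbour of an inner vertex in the direction away from the removed piece. -/
def next (x : D.Inner) : L.Vert :=
  -- Inner vertex `j` lies below the removed piece exactly if `j < σ i`, since its position is `j +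
  -- 1`; it then moves down to position `j`, otherwise up to `j + 2`.
  if x.2.castSucc < σ x.1 then D.pt x.1 x.2.castSucc.castSucc else D.pt x.1 x.2.succ.succ

open Classical in
/-- One step in the direction away from the removed pieces; the roots stay in place. -/
def step (v : L.Vert) : L.Vert := if h : ∃ x, v = D.inner x then σ.next h.choose else v

/-- All vertices flow to a root. -/
def IsGood : Prop := ∀ v, ∃ N, L.IsRoot (σ.step^[N] v)

/-- The directed edges from the vertices in the direction away from the removed pieces. -/
def arcs : Set (L.Vert × L.Vert) := {e | ¬ L.IsRoot e.1 ∧ e.2 = σ.step e.1}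

/-- The tree-graph with the removed pieces deleted. -/
def graph : SimpleGraph L.Vert := SimpleGraph.fromRel fun u v => (u, v) ∈ σ.arcs

lemma step_inner (hL : L.IsTGraph) (x : D.Inner) : σ.step (D.inner x) = σ.next x := by
  have h : ∃ y, D.inner x = D.inner y := ⟨x, rfl⟩
  rw [step, dif_pos h, ← D.inner_injective hL h.choose_spec]

lemma step_of_isRoot {v : L.Vert} (h : L.IsRoot v) : σ.step v = v := by
  rw [step, dif_neg]
  rintro ⟨x, rfl⟩
  exact D.not_isRoot_inner x h

lemma iterate_step_of_isRoot {v : L.Vert} (h : L.IsRoot v) (N : ℕ) : σ.step^[N] v = v :=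
  Function.iterate_fixed (σ.step_of_isRoot h) N

/-- The map `succAbove` skips the removed index, so it enumerates the kept pieces by the inner
vertices: each kept piece is traversed from exactly one of them. -/
lemma edge_succAbove (x : D.Inner) :
    D.edge ⟨x.1, (σ x.1).succAbove x.2⟩ = s(D.inner x, σ.next x) := by
  by_cases h : x.2.castSucc < σ x.1
  · rw [next, if_pos h, Fin.succAbove_of_castSucc_lt _ _ h, edge, Sym2.eq_swap]
    rfl
  · rw [next, if_neg h, Fin.succAbove_of_le_castSucc _ _ (not_lt.1 h), edge]
    rfl

lemma out_next (hL : L.IsTGraph) (x : D.Inner) : L.Out (D.inner x) (σ.next x) := by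
  rw [D.out_inner_iff hL, next]
  split_ifs
  exacts [Or.inl rfl, Or.inr rfl]

lemma next_ne (x : D.Inner) : σ.next x ≠ D.inner x := by
  intro h
  have h1 := σ.edge_succAbove x
  rw [h, edge, Sym2.eq_iff] at h1
  have h2 := D.pt_castSucc_ne_pt_succ ⟨x.1, (σ x.1).succAbove x.2⟩
  rcases h1 with ⟨h3, h4⟩ | ⟨h3, h4⟩ <;> exact h2 (congrArg Subtype.val (h3.trans h4.symm))

lemma mem_arcs_iff (hL : L.IsTGraph) {e : L.Vert × L.Vert} :
    e ∈ σ.arcs ↔ ∃ x, e = (D.inner x, σ.next x) := by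
  obtain ⟨u, v⟩ := e
  constructor
  · rintro ⟨h1, h2⟩
    obtain ⟨x, hx⟩ := D.not_isRoot_iff.1 h1
    simp only at hx h2
    subst hx
    rw [σ.step_inner hL] at h2
    exact ⟨x, by rw [h2]⟩
  · rintro ⟨x, hx⟩
    obtain ⟨rfl, rfl⟩ := Prod.ext_iff.1 hx
    exact ⟨D.not_isRoot_inner x, (σ.step_inner hL x).symm⟩

lemma inner_eq_of_edge_eq (hL : L.IsTGraph) {x y : D.Inner}
    (h : s(D.inner x, σ.next x) = s(D.inner y, σ.next y)) : x = y := by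
  rw [← edge_succAbove, ← edge_succAbove] at h
  have h1 := D.edge_injective hL h
  obtain ⟨i, j⟩ := x
  obtain ⟨i', j'⟩ := y
  obtain rfl : i = i' := congrArg Sigma.fst h1
  have h2 : (σ i).succAbove j = (σ i).succAbove j' := by simpa using h1
  rw [Fin.succAbove_right_injective h2]

lemma no_two_cycle (hL : L.IsTGraph) {u v : L.Vert} (h : (u, v) ∈ σ.arcs) : (v, u) ∉ σ.arcs := by
  intro h'
  obtain ⟨x, hx⟩ := (σ.mem_arcs_iff hL).1 h
  obtain ⟨y, hy⟩ := (σ.mem_arcs_iff hL).1 h'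
  obtain ⟨h1, h2⟩ := Prod.ext_iff.1 hx
  obtain ⟨h3, h4⟩ := Prod.ext_iff.1 hy
  simp only at h1 h2 h3 h4
  have h5 : x = y := by
    apply σ.inner_eq_of_edge_eq hL
    rw [← h1, ← h2, ← h3, ← h4, Sym2.eq_swap]
  subst h5
  exact σ.next_ne x (by rw [← h4, ← h1])

lemma graph_adj_iff (hL : L.IsTGraph) {u v : L.Vert} :
    σ.graph.Adj u v ↔ (u, v) ∈ σ.arcs ∨ (v, u) ∈ σ.arcs := by
  rw [graph, SimpleGraph.fromRel_adj]
  refine ⟨fun h => h.2, fun h => ⟨?_, h⟩⟩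
  rintro rfl
  have h1 : (u, u) ∈ σ.arcs := h.elim id id
  exact σ.no_two_cycle hL h1 h1

lemma graph_adj_iff_exists_piece (hL : L.IsTGraph) {u v : L.Vert} :
    σ.graph.Adj u v ↔ ∃ e : D.Piece, e.2 ≠ σ e.1 ∧ D.edge e = s(u, v) := by
  rw [σ.graph_adj_iff hL]
  constructor
  · rintro (h | h)
    · obtain ⟨x, hx⟩ := (σ.mem_arcs_iff hL).1 h
      obtain ⟨rfl, rfl⟩ := Prod.ext_iff.1 hx
      exact ⟨_, Fin.succAbove_ne _ _, σ.edge_succAbove x⟩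
    · obtain ⟨x, hx⟩ := (σ.mem_arcs_iff hL).1 h
      obtain ⟨rfl, rfl⟩ := Prod.ext_iff.1 hx
      exact ⟨_, Fin.succAbove_ne _ _, (σ.edge_succAbove x).trans Sym2.eq_swap⟩
  · rintro ⟨⟨i, j⟩, hj, he⟩
    obtain ⟨m, hm⟩ := Fin.exists_succAbove_eq hj
    simp only at hm
    rw [← hm] at he
    have h1 := (σ.edge_succAbove ⟨i, m⟩).symm.trans he
    rcases Sym2.eq_iff.1 h1 with ⟨rfl, rfl⟩ | ⟨rfl, rfl⟩
    · exact Or.inl ((σ.mem_arcs_iff hL).2 ⟨_, rfl⟩)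
    · exact Or.inr ((σ.mem_arcs_iff hL).2 ⟨_, rfl⟩)

lemma adj_step (hL : L.IsTGraph) {v : L.Vert} (h : ¬ L.IsRoot v) : σ.graph.Adj v (σ.step v) :=
  (σ.graph_adj_iff hL).2 (Or.inl ⟨h, rfl⟩)

lemma reachable_iterate (hL : L.IsTGraph) (v : L.Vert) (N : ℕ) :
    σ.graph.Reachable v (σ.step^[N] v) := by
  induction N with
  | zero => exact SimpleGraph.Reachable.refl _
  | succ N ih =>
    rw [Function.iterate_succ_apply']
    by_cases h : L.IsRoot (σ.step^[N] v)
    · rwa [σ.step_of_isRoot h]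
    · exact ih.trans (σ.adj_step hL h).reachable

/-- Induct along the walk. A step with the flow lengthens the orbit by one; a step against the flow
drops the first step of an orbit already known to reach the root. -/
lemma exists_iterate_eq_of_reachable (hL : L.IsTGraph) {u r : L.Vert} (hr : L.IsRoot r)
    (h : σ.graph.Reachable u r) : ∃ N, σ.step^[N] u = r := by
  obtain ⟨p⟩ := h
  induction p with
  | nil => exact ⟨0, rfl⟩
  | @cons u v r hadj p ih =>
    obtain ⟨N, hN⟩ := ih hr
    rcases (σ.graph_adj_iff hL).1 hadj with h | h
    · refine ⟨N + 1, ?_⟩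
      rw [Function.iterate_succ_apply, ← show v = σ.step u from h.2, hN]
    · cases N with
      | zero =>
        obtain rfl : v = r := hN
        exact absurd hr h.1
      | succ N =>
        refine ⟨N, ?_⟩
        rwa [Function.iterate_succ_apply, ← show u = σ.step v from h.2] at hN

lemma root_unique {v r r' : L.Vert} (hr : L.IsRoot r) (hr' : L.IsRoot r') {N N' : ℕ}
    (h : σ.step^[N] v = r) (h' : σ.step^[N'] v = r') : r = r' := by
  wlog hle : N ≤ N' generalizing N N' r r'
  · exact (this hr' hr h' h (le_of_not_ge hle)).symm
  obtain ⟨m, rfl⟩ := Nat.exists_eq_add_of_le' hle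
  rw [Function.iterate_add_apply, h, σ.iterate_step_of_isRoot hr] at h'
  exact h'

variable {σ}

open Classical in
/-- The number of steps to the root. -/
def IsGood.depth (hσ : σ.IsGood) (v : L.Vert) : ℕ := Nat.find (hσ v)

lemma IsGood.depth_step_lt (hσ : σ.IsGood) {v : L.Vert} (h : ¬ L.IsRoot v) :
    hσ.depth (σ.step v) < hσ.depth v := by
  classical
  have h1 : L.IsRoot (σ.step^[hσ.depth v] v) := Nat.find_spec (hσ v)
  have h2 : hσ.depth v ≠ 0 := fun h0 => h (by simpa [h0] using h1)
  obtain ⟨m, hm⟩ := Nat.exists_eq_succ_of_ne_zero h2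
  rw [hm, Function.iterate_succ_apply] at h1
  have h3 : hσ.depth (σ.step v) ≤ m := Nat.find_min' _ h1
  omega

/-- At a vertex of maximal depth on a cycle, both neighbours on the cycle would have to be its
unique successor, since a predecessor would be deeper. -/
lemma IsGood.isAcyclic (hL : L.IsTGraph) (hσ : σ.IsGood) : σ.graph.IsAcyclic := by
  classical
  intro v c hc
  obtain ⟨w, hw, hmax⟩ := c.support.toFinset.exists_max_image hσ.depth
    ⟨v, by simp⟩
  rw [List.mem_toFinset] at hw
  have hc' := (SimpleGraph.Walk.isCycle_rotate hw).2 hc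
  have key : ∀ x, σ.graph.Adj w x → x ∈ c.support → x = σ.step w := by
    intro x hadj hx
    rcases (σ.graph_adj_iff hL).1 hadj with h | h
    · exact h.2
    · have h1 := hσ.depth_step_lt h.1
      rw [← show w = σ.step x from h.2] at h1
      exact absurd (hmax x (by simpa using hx)) (not_le.2 h1)
  have hsupp : ∀ x, x ∈ (c.rotate w hw).support → x ∈ c.support := by
    intro x hx
    exact (SimpleGraph.Walk.mem_support_rotate_iff c w hw).1 hx
  have hn : ¬ (c.rotate w hw).Nil := hc'.not_nil
  apply hc'.snd_ne_penultimate
  rw [key _ ((c.rotate w hw).adj_snd hn) (hsupp _ (SimpleGraph.Walk.getVert_mem_support _ _)),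
    key _ ((c.rotate w hw).adj_penultimate hn).symm
      (hsupp _ (SimpleGraph.Walk.getVert_mem_support _ _))]

lemma IsGood.isSpanningForest (hL : L.IsTGraph) (hσ : σ.IsGood) : L.IsSpanningForest σ.arcs where
  edge u v h := by
    obtain ⟨x, hx⟩ := (σ.mem_arcs_iff hL).1 h
    obtain ⟨rfl, rfl⟩ := Prod.ext_iff.1 hx
    exact σ.out_next hL x
  out_unique u hu := ⟨σ.step u, ⟨hu, rfl⟩, fun v h => h.2⟩
  no_two_cycle u v h := σ.no_two_cycle hL h
  acyclic := hσ.isAcyclic hL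
  root_unique u := by
    obtain ⟨N, hN⟩ := hσ u
    refine ⟨_, ⟨hN, σ.reachable_iterate hL u N⟩, ?_⟩
    rintro r ⟨hr, hur⟩
    obtain ⟨M, hM⟩ := σ.exists_iterate_eq_of_reachable hL hr hur
    exact σ.root_unique hr hN hM rfl

/-- Following the flow decreases the depth strictly, so no vertex is visited twice. The depth bound
is carried along for extending such paths. -/
lemma IsGood.exists_path (hL : L.IsTGraph) (hσ : σ.IsGood) (v : L.Vert) :
    ∃ (r : L.Vert) (p : σ.graph.Walk v r), L.IsRoot r ∧ p.IsPath ∧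
      ∀ w ∈ p.support, hσ.depth w ≤ hσ.depth v := by
  induction hd : hσ.depth v using Nat.strong_induction_on generalizing v with
  | _ d ih =>
    by_cases hv : L.IsRoot v
    · refine ⟨v, SimpleGraph.Walk.nil, hv, SimpleGraph.Walk.IsPath.nil, ?_⟩
      simp [hd]
    · have hlt := hσ.depth_step_lt hv
      obtain ⟨r, p, hr, hp, hsup⟩ := ih _ (hd ▸ hlt) (σ.step v) rfl
      refine ⟨r, SimpleGraph.Walk.cons (σ.adj_step hL hv) p, hr, ?_, ?_⟩
      · refine hp.cons fun hmem => ?_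
        exact absurd (hsup v hmem) (not_le.2 hlt)
      · intro w hw
        rw [SimpleGraph.Walk.support_cons, List.mem_cons] at hw
        rcases hw with rfl | hw
        · exact hd.le
        · exact (hsup w hw).trans (hd ▸ hlt).le

/-- Orienting the edges along the paths to the roots amounts to going away from the removed
pieces. -/
lemma IsGood.arcs_eq_of_graph_eq (hL : L.IsTGraph) (hσ : σ.IsGood) {G : SimpleGraph L.Vert}
    (hG : G = σ.graph) :
    {e : L.Vert × L.Vert | ∃ (h : G.Adj e.1 e.2) (r : L.Vert) (p : G.Walk e.2 r),
      L.IsRoot r ∧ (SimpleGraph.Walk.cons h p).IsPath} = σ.arcs := by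
  subst hG
  ext ⟨u, v⟩
  constructor
  · rintro ⟨h, r, p, hr, hp⟩
    obtain ⟨r', q, hr', hq, -⟩ := hσ.exists_path hL u
    have hrr : r = r' := by
      obtain ⟨N, hN⟩ := σ.exists_iterate_eq_of_reachable hL hr ⟨SimpleGraph.Walk.cons h p⟩
      obtain ⟨M, hM⟩ := σ.exists_iterate_eq_of_reachable hL hr' ⟨q⟩
      exact σ.root_unique hr hr' hN hM
    subst hrr
    have hu : ¬ L.IsRoot u := by
      intro hu
      have : u = r := by
        obtain ⟨N, hN⟩ := σ.exists_iterate_eq_of_reachable hL hr ⟨q⟩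
        rwa [σ.iterate_step_of_isRoot hu] at hN
      subst this
      simp at hp
    obtain ⟨r'', q', hr'', hq', hsup⟩ := hσ.exists_path hL (σ.step u)
    have hcons : (SimpleGraph.Walk.cons (σ.adj_step hL hu) q').IsPath :=
      hq'.cons fun hmem => absurd (hsup u hmem) (not_le.2 (hσ.depth_step_lt hu))
    have hrr : r = r'' := by
      obtain ⟨N, hN⟩ := σ.exists_iterate_eq_of_reachable hL hr ⟨q⟩
      obtain ⟨M, hM⟩ := σ.exists_iterate_eq_of_reachable hL hr''
        ⟨SimpleGraph.Walk.cons (σ.adj_step hL hu) q'⟩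
      exact σ.root_unique hr hr'' hN hM
    subst hrr
    -- Paths in an acyclic graph are unique, so the given path to the root starts with the same step
    -- as the flow.
    have heq := ((hσ.isAcyclic hL).subsingleton_path u r).elim ⟨_, hp⟩ ⟨_, hcons⟩
    have h1 := congrArg (fun w : σ.graph.Path u r => (w : σ.graph.Walk u r).snd) heq
    simp only [SimpleGraph.Walk.snd_cons] at h1
    exact ⟨hu, h1⟩
  · rintro ⟨hu, hv⟩
    simp only at hu hv
    subst hv
    obtain ⟨r, p, hr, hp, hsup⟩ := hσ.exists_path hL (σ.step u)
    exact ⟨σ.adj_step hL hu, r, p, hr,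
      hp.cons fun hmem => absurd (hsup u hmem) (not_le.2 (hσ.depth_step_lt hu))⟩

end Selection

/-- The threshold is the first index at which `up` holds, or `k` if there is none. -/
lemma exists_threshold {k : ℕ} (up : Fin k → Prop)
    (h : ∀ j j' : Fin k, (j' : ℕ) = j + 1 → up j → up j') :
    ∃ s : Fin (k + 1), ∀ j : Fin k, j.castSucc < s ↔ ¬ up j := by
  classical
  have hex : ∃ m, k ≤ m ∨ ∃ hm : m < k, up ⟨m, hm⟩ := ⟨k, Or.inl le_rfl⟩
  have hle : Nat.find hex ≤ k := Nat.find_min' hex (Or.inl le_rfl)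
  refine ⟨⟨Nat.find hex, by omega⟩, fun j => ?_⟩
  rw [Fin.lt_def, Fin.val_castSucc]
  constructor
  · intro hj hup
    exact Nat.find_min hex hj (Or.inr ⟨j.2, hup⟩)
  · intro hj
    by_contra hlt
    simp only [not_lt] at hlt
    apply hj
    have key : ∀ d (hd : Nat.find hex + d < k), up ⟨Nat.find hex + d, hd⟩ := by
      intro d
      induction d with
      | zero =>
        intro hd
        rcases Nat.find_spec hex with h0 | ⟨hm, h0⟩
        · omega
        · exact h0
      | succ d ih =>
        intro hd
        exact h ⟨Nat.find hex + d, by omega⟩ _ (by simp; omega) (ih (by omega))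
    have := key (j - Nat.find hex) (by omega)
    convert this using 1
    exact Fin.ext (by simp; omega)

/-! ### From spanning forests to good selections -/

variable (D)

lemma pt_down_ne_up (x : D.Inner) :
    D.pt x.1 x.2.castSucc.castSucc ≠ D.pt x.1 x.2.succ.succ := by
  intro h
  have := congrArg Fin.val (D.pt_injective _ h)
  simp only [Fin.val_castSucc, Fin.val_succ] at this
  omega

/-- If a vertex points up and the next one on the same complete edge points down, these are opposite
directed edges, which a forest excludes. Hence the arrows point down up to a threshold and up after
it, and the piece at the threshold is the one removed. -/
lemma exists_selection_of_isSpanningForest (hL : L.IsTGraph) {F : Set (L.Vert × L.Vert)}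
    (hF : L.IsSpanningForest F) : ∃ σ : D.Selection, σ.IsGood ∧ F = σ.arcs := by
  choose f hf huniq using fun x : D.Inner => hF.out_unique (D.inner x) (D.not_isRoot_inner x)
  simp only at hf huniq
  have hout : ∀ x, f x = D.pt x.1 x.2.castSucc.castSucc ∨ f x = D.pt x.1 x.2.succ.succ :=
    fun x => (D.out_inner_iff hL).1 (hF.edge _ _ (hf x))
  have hthr : ∀ i, ∃ s : Fin (D.k i + 1), ∀ j : Fin (D.k i),
      j.castSucc < s ↔ ¬ (f ⟨i, j⟩ = D.pt i j.succ.succ) := by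
    intro i
    apply exists_threshold fun j => f ⟨i, j⟩ = D.pt i j.succ.succ
    intro j j' hj hup
    by_contra hdown
    have h1 := (hout ⟨i, j'⟩).resolve_right hdown
    have e1 : D.pt i j'.castSucc.castSucc = D.inner ⟨i, j⟩ := by
      rw [inner]
      congr 1
      exact Fin.ext (by simp [hj])
    have e2 : D.pt i j.succ.succ = D.inner ⟨i, j'⟩ := by
      rw [inner]
      congr 1
      exact Fin.ext (by simp [hj])
    have h2 := hf ⟨i, j⟩
    have h3 := hf ⟨i, j'⟩
    rw [hup, e2] at h2
    rw [h1, e1] at h3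
    exact hF.no_two_cycle _ _ h2 h3
  choose σ hσ using hthr
  have hnext : ∀ x, f x = Selection.next (D := D) σ x := by
    intro x
    rw [Selection.next]
    split_ifs with h
    · exact (hout x).resolve_right ((hσ x.1 x.2).1 h)
    · exact not_not.1 (mt (hσ x.1 x.2).2 h)
  have hFσ : F = Selection.arcs (D := D) σ := by
    ext ⟨u, v⟩
    rw [Selection.mem_arcs_iff σ hL]
    constructor
    · intro h
      obtain ⟨x, rfl⟩ := D.not_isRoot_iff.1 (Out.not_isRoot (hF.edge _ _ h))
      exact ⟨x, by rw [huniq x v h, hnext]⟩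
    · rintro ⟨x, hx⟩
      obtain ⟨rfl, rfl⟩ := Prod.ext_iff.1 hx
      simp only
      rw [← hnext]
      exact hf x
  refine ⟨σ, fun v => ?_, hFσ⟩
  obtain ⟨r, ⟨hr, hvr⟩, -⟩ := hF.root_unique v
  subst hFσ
  obtain ⟨N, hN⟩ := Selection.exists_iterate_eq_of_reachable σ hL hr hvr
  exact ⟨N, hN ▸ hr⟩

lemma arcs_injective (hL : L.IsTGraph) :
    Function.Injective (fun σ : D.Selection => σ.arcs) := by
  intro σ σ' h
  have hnext : ∀ x, σ.next x = σ'.next x := by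
    intro x
    have h1 : (D.inner x, σ.next x) ∈ σ'.arcs := by
      rw [← show σ.arcs = σ'.arcs from h]
      exact (σ.mem_arcs_iff hL).2 ⟨x, rfl⟩
    rw [← σ'.step_inner hL]
    exact h1.2
  have hlt : ∀ x : D.Inner, x.2.castSucc < σ x.1 ↔ x.2.castSucc < σ' x.1 := by
    intro x
    have h1 := hnext x
    rw [Selection.next, Selection.next] at h1
    split_ifs at h1 with h2 h3 h3
    · simp [h2, h3]
    · exact absurd h1 (D.pt_down_ne_up x)
    · exact absurd h1.symm (D.pt_down_ne_up x)
    · simp [h2, h3]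
  funext i
  by_contra hne
  rcases lt_or_gt_of_ne hne with h1 | h1
  · have hk : (σ i : ℕ) < D.k i := by
      have := (σ' i).2
      rw [Fin.lt_def] at h1
      omega
    have h2 := (hlt ⟨i, ⟨σ i, hk⟩⟩).2 h1
    exact absurd h2 (lt_irrefl _)
  · have hk : (σ' i : ℕ) < D.k i := by
      have := (σ i).2
      rw [Fin.lt_def] at h1
      omega
    have h2 := (hlt ⟨i, ⟨σ' i, hk⟩⟩).1 h1
    exact absurd h2 (lt_irrefl _)

/-- The lexicographic order of the plane increases or decreases along each segment. -/
lemma lex_line_strictMono (i : Fin n)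
    (h : toLex ((L.a i).re, (L.a i).im) < toLex ((L.b i).re, (L.b i).im)) :
    StrictMono fun t => toLex ((L.line i t).re, (L.line i t).im) := by
  intro s t hst
  simp only [Prod.Lex.toLex_lt_toLex, line, Complex.add_re, Complex.add_im, Complex.mul_re,
    Complex.mul_im, Complex.sub_re, Complex.sub_im, Complex.ofReal_re, Complex.ofReal_im,
    zero_mul, sub_zero, add_zero] at h ⊢
  rcases h with h | ⟨h1, h2⟩
  · left
    nlinarith
  · right
    rw [h1]
    constructor
    · ring
    · nlinarith

lemma lex_line_strictAnti (i : Fin n)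
    (h : toLex ((L.b i).re, (L.b i).im) < toLex ((L.a i).re, (L.a i).im)) :
    StrictAnti fun t => toLex ((L.line i t).re, (L.line i t).im) := by
  intro s t hst
  simp only [Prod.Lex.toLex_lt_toLex, line, Complex.add_re, Complex.add_im, Complex.mul_re,
    Complex.mul_im, Complex.sub_re, Complex.sub_im, Complex.ofReal_re, Complex.ofReal_im,
    zero_mul, sub_zero, add_zero] at h ⊢
  rcases h with h | ⟨h1, h2⟩
  · left
    nlinarith
  · right
    rw [h1]
    constructor
    · ring
    · nlinarith

/-- Remove the end piece at the lexicographically lower end of each complete edge. Every step then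
increases the lexicographic order, and an orbit in a finite set that never met a root could not keep
increasing. -/
lemma exists_isGood (hL : L.IsTGraph) : ∃ σ : D.Selection, σ.IsGood := by
  classical
  let key : ℂ → ℝ ×ₗ ℝ := fun z => toLex (z.re, z.im)
  let σ : D.Selection := fun i => if key (L.a i) < key (L.b i) then 0 else Fin.last _
  have hinc : ∀ v, ¬ L.IsRoot v → key v < key (σ.step v) := by
    intro v hv
    obtain ⟨x, rfl⟩ := D.not_isRoot_iff.1 hv
    rw [σ.step_inner hL, Selection.next]
    by_cases h : key (L.a x.1) < key (L.b x.1)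
    · have : σ x.1 = 0 := if_pos h
      rw [this, if_neg (Fin.not_lt_zero _)]
      refine lex_line_strictMono x.1 h (D.strictMono x.1 ?_)
      rw [Fin.lt_def]
      simp
    · have hne : key (L.b x.1) ≠ key (L.a x.1) := by
        intro he
        apply L.ne x.1
        have := toLex.injective he
        rw [Prod.ext_iff] at this
        exact Complex.ext this.1.symm this.2.symm
      have h' : key (L.b x.1) < key (L.a x.1) := lt_of_le_of_ne (not_lt.1 h) hne
      have : σ x.1 = Fin.last _ := if_neg h
      rw [this, if_pos (Fin.castSucc_lt_last _)]
      refine lex_line_strictAnti x.1 h' (D.strictMono x.1 ?_)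
      rw [Fin.lt_def]
      simp
  refine ⟨σ, fun v => ?_⟩
  by_contra hno
  push Not at hno
  have hmono : StrictMono fun N => key (σ.step^[N] v) := by
    apply strictMono_nat_of_lt_succ
    intro N
    rw [Function.iterate_succ_apply']
    exact hinc _ (hno N)
  have hinj : Function.Injective fun N => σ.step^[N] v := fun a b hab =>
    hmono.injective (by simp only at hab ⊢; rw [hab])
  exact not_injective_infinite_finite _ hinj

end Subdivision
end SegmentFamily

/-! ### Faces and the sides of the pieces -/

namespace SegmentFamily

open Set

variable {n : ℕ} {L : SegmentFamily n} {C : Set ℂ}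

lemma IsEncircledBy.isCompact (hC : L.IsEncircledBy C) : IsCompact C := by
  obtain ⟨γ, hγ, -, rfl⟩ := hC.curve
  exact isCompact_range hγ

lemma IsEncircledBy.isConnected (hC : L.IsEncircledBy C) : IsConnected C := by
  obtain ⟨γ, hγ, -, rfl⟩ := hC.curve
  exact isConnected_range hγ

/-- The limit points missing from the carrier are the roots, and these lie on the curve. This is why
the figure is closed. -/
lemma IsEncircledBy.carrier_union_eq (hC : L.IsEncircledBy C) :
    L.carrier ∪ C = closure L.carrier ∪ C := by
  apply Subset.antisymm (union_subset_union_left _ subset_closure)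
  rintro x (hx | hx)
  · by_cases h : x ∈ L.carrier
    · exact Or.inl h
    · exact Or.inr (hC.roots ⟨hx, h⟩)
  · exact Or.inr hx

lemma IsEncircledBy.isCompact_union (hC : L.IsEncircledBy C) : IsCompact (L.carrier ∪ C) := by
  rw [hC.carrier_union_eq, closure_carrier]
  refine IsCompact.union (isCompact_iUnion fun i => ?_) hC.isCompact
  rw [segment_eq]
  exact isCompact_Icc.image (L.continuous_line i)

lemma IsEncircledBy.isClosed_union (hC : L.IsEncircledBy C) : IsClosed (L.carrier ∪ C) :=
  hC.isCompact_union.isClosed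

lemma IsEncircledBy.vert_mem (hC : L.IsEncircledBy C) (v : L.Vert) : (v : ℂ) ∈ L.carrier ∪ C := by
  rw [hC.carrier_union_eq]
  exact Or.inl (L.vertexSet_subset_closure v.2)

namespace Face

lemma isPreconnected (F : L.Face C) : IsPreconnected F.1 := by
  obtain ⟨⟨x, -, hx⟩, -⟩ := F.2
  rw [hx]
  exact isPreconnected_connectedComponentIn

lemma nonempty (F : L.Face C) : F.1.Nonempty := by
  obtain ⟨⟨x, hx, h⟩, -⟩ := F.2
  rw [h]
  exact ⟨x, mem_connectedComponentIn hx⟩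

lemma subset_compl (F : L.Face C) : F.1 ⊆ (L.carrier ∪ C)ᶜ := by
  obtain ⟨⟨x, hx, h⟩, -⟩ := F.2
  rw [h]
  exact connectedComponentIn_subset _ _

lemma eq_component (F : L.Face C) {x : ℂ} (hx : x ∈ F.1) :
    F.1 = connectedComponentIn (L.carrier ∪ C)ᶜ x := by
  obtain ⟨⟨y, hy, h⟩, -⟩ := F.2
  rw [h] at hx ⊢
  exact connectedComponentIn_eq hx

lemma eq_of_mem {F F' : L.Face C} {x : ℂ} (h : x ∈ F.1) (h' : x ∈ F'.1) : F = F' :=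
  Subtype.ext (by rw [F.eq_component h, F'.eq_component h'])

lemma isOpen (hC : L.IsEncircledBy C) (F : L.Face C) : IsOpen F.1 := by
  obtain ⟨x, hx⟩ := F.nonempty
  rw [F.eq_component hx]
  exact isOpen_component_compl hC.isClosed_union x

lemma subset_component (F : L.Face C) {S : Set ℂ} (hS : S ⊆ L.carrier ∪ C) {p : ℂ}
    (h : (F.1 ∩ connectedComponentIn Sᶜ p).Nonempty) : F.1 ⊆ connectedComponentIn Sᶜ p :=
  subset_component_of_inter F.isPreconnected
    (F.subset_compl.trans (compl_subset_compl.2 hS)) h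

end Face

/-- The points of a face are encircled by the curve. -/
lemma IsEncircledBy.isBounded_component_of_mem_face (hC : L.IsEncircledBy C) (F : L.Face C) {x : ℂ}
    (hx : x ∈ F.1) : Bornology.IsBounded (connectedComponentIn Cᶜ x) := by
  -- An unbounded component of the complement of `C` contains no point of the carrier, so it would
  -- be contained in the bounded face.
  by_contra h
  apply h
  apply F.2.2.subset
  rw [F.eq_component hx]
  have hxC : x ∈ Cᶜ := fun h => F.subset_compl hx (Or.inr h)
  apply isPreconnected_connectedComponentIn.subset_connectedComponentIn
    (mem_connectedComponentIn hxC)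
  rintro y hy (hyL | hyC)
  · have := (hC.inside y hyL).2
    rw [← connectedComponentIn_eq hy] at this
    exact h this
  · exact connectedComponentIn_subset _ _ hy hyC

namespace Subdivision

variable (D : L.Subdivision)

lemma piece_disjoint_curve (hC : L.IsEncircledBy C) (e : D.Piece) : Disjoint (D.piece e) C :=
  disjoint_left.2 fun x hx => (hC.inside x (D.piece_subset_carrier e hx)).1

/-- A piece with its ends. -/
def closedPiece (e : D.Piece) : Set ℂ :=
  segment ℝ (D.pt e.1 e.2.castSucc : ℂ) (D.pt e.1 e.2.succ)

lemma closedPiece_eq (e : D.Piece) : D.closedPiece e =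
    insert (D.pt e.1 e.2.castSucc : ℂ) (insert (D.pt e.1 e.2.succ : ℂ) (D.piece e)) :=
  (insert_endpoints_openSegment ℝ _ _).symm

lemma piece_subset_closedPiece (e : D.Piece) : D.piece e ⊆ D.closedPiece e :=
  openSegment_subset_segment ℝ _ _

lemma isCompact_closedPiece (e : D.Piece) : IsCompact (D.closedPiece e) := by
  rw [closedPiece, segment_eq_image']
  exact isCompact_Icc.image (by fun_prop)

lemma isConnected_closedPiece (e : D.Piece) : IsConnected (D.closedPiece e) :=
  ⟨⟨_, left_mem_segment _ _ _⟩, (convex_segment _ _).isPreconnected⟩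

lemma mem_piece_or_exists_vert {e : D.Piece} {x : ℂ} (hx : x ∈ D.closedPiece e) :
    x ∈ D.piece e ∨ ∃ v : L.Vert, (v : ℂ) = x := by
  rw [closedPiece_eq] at hx
  rcases hx with rfl | rfl | hx
  exacts [Or.inr ⟨_, rfl⟩, Or.inr ⟨_, rfl⟩, Or.inl hx]

lemma closedPiece_subset (hC : L.IsEncircledBy C) (e : D.Piece) :
    D.closedPiece e ⊆ L.carrier ∪ C := by
  intro x hx
  rcases D.mem_piece_or_exists_vert hx with h | ⟨v, rfl⟩
  · exact Or.inl (D.piece_subset_carrier e h)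
  · exact hC.vert_mem v

lemma exists_piece_or_vert {x : ℂ} (hx : x ∈ L.carrier) :
    (∃ e, x ∈ D.piece e) ∨ ∃ y, x = D.inner y := by
  obtain ⟨i, hi⟩ := mem_iUnion.1 hx
  rcases D.exists_mem_of_mem_seg hi with ⟨j, hj⟩ | ⟨j, hj⟩
  exacts [Or.inl ⟨_, hj⟩, Or.inr ⟨_, hj⟩]

lemma disjoint_piece_closedPiece (hL : L.IsTGraph) {e e' : D.Piece} (h : e ≠ e') :
    Disjoint (D.piece e) (D.closedPiece e') := by
  rw [disjoint_left]
  intro x hx hx'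
  rcases D.mem_piece_or_exists_vert hx' with h1 | ⟨v, rfl⟩
  · exact disjoint_left.1 (D.disjoint_piece hL h) hx h1
  · exact D.vert_notMem_piece v e hx

/-- The difference is a finite union of closed sets: the curve, the vertices and the other pieces
with their ends. -/
lemma isClosed_sdiff_piece (hL : L.IsTGraph) (hC : L.IsEncircledBy C) (e : D.Piece) :
    IsClosed ((L.carrier ∪ C) \ D.piece e) := by
  have h : (L.carrier ∪ C) \ D.piece e =
      C ∪ (range (Subtype.val : L.Vert → ℂ) ∪ ⋃ e' : {e' // e' ≠ e}, D.closedPiece e'.1) := by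
    apply Subset.antisymm
    · rintro x ⟨hx | hx, hxe⟩
      · rcases D.exists_piece_or_vert hx with ⟨e', he'⟩ | ⟨y, rfl⟩
        · refine Or.inr (Or.inr (mem_iUnion.2 ⟨⟨e', ?_⟩, D.piece_subset_closedPiece e' he'⟩))
          rintro rfl
          exact hxe he'
        · exact Or.inr (Or.inl ⟨_, rfl⟩)
      · exact Or.inl hx
    · rintro x (hx | ⟨v, rfl⟩ | hx)
      · exact ⟨Or.inr hx, fun h => disjoint_left.1 (D.piece_disjoint_curve hC e) h hx⟩
      · exact ⟨hC.vert_mem v, D.vert_notMem_piece v e⟩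
      · obtain ⟨⟨e', he'⟩, hx⟩ := mem_iUnion.1 hx
        exact ⟨D.closedPiece_subset hC e' hx, fun h =>
          disjoint_left.1 (D.disjoint_piece_closedPiece hL he'.symm) h hx⟩
  rw [h]
  exact hC.isCompact.isClosed.union ((finite_range _).isClosed.union
    (isClosed_iUnion_of_finite fun e' => (D.isCompact_closedPiece e'.1).isClosed))

variable (C)

/-- The faces on the two sides of each piece. -/
structure SideData where
  left : D.Piece → L.Face C
  right : D.Piece → L.Face C
  left_frontier : ∀ e, D.piece e ⊆ frontier (left e).1
  right_frontier : ∀ e, D.piece e ⊆ frontier (right e).1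
  nhds_subset : ∀ e, ∀ m ∈ D.piece e, ∃ ρ > 0,
    Metric.ball m ρ ⊆ D.piece e ∪ (left e).1 ∪ (right e).1
  separated : ∀ e, ∀ Q ⊆ L.carrier ∪ C, IsClosed Q → IsPreconnected Q → Disjoint (D.piece e) Q →
    (D.pt e.1 e.2.castSucc : ℂ) ∈ Q → (D.pt e.1 e.2.succ : ℂ) ∈ Q →
    ∀ p ∈ (left e).1, ∀ q ∈ (right e).1, q ∉ connectedComponentIn (Q ∪ D.piece e)ᶜ p

variable {C}

/-- A component of the complement that accumulates on a piece is a face. -/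
lemma exists_face_of_strip (hC : L.IsEncircledBy C) (e : D.Piece) {A : Set ℂ} (hA : IsConnected A)
    (hAK : A ⊆ (L.carrier ∪ C)ᶜ) (hcl : D.piece e ⊆ closure A) :
    ∃ F : L.Face C, A ⊆ F.1 ∧ D.piece e ⊆ frontier F.1 := by
  obtain ⟨x, hx⟩ := hA.nonempty
  have hAF : A ⊆ connectedComponentIn (L.carrier ∪ C)ᶜ x :=
    hA.isPreconnected.subset_connectedComponentIn hx hAK
  obtain ⟨m, hm⟩ := D.piece_nonempty e
  have hmL := D.piece_subset_carrier e hm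
  have hFb : Bornology.IsBounded (connectedComponentIn (L.carrier ∪ C)ᶜ x) := by
    refine (hC.inside m hmL).2.subset ?_
    -- Adding the limit point `m` keeps the component connected and off `C`, so it lies in the
    -- bounded component of the complement of `C` that contains `m`.
    have hpre : IsPreconnected (insert m (connectedComponentIn (L.carrier ∪ C)ᶜ x)) :=
      isPreconnected_connectedComponentIn.subset_closure (subset_insert _ _)
        (insert_subset (closure_mono hAF (hcl hm)) subset_closure)
    refine (subset_insert _ _).trans
      (hpre.subset_connectedComponentIn (mem_insert m _) (insert_subset ?_ ?_))
    · exact (hC.inside m hmL).1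
    · exact (connectedComponentIn_subset _ _).trans (compl_subset_compl.2 subset_union_right)
  refine ⟨⟨connectedComponentIn (L.carrier ∪ C)ᶜ x, ⟨x, hAK hx, rfl⟩, hFb⟩, hAF, ?_⟩
  intro y hy
  rw [frontier, (isOpen_component_compl hC.isClosed_union x).interior_eq]
  refine ⟨closure_mono hAF (hcl hy), fun h => ?_⟩
  exact connectedComponentIn_subset _ _ h (Or.inl (D.piece_subset_carrier e hy))

/-- Apply `exists_sides` to the figure without the piece. The separation of two single points
extends to all points of the two faces, because a face does not meet `Q` or the piece. -/
lemma nonempty_sideData (hL : L.IsTGraph) (hC : L.IsEncircledBy C) : Nonempty (D.SideData C) := by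
  have key : ∀ e : D.Piece, ∃ l r : L.Face C, D.piece e ⊆ frontier l.1 ∧ D.piece e ⊆ frontier r.1 ∧
      (∀ m ∈ D.piece e, ∃ ρ > 0, Metric.ball m ρ ⊆ D.piece e ∪ l.1 ∪ r.1) ∧
      ∀ Q ⊆ L.carrier ∪ C, IsClosed Q → IsPreconnected Q → Disjoint (D.piece e) Q →
        (D.pt e.1 e.2.castSucc : ℂ) ∈ Q → (D.pt e.1 e.2.succ : ℂ) ∈ Q →
        ∀ p ∈ l.1, ∀ q ∈ r.1, q ∉ connectedComponentIn (Q ∪ D.piece e)ᶜ p := by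
    intro e
    have hun : (L.carrier ∪ C) \ D.piece e ∪ openSegment ℝ (D.pt e.1 e.2.castSucc : ℂ)
        (D.pt e.1 e.2.succ) = L.carrier ∪ C :=
      sdiff_union_of_subset ((D.piece_subset_carrier e).trans subset_union_left)
    obtain ⟨A, B, hA, hB, hAK, hBK, hAcl, hBcl, hnear, p, hp, q, hq, hsep⟩ :=
      exists_sides (D.isClosed_sdiff_piece hL hC e)
        ⟨hC.vert_mem _, D.vert_notMem_piece (D.pt e.1 e.2.castSucc) e⟩
        ⟨hC.vert_mem _, D.vert_notMem_piece (D.pt e.1 e.2.succ) e⟩ (D.pt_castSucc_ne_pt_succ e)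
        disjoint_sdiff_right
    rw [hun] at hAK hBK
    obtain ⟨l, hAl, hl⟩ := D.exists_face_of_strip hC e hA hAK hAcl
    obtain ⟨r, hBr, hr⟩ := D.exists_face_of_strip hC e hB hBK hBcl
    refine ⟨l, r, hl, hr, ?_, ?_⟩
    · intro m hm
      obtain ⟨ρ, hρ, hball⟩ := hnear m hm
      exact ⟨ρ, hρ, hball.trans (union_subset_union (union_subset_union_right _ hAl) hBr)⟩
    · intro Q hQK hQ hQc hdisj hu hv p' hp' q' hq' hmem
      have hS : Q ∪ D.piece e ⊆ L.carrier ∪ C :=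
        union_subset hQK ((D.piece_subset_carrier e).trans subset_union_left)
      apply hsep Q (subset_sdiff.2 ⟨hQK, hdisj.symm⟩) hQ hQc hu hv
      have h1 : l.1 ⊆ connectedComponentIn (Q ∪ D.piece e)ᶜ p :=
        l.subset_component hS ⟨p, hAl hp, mem_connectedComponentIn
          (fun h => l.subset_compl (hAl hp) (hS h))⟩
      have h2 := connectedComponentIn_eq (h1 hp')
      change q ∈ connectedComponentIn (Q ∪ D.piece e)ᶜ p
      rw [h2]
      exact r.subset_component hS ⟨q', hq', hmem⟩ (hBr hq)
  choose l r h1 h2 h3 h4 using key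
  exact ⟨⟨l, r, h1, h2, h3, h4⟩⟩

variable {D}

/-- A face at a piece lies in a complementary component if and only if the piece does. -/
lemma face_subset_component_iff (e : D.Piece) {F : L.Face C}
    (hF : D.piece e ⊆ frontier F.1) {S : Set ℂ} (hSK : S ⊆ L.carrier ∪ C) (hS : IsClosed S)
    (hdisj : Disjoint (D.piece e) S) (p : ℂ) :
    F.1 ⊆ connectedComponentIn Sᶜ p ↔ D.piece e ⊆ connectedComponentIn Sᶜ p := by
  constructor
  · intro h
    have hpre : IsPreconnected (F.1 ∪ D.piece e) :=
      F.isPreconnected.subset_closure subset_union_left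
        (union_subset subset_closure (hF.trans frontier_subset_closure))
    have hsub : F.1 ∪ D.piece e ⊆ Sᶜ :=
      union_subset (F.subset_compl.trans (compl_subset_compl.2 hSK)) hdisj.subset_compl_right
    obtain ⟨x, hx⟩ := F.nonempty
    exact subset_union_right.trans
      (subset_component_of_inter hpre hsub ⟨x, Or.inl hx, h hx⟩)
  · intro h
    obtain ⟨m, hm⟩ := D.piece_nonempty e
    obtain ⟨y, hyU, hyF⟩ := mem_closure_iff.1 (frontier_subset_closure (hF hm)) _
      (isOpen_component_compl hS p) (h hm)
    exact F.subset_component hSK ⟨y, hyF, hyU⟩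

namespace SideData

variable (S : D.SideData C)

lemma eq_or_eq_of_mem_frontier {e : D.Piece} {F : L.Face C} {m : ℂ} (hm : m ∈ D.piece e)
    (hF : m ∈ frontier F.1) : F = S.left e ∨ F = S.right e := by
  obtain ⟨ρ, hρ, hball⟩ := S.nhds_subset e m hm
  obtain ⟨y, hy, hyF⟩ := mem_closure_iff.1 (frontier_subset_closure hF) _ Metric.isOpen_ball
    (Metric.mem_ball_self hρ)
  rcases hball hy with (h | h) | h
  · exact absurd (Or.inl (D.piece_subset_carrier e h)) (F.subset_compl hyF)
  · exact Or.inl (Face.eq_of_mem hyF h)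
  · exact Or.inr (Face.eq_of_mem hyF h)

/-- The faces within a complementary component `U` of a closed connected part `Q` of the figure,
joined by the removed pieces in `U`, form a tree if these pieces make up the figure in `U`. -/
lemma isTreeLike (hL : L.IsTGraph) (hC : L.IsEncircledBy C) (σ : D.Selection) {Q : Set ℂ}
    (hQK : Q ⊆ L.carrier ∪ C) (hQ : IsClosed Q) (hQc : IsPreconnected Q)
    (hdisj : ∀ i, Disjoint (D.piece ⟨i, σ i⟩) Q) {p₀ : ℂ}
    (hb : Bornology.IsBounded (connectedComponentIn Qᶜ p₀))
    (hcover : ∀ x ∈ L.carrier ∪ C, x ∈ connectedComponentIn Qᶜ p₀ → ∃ i, x ∈ D.piece ⟨i, σ i⟩)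
    (hends : ∀ i, D.piece ⟨i, σ i⟩ ⊆ connectedComponentIn Qᶜ p₀ →
      (D.pt i (σ i).castSucc : ℂ) ∈ Q ∧ (D.pt i (σ i).succ : ℂ) ∈ Q) :
    IsTreeLike
      (W := {F : L.Face C // F.1 ⊆ connectedComponentIn Qᶜ p₀})
      (I := {i : Fin n // D.piece ⟨i, σ i⟩ ⊆ connectedComponentIn Qᶜ p₀})
      (fun i => ⟨S.left ⟨i.1, σ i.1⟩, (face_subset_component_iff _ (S.left_frontier _) hQK hQ
        (hdisj i.1) p₀).2 i.2⟩)
      (fun i => ⟨S.right ⟨i.1, σ i.1⟩, (face_subset_component_iff _ (S.right_frontier _) hQK hQ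
        (hdisj i.1) p₀).2 i.2⟩) := by
  set U := connectedComponentIn Qᶜ p₀ with hU
  have hUo : IsOpen U := isOpen_component_compl hQ p₀
  constructor
  · intro A hA hcl
    by_contra hne
    -- For a set of faces, `X` is their union together with the removed pieces that have both sides
    -- in it. If no removed piece leaves `A`, then `X A` and `X Aᶜ` are disjoint open sets covering
    -- the connected set `U`.
    let X : Set {F : L.Face C // F.1 ⊆ U} → Set ℂ := fun A => {x | (∃ F ∈ A, x ∈ F.1.1) ∨
      ∃ i : {i : Fin n // D.piece ⟨i, σ i⟩ ⊆ U}, (∃ h, ⟨S.left ⟨i.1, σ i.1⟩, h⟩ ∈ A) ∧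
        (∃ h, ⟨S.right ⟨i.1, σ i.1⟩, h⟩ ∈ A) ∧ x ∈ D.piece ⟨i.1, σ i.1⟩}
    have hXo : ∀ A, IsOpen (X A) := by
      intro A
      rw [Metric.isOpen_iff]
      rintro x (⟨F, hF, hx⟩ | ⟨i, ⟨h1, hl⟩, ⟨h2, hr⟩, hx⟩)
      · obtain ⟨ε, hε, hball⟩ := Metric.isOpen_iff.1 (F.1.isOpen hC) x hx
        exact ⟨ε, hε, fun y hy => Or.inl ⟨F, hF, hball hy⟩⟩
      · obtain ⟨ρ, hρ, hball⟩ := S.nhds_subset _ x hx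
        refine ⟨ρ, hρ, fun y hy => ?_⟩
        rcases hball hy with (h | h) | h
        · exact Or.inr ⟨i, ⟨h1, hl⟩, ⟨h2, hr⟩, h⟩
        · exact Or.inl ⟨_, hl, h⟩
        · exact Or.inl ⟨_, hr, h⟩
    have hcov : U ⊆ X A ∪ X Aᶜ := by
      intro x hx
      by_cases hxK : x ∈ L.carrier ∪ C
      · obtain ⟨i, hi⟩ := hcover x hxK hx
        have hiU : D.piece ⟨i, σ i⟩ ⊆ U :=
          subset_component_of_inter (D.isPreconnected_piece _) (hdisj i).subset_compl_right
            ⟨x, hi, hx⟩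
        have hlr := hcl ⟨i, hiU⟩
        by_cases hmem : (⟨S.left ⟨i, σ i⟩, (face_subset_component_iff _ (S.left_frontier _) hQK hQ
            (hdisj i) p₀).2 hiU⟩ : {F : L.Face C // F.1 ⊆ U}) ∈ A
        · exact Or.inl (Or.inr ⟨⟨i, hiU⟩, ⟨_, hmem⟩, ⟨_, hlr.1 hmem⟩, hi⟩)
        · exact Or.inr (Or.inr ⟨⟨i, hiU⟩, ⟨_, hmem⟩, ⟨_, fun h => hmem (hlr.2 h)⟩, hi⟩)
      · have hxV : x ∈ connectedComponentIn (L.carrier ∪ C)ᶜ x := mem_connectedComponentIn hxK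
        have hVU : connectedComponentIn (L.carrier ∪ C)ᶜ x ⊆ U :=
          subset_component_of_inter isPreconnected_connectedComponentIn
            ((connectedComponentIn_subset _ _).trans (compl_subset_compl.2 hQK)) ⟨x, hxV, hx⟩
        let F : {F : L.Face C // F.1 ⊆ U} := ⟨⟨_, ⟨x, hxK, rfl⟩, hb.subset hVU⟩, hVU⟩
        by_cases hmem : F ∈ A
        · exact Or.inl (Or.inl ⟨F, hmem, hxV⟩)
        · exact Or.inr (Or.inl ⟨F, hmem, hxV⟩)
    have hdis : X A ∩ X Aᶜ = ∅ := by
      rw [eq_empty_iff_forall_notMem]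
      rintro x ⟨⟨F, hF, hx⟩ | ⟨i, ⟨h1, hl⟩, -, hx⟩, ⟨F', hF', hx'⟩ | ⟨i', ⟨h1', hl'⟩, -, hx'⟩⟩
      · rw [Subtype.ext (Face.eq_of_mem hx hx') (a1 := F) (a2 := F')] at hF
        exact hF' hF
      · exact F.1.subset_compl hx (Or.inl (D.piece_subset_carrier _ hx'))
      · exact F'.1.subset_compl hx' (Or.inl (D.piece_subset_carrier _ hx))
      · obtain rfl : i = i' := by
          by_contra hne
          refine disjoint_left.1 (D.disjoint_piece hL (e := ⟨i.1, σ i.1⟩) (e' := ⟨i'.1, σ i'.1⟩)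
            fun h => hne (Subtype.ext (congrArg Sigma.fst h))) hx hx'
        exact hl' hl
    have hmeets : ∀ A : Set {F : L.Face C // F.1 ⊆ U}, A.Nonempty → (U ∩ X A).Nonempty := by
      rintro A ⟨F, hF⟩
      obtain ⟨x, hx⟩ := F.1.nonempty
      exact ⟨x, F.2 hx, Or.inl ⟨F, hF, hx⟩⟩
    obtain ⟨x, -, hx⟩ := isPreconnected_connectedComponentIn (X A) (X Aᶜ) (hXo _) (hXo _) hcov
      (hmeets A hA) (hmeets Aᶜ (nonempty_compl.2 hne))
    rw [hdis] at hx
    exact hx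
  · intro i
    obtain ⟨hu, hv⟩ := hends i.1 i.2
    have hSK : Q ∪ D.piece ⟨i.1, σ i.1⟩ ⊆ L.carrier ∪ C :=
      union_subset hQK ((D.piece_subset_carrier _).trans subset_union_left)
    have hScl : IsClosed (Q ∪ D.piece ⟨i.1, σ i.1⟩) := by
      rw [piece, union_openSegment_eq hu hv]
      exact hQ.union (isClosed_segment _ _)
    obtain ⟨p, hp⟩ := (S.left ⟨i.1, σ i.1⟩).nonempty
    -- Adding the piece `i` to `Q` separates its two sides, while any other removed piece avoids the
    -- enlarged set and so has both sides in the same component.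
    refine ⟨{F | F.1.1 ⊆ connectedComponentIn (Q ∪ D.piece ⟨i.1, σ i.1⟩)ᶜ p}, ?_, ?_, ?_⟩
    · exact (S.left ⟨i.1, σ i.1⟩).subset_component hSK
        ⟨p, hp, mem_connectedComponentIn fun h => (S.left _).subset_compl hp (hSK h)⟩
    · intro h
      obtain ⟨q, hq⟩ := (S.right ⟨i.1, σ i.1⟩).nonempty
      exact S.separated ⟨i.1, σ i.1⟩ Q hQK hQ hQc (hdisj i.1) hu hv p hp q hq (h hq)
    · intro j hj
      have hd : Disjoint (D.piece ⟨j.1, σ j.1⟩) (Q ∪ D.piece ⟨i.1, σ i.1⟩) := by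
        rw [disjoint_union_right]
        exact ⟨hdisj j.1, D.disjoint_piece hL fun h => hj (Subtype.ext (congrArg Sigma.fst h))⟩
      exact (face_subset_component_iff _ (S.left_frontier _) hSK hScl hd p).trans
        (face_subset_component_iff _ (S.right_frontier _) hSK hScl hd p).symm

end SideData
end Subdivision
end SegmentFamily

/-! ### Good selections and matchings -/

lemma IsTreeLike.of_subtype {W I : Type*} {l r : I → W} {P : W → Prop} {R : I → Prop}
    (hP : ∀ w, P w) (hR : ∀ i, R i)
    (h : IsTreeLike (W := {w // P w}) (I := {i // R i}) (fun i => ⟨l i.1, hP _⟩)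
      (fun i => ⟨r i.1, hP _⟩)) : IsTreeLike l r := by
  constructor
  · rintro A ⟨w, hw⟩ hA
    have := h.connected (Subtype.val ⁻¹' A) ⟨⟨w, hP w⟩, hw⟩ fun i => hA i.1
    ext x
    exact ⟨fun _ => trivial, fun _ =>
      (this ▸ Set.mem_univ _ : (⟨x, hP x⟩ : {w // P w}) ∈ Subtype.val ⁻¹' A)⟩
  · intro i
    obtain ⟨A, h1, h2, h3⟩ := h.bridge ⟨i, hR i⟩
    refine ⟨Subtype.val '' A, ⟨_, h1, rfl⟩, ?_, ?_⟩
    · rintro ⟨w, hw, hwr⟩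
      exact h2 (by rwa [show (⟨r i, hP _⟩ : {w // P w}) = w from Subtype.ext hwr.symm])
    · intro j hj
      have h4 := h3 ⟨j, hR j⟩ fun h => hj (congrArg Subtype.val h)
      constructor
      · rintro ⟨w, hw, hwl⟩
        refine ⟨_, h4.1 ?_, rfl⟩
        rwa [show (⟨l j, hP _⟩ : {w // P w}) = w from Subtype.ext hwl.symm]
      · rintro ⟨w, hw, hwl⟩
        refine ⟨_, h4.2 ?_, rfl⟩
        rwa [show (⟨r j, hP _⟩ : {w // P w}) = w from Subtype.ext hwl.symm]

namespace SegmentFamily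
namespace Subdivision

open Set

variable {n : ℕ} {L : SegmentFamily n} {C : Set ℂ} {D : L.Subdivision}

/-! ### The figure left after removing the selected pieces -/

namespace Selection

variable (σ : D.Selection)

/-- The closed piece from an inner vertex to the next vertex. -/
def arm (x : D.Inner) : Set ℂ := D.closedPiece ⟨x.1, (σ x.1).succAbove x.2⟩

lemma arm_eq (x : D.Inner) : σ.arm x = segment ℝ (D.inner x : ℂ) (σ.next x) := by
  have h := σ.edge_succAbove x
  rw [edge, Sym2.eq_iff] at h
  rw [arm, closedPiece]
  rcases h with ⟨h1, h2⟩ | ⟨h1, h2⟩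
  · rw [h1, h2]
  · rw [h1, h2, segment_symm]

lemma inner_mem_arm (x : D.Inner) : (D.inner x : ℂ) ∈ σ.arm x := by
  rw [arm_eq]
  exact left_mem_segment _ _ _

lemma next_mem_arm (x : D.Inner) : (σ.next x : ℂ) ∈ σ.arm x := by
  rw [arm_eq]
  exact right_mem_segment _ _ _

lemma vert_mem_arm_iff {v : L.Vert} {x : D.Inner} :
    (v : ℂ) ∈ σ.arm x ↔ v = D.inner x ∨ v = σ.next x := by
  constructor
  · intro h
    rw [arm_eq, ← insert_endpoints_openSegment] at h
    rcases h with h | h | h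
    · exact Or.inl (Subtype.ext h)
    · exact Or.inr (Subtype.ext h)
    · exfalso
      apply D.vert_notMem_piece v ⟨x.1, (σ x.1).succAbove x.2⟩
      rw [← subsegment_edge, edge_succAbove]
      exact h
  · rintro (rfl | rfl)
    exacts [σ.inner_mem_arm x, σ.next_mem_arm x]

lemma isClosed_arm (x : D.Inner) : IsClosed (σ.arm x) := (D.isCompact_closedPiece _).isClosed

lemma isPreconnected_arm (x : D.Inner) : IsPreconnected (σ.arm x) :=
  (D.isConnected_closedPiece _).isPreconnected

lemma arm_subset (hC : L.IsEncircledBy C) (x : D.Inner) : σ.arm x ⊆ L.carrier ∪ C :=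
  D.closedPiece_subset hC _

lemma disjoint_removed_arm (hL : L.IsTGraph) (i : Fin n) (x : D.Inner) :
    Disjoint (D.piece ⟨i, σ i⟩) (σ.arm x) := by
  apply D.disjoint_piece_closedPiece hL
  intro h
  obtain ⟨i', j⟩ := x
  obtain rfl : i = i' := congrArg Sigma.fst h
  simp at h

lemma exists_vert_of_mem_arm_inter (hL : L.IsTGraph) {x y : D.Inner} (hxy : x ≠ y) {z : ℂ}
    (hx : z ∈ σ.arm x) (hy : z ∈ σ.arm y) : ∃ v : L.Vert, (v : ℂ) = z := by
  rcases D.mem_piece_or_exists_vert hx with h | h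
  · exfalso
    refine disjoint_left.1 (D.disjoint_piece_closedPiece hL ?_) h hy
    intro h'
    apply hxy
    apply σ.inner_eq_of_edge_eq hL
    rw [← edge_succAbove, ← edge_succAbove, h']
  · exact h

/-- The figure consists of the curve, the arms and the removed pieces. -/
lemma mem_of_mem_figure {x : ℂ} (hx : x ∈ L.carrier ∪ C) :
    x ∈ C ∨ (∃ y, x ∈ σ.arm y) ∨ ∃ i, x ∈ D.piece ⟨i, σ i⟩ := by
  rcases hx with hx | hx
  · right
    rcases D.exists_piece_or_vert hx with ⟨⟨i, j⟩, he⟩ | ⟨y, rfl⟩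
    · by_cases hj : j = σ i
      · subst hj
        exact Or.inr ⟨i, he⟩
      · obtain ⟨m, rfl⟩ := Fin.exists_succAbove_eq hj
        exact Or.inl ⟨⟨i, m⟩, D.piece_subset_closedPiece _ he⟩
    · exact Or.inl ⟨y, σ.inner_mem_arm y⟩
  · exact Or.inl hx

/-- The figure without the removed pieces. -/
def remaining (C : Set ℂ) : Set ℂ := C ∪ ⋃ x, σ.arm x

lemma remaining_subset (hC : L.IsEncircledBy C) : σ.remaining C ⊆ L.carrier ∪ C :=
  union_subset subset_union_right (iUnion_subset fun x => σ.arm_subset hC x)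

lemma isClosed_remaining (hC : L.IsEncircledBy C) : IsClosed (σ.remaining C) :=
  hC.isCompact.isClosed.union (isClosed_iUnion_of_finite fun x => σ.isClosed_arm x)

lemma disjoint_removed_remaining (hL : L.IsTGraph) (hC : L.IsEncircledBy C) (i : Fin n) :
    Disjoint (D.piece ⟨i, σ i⟩) (σ.remaining C) := by
  rw [remaining, disjoint_union_right, disjoint_iUnion_right]
  exact ⟨D.piece_disjoint_curve hC _, fun x => σ.disjoint_removed_arm hL i x⟩

lemma inner_notMem_curve (hC : L.IsEncircledBy C) (x : D.Inner) : (D.inner x : ℂ) ∉ C :=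
  (hC.inside _ (mem_iUnion.2 ⟨x.1, D.inner_mem_seg x⟩)).1

lemma vert_mem_remaining (hC : L.IsEncircledBy C) (v : L.Vert) : (v : ℂ) ∈ σ.remaining C := by
  by_cases h : L.IsRoot v
  · exact Or.inl (hC.roots h)
  · obtain ⟨x, rfl⟩ := D.not_isRoot_iff.1 h
    exact Or.inr (mem_iUnion.2 ⟨x, σ.inner_mem_arm x⟩)

variable {σ}

/-- Every arm is joined to the curve by the chain of arms that follows the flow to a root. -/
lemma IsGood.isPreconnected_remaining (hL : L.IsTGraph) (hC : L.IsEncircledBy C)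
    (hσ : σ.IsGood) : IsPreconnected (σ.remaining C) := by
  have key : ∀ (N : ℕ) (v : L.Vert), L.IsRoot (σ.step^[N] v) →
      ∃ t ⊆ σ.remaining C, C ⊆ t ∧ (v : ℂ) ∈ t ∧ IsPreconnected t := by
    intro N
    induction N with
    | zero =>
      intro v hv
      exact ⟨C, subset_union_left, Subset.rfl, hC.roots hv, hC.isConnected.isPreconnected⟩
    | succ N ih =>
      intro v hv
      by_cases hr : L.IsRoot v
      · exact ⟨C, subset_union_left, Subset.rfl, hC.roots hr, hC.isConnected.isPreconnected⟩
      rw [Function.iterate_succ_apply] at hv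
      obtain ⟨t, ht, hCt, hvt, htc⟩ := ih _ hv
      obtain ⟨x, rfl⟩ := D.not_isRoot_iff.1 hr
      rw [σ.step_inner hL] at hvt
      refine ⟨t ∪ σ.arm x, union_subset ht ?_, hCt.trans subset_union_left,
        Or.inr (σ.inner_mem_arm x), htc.union _ hvt (σ.next_mem_arm x) (σ.isPreconnected_arm x)⟩
      exact (subset_iUnion σ.arm x).trans subset_union_right
  obtain ⟨c, hc⟩ := hC.isConnected.nonempty
  refine isPreconnected_of_forall c ?_
  rintro y (hy | hy)
  · exact ⟨C, subset_union_left, hc, hy, hC.isConnected.isPreconnected⟩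
  · obtain ⟨x, hx⟩ := mem_iUnion.1 hy
    obtain ⟨N, hN⟩ := hσ (D.inner x)
    obtain ⟨t, ht, hCt, hvt, htc⟩ := key N _ hN
    refine ⟨t ∪ σ.arm x, union_subset ht ?_, Or.inl (hCt hc), Or.inr hx,
      htc.union _ hvt (σ.inner_mem_arm x) (σ.isPreconnected_arm x)⟩
    exact (subset_iUnion σ.arm x).trans subset_union_right

/-- A logarithm on the curve extends along the trees that are attached to it. -/
lemma IsGood.hasLogOn_remaining (hL : L.IsTGraph) (hC : L.IsEncircledBy C)
    (hσ : σ.IsGood) {f : ℂ → ℂ} (hf : ContinuousOn f (σ.remaining C))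
    (h0 : ∀ z ∈ σ.remaining C, f z ≠ 0) (hlog : HasLogOn C f) : HasLogOn (σ.remaining C) f := by
  classical
  -- The sets `s` are closed under the flow. Removing a deepest vertex keeps them so, because no
  -- vertex of `s` flows into it.
  have key : ∀ s : Finset D.Inner, (∀ x ∈ s, ∀ y, σ.next x = D.inner y → y ∈ s) →
      HasLogOn (C ∪ ⋃ x ∈ s, σ.arm x) f := by
    intro s
    induction s using Finset.strongInduction with
    | _ s ih =>
      intro hs
      rcases s.eq_empty_or_nonempty with rfl | hne
      · simpa using hlog
      obtain ⟨x, hxs, hmax⟩ := s.exists_max_image (fun x => hσ.depth (D.inner x)) hne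
      have hdepth : ∀ {y z}, σ.next y = D.inner z →
          hσ.depth (D.inner z) < hσ.depth (D.inner y) := by
        intro y z h
        rw [← h, ← σ.step_inner hL]
        exact hσ.depth_step_lt (D.not_isRoot_inner y)
      have h1 := ih (s.erase x) (Finset.erase_ssubset hxs) (by
        intro y hy z hz
        have hy' := Finset.mem_of_mem_erase hy
        refine Finset.mem_erase.2 ⟨?_, hs y hy' z hz⟩
        rintro rfl
        exact absurd (hmax y hy') (not_le.2 (hdepth hz)))
      have harm : σ.arm x ⊆ σ.remaining C := (subset_iUnion σ.arm x).trans subset_union_right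
      have h2 : HasLogOn (σ.arm x) f := by
        rw [arm_eq]
        apply hasLogOn_segment
        · intro h
          exact σ.next_ne x (Subtype.ext h).symm
        · rw [← arm_eq]
          exact hf.mono harm
        · rw [← arm_eq]
          exact fun z hz => h0 z (harm hz)
      have h3 : C ∪ ⋃ y ∈ s, σ.arm y = (C ∪ ⋃ y ∈ s.erase x, σ.arm y) ∪ σ.arm x := by
        conv_lhs => rw [← Finset.insert_erase hxs, Finset.set_biUnion_insert]
        rw [union_assoc, union_comm (σ.arm x)]
      rw [h3]
      -- The arm of a deepest vertex is a leaf: it can meet the rest only at its far end `σ.next x`,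
      -- so the logarithm extends over it.
      refine h1.union h2 ?_ (σ.isClosed_arm x) (σ.next x) ?_
      · exact hC.isCompact.isClosed.union (isClosed_biUnion_finset fun y _ => σ.isClosed_arm y)
      · rintro z ⟨hz, hzx⟩
        have hv : ∃ v : L.Vert, (v : ℂ) = z := by
          rcases hz with hz | hz
          · rcases D.mem_piece_or_exists_vert hzx with h | h
            · exact absurd hz (disjoint_left.1 (D.piece_disjoint_curve hC _) h)
            · exact h
          · simp only [mem_iUnion] at hz
            obtain ⟨y, hy, hzy⟩ := hz
            exact σ.exists_vert_of_mem_arm_inter hL (Finset.ne_of_mem_erase hy) hzy hzx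
        obtain ⟨v, rfl⟩ := hv
        rcases σ.vert_mem_arm_iff.1 hzx with rfl | rfl
        · exfalso
          rcases hz with hz | hz
          · exact inner_notMem_curve hC x hz
          · simp only [mem_iUnion] at hz
            obtain ⟨y, hy, hzy⟩ := hz
            rcases σ.vert_mem_arm_iff.1 hzy with h | h
            · exact Finset.ne_of_mem_erase hy (D.inner_injective hL h).symm
            · exact absurd (hmax y (Finset.mem_of_mem_erase hy)) (not_le.2 (hdepth h.symm))
        · rfl
  have := key Finset.univ fun x _ y _ => Finset.mem_univ y
  simpa [remaining] using this

/-- For a good selection the faces form a tree whose edges are the removed pieces. -/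
lemma IsGood.isTreeLike (hL : L.IsTGraph) (hC : L.IsEncircledBy C) (S : D.SideData C)
    (hσ : σ.IsGood) (w₀ : L.Face C) :
    IsTreeLike (fun i : Fin n => S.left ⟨i, σ i⟩) (fun i : Fin n => S.right ⟨i, σ i⟩) := by
  have hQK := σ.remaining_subset hC
  have hQ := σ.isClosed_remaining hC
  have hdisj := σ.disjoint_removed_remaining hL hC
  obtain ⟨p, hp⟩ := w₀.nonempty
  have hnot : ∀ (F : L.Face C) {x}, x ∈ F.1 → x ∉ σ.remaining C := fun F x hx h =>
    F.subset_compl hx (hQK h)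
  have hCQ : C ⊆ σ.remaining C := subset_union_left
  have hb : Bornology.IsBounded (connectedComponentIn (σ.remaining C)ᶜ p) :=
    (hC.isBounded_component_of_mem_face w₀ hp).subset
      (connectedComponentIn_mono _ (compl_subset_compl.2 hCQ))
  -- All faces lie inside the curve, which is connected, so the quotient has a logarithm on `C`. It
  -- extends along the attached trees, hence the remaining figure does not separate the faces.
  have hfaces : ∀ F : L.Face C, F.1 ⊆ connectedComponentIn (σ.remaining C)ᶜ p := by
    intro F
    obtain ⟨q, hq⟩ := F.nonempty
    refine F.subset_component hQK ⟨q, hq, ?_⟩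
    apply mem_component_of_hasLogOn hQ (hnot w₀ hp) (hnot F hq) hb
    have hne : ∀ (F : L.Face C) {x}, x ∈ F.1 → ∀ z ∈ σ.remaining C, z - x ≠ 0 :=
      fun F x hx z hz h => hnot F hx (sub_eq_zero.1 h ▸ hz)
    apply hσ.hasLogOn_remaining hL hC
    · exact ContinuousOn.div (by fun_prop) (by fun_prop) (hne F hq)
    · intro z hz
      exact div_ne_zero (hne w₀ hp z hz) (hne F hq z hz)
    · have hpC : p ∉ C := fun h => hnot w₀ hp (hCQ h)
      have hqC : q ∉ C := fun h => hnot F hq (hCQ h)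
      exact hasLogOn_div_of_mem_component hC.isCompact.isClosed hpC
        (hC.curve.mem_component hpC hqC (hC.isBounded_component_of_mem_face w₀ hp)
          (hC.isBounded_component_of_mem_face F hq))
  have hpieces : ∀ i, D.piece ⟨i, σ i⟩ ⊆ connectedComponentIn (σ.remaining C)ᶜ p := fun i =>
    (face_subset_component_iff _ (S.left_frontier _) hQK hQ (hdisj i) p).1 (hfaces _)
  refine IsTreeLike.of_subtype hfaces hpieces (S.isTreeLike hL hC σ hQK hQ
    (hσ.isPreconnected_remaining hL hC) hdisj hb ?_ ?_)
  · intro x hx hxU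
    have hxQ : x ∉ σ.remaining C := connectedComponentIn_subset _ _ hxU
    rcases σ.mem_of_mem_figure hx with h | ⟨y, h⟩ | h
    · exact absurd (hCQ h) hxQ
    · exact absurd (Or.inr (mem_iUnion.2 ⟨y, h⟩)) hxQ
    · exact h
  · intro i _
    exact ⟨σ.vert_mem_remaining hC _, σ.vert_mem_remaining hC _⟩

/-! The vertices that do not flow to a root -/

variable (σ)

/-- The vertex never reaches a root. -/
def IsStuck (v : L.Vert) : Prop := ∀ N, ¬ L.IsRoot (σ.step^[N] v)

/-- The inner vertices whose orbits merge with the orbit of `v`. -/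
def basin (v : L.Vert) : Set D.Inner := {x | ∃ a b, σ.step^[a] (D.inner x) = σ.step^[b] v}

/-- The union of the arms of the vertices whose orbits merge with the orbit of `v`. -/
def basinSet (v : L.Vert) : Set ℂ := ⋃ x ∈ σ.basin v, σ.arm x

variable {σ}

lemma mem_basin_of_merge {v w : L.Vert} {x : D.Inner} {a b c d : ℕ}
    (h : σ.step^[a] (D.inner x) = σ.step^[b] w) (h' : σ.step^[c] w = σ.step^[d] v) :
    x ∈ σ.basin v := by
  refine ⟨c + a, b + d, ?_⟩
  rw [Function.iterate_add_apply, h, Function.iterate_add_apply, ← h',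
    ← Function.iterate_add_apply, ← Function.iterate_add_apply, add_comm]

lemma arm_subset_basinSet {v : L.Vert} {x : D.Inner} (hx : x ∈ σ.basin v) :
    σ.arm x ⊆ σ.basinSet v := subset_biUnion_of_mem (u := σ.arm) hx

lemma isClosed_basinSet (v : L.Vert) : IsClosed (σ.basinSet v) :=
  (toFinite _).isClosed_biUnion fun x _ => σ.isClosed_arm x

lemma isBounded_basinSet (v : L.Vert) : Bornology.IsBounded (σ.basinSet v) :=
  (Bornology.isBounded_biUnion (toFinite _)).2 fun _ _ => (D.isCompact_closedPiece _).isBounded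

namespace IsStuck

variable {v : L.Vert}

lemma not_isRoot (hv : σ.IsStuck v) : ¬ L.IsRoot v := hv 0

lemma iterate (hv : σ.IsStuck v) (m : ℕ) : σ.IsStuck (σ.step^[m] v) := by
  intro N
  rw [← Function.iterate_add_apply]
  exact hv _

/-- A root stays in place, so an orbit that reaches one remains there. -/
lemma of_iterate {m : ℕ} (hv : σ.IsStuck (σ.step^[m] v)) : σ.IsStuck v := by
  intro N hN
  apply hv N
  rw [← Function.iterate_add_apply, add_comm, Function.iterate_add_apply,
    σ.iterate_step_of_isRoot hN]
  exact hN

lemma of_mem_basin (hv : σ.IsStuck v) {x : D.Inner} (hx : x ∈ σ.basin v) :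
    σ.IsStuck (D.inner x) := by
  obtain ⟨a, b, h⟩ := hx
  exact of_iterate (m := a) (h ▸ hv.iterate b)

/-- The next vertex of a vertex in the basin is again an inner vertex in the basin. -/
lemma exists_next (hL : L.IsTGraph) (hv : σ.IsStuck v) {x : D.Inner} (hx : x ∈ σ.basin v) :
    ∃ y ∈ σ.basin v, σ.next x = D.inner y := by
  have h1 : ¬ L.IsRoot (σ.next x) := by
    rw [← σ.step_inner hL]
    exact hv.of_mem_basin hx 1
  obtain ⟨y, hy⟩ := D.not_isRoot_iff.1 h1
  obtain ⟨a, b, h⟩ := hx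
  refine ⟨y, mem_basin_of_merge (a := 0) (b := 1) (w := D.inner x) ?_ h, hy⟩
  rw [Function.iterate_zero_apply, Function.iterate_one, σ.step_inner hL, hy]

lemma exists_inner (hv : σ.IsStuck v) : ∃ x ∈ σ.basin v, v = D.inner x := by
  obtain ⟨x, rfl⟩ := D.not_isRoot_iff.1 hv.not_isRoot
  exact ⟨x, ⟨0, 0, rfl⟩, rfl⟩

lemma mem_basinSet (hv : σ.IsStuck v) : (v : ℂ) ∈ σ.basinSet v := by
  obtain ⟨x, hx, rfl⟩ := hv.exists_inner
  exact arm_subset_basinSet hx (σ.inner_mem_arm x)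

lemma basinSet_subset_carrier (hL : L.IsTGraph) (hv : σ.IsStuck v) :
    σ.basinSet v ⊆ L.carrier := by
  intro z hz
  obtain ⟨x, hx, hzx⟩ := mem_iUnion₂.1 hz
  rcases D.mem_piece_or_exists_vert hzx with h | ⟨w, rfl⟩
  · exact D.piece_subset_carrier _ h
  · have : ¬ L.IsRoot w := by
      rcases σ.vert_mem_arm_iff.1 hzx with rfl | rfl
      · exact D.not_isRoot_inner x
      · obtain ⟨y, -, hy⟩ := hv.exists_next hL hx
        rw [hy]
        exact D.not_isRoot_inner y
    rwa [isRoot_iff, not_not] at this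

/-- Consecutive arms of an orbit share a vertex, so the initial stretch of the orbit is joined
within the basin. -/
lemma exists_joining (hL : L.IsTGraph) (hv : σ.IsStuck v) (m : ℕ) {x : D.Inner}
    (hx : x ∈ σ.basin v) :
    ∃ t ⊆ σ.basinSet v, (D.inner x : ℂ) ∈ t ∧ (σ.step^[m] (D.inner x) : ℂ) ∈ t ∧
      IsPreconnected t := by
  induction m generalizing x with
  | zero =>
    exact ⟨σ.arm x, arm_subset_basinSet hx, σ.inner_mem_arm x, σ.inner_mem_arm x,
      σ.isPreconnected_arm x⟩
  | succ m ih =>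
    obtain ⟨y, hy, hxy⟩ := hv.exists_next hL hx
    obtain ⟨t, ht, h1, h2, h3⟩ := ih hy
    refine ⟨σ.arm x ∪ t, union_subset (arm_subset_basinSet hx) ht, Or.inl (σ.inner_mem_arm x),
      Or.inr ?_, (σ.isPreconnected_arm x).union (D.inner y : ℂ) ?_ h1 h3⟩
    · rwa [Function.iterate_succ_apply, σ.step_inner hL, hxy]
    · rw [← hxy]
      exact σ.next_mem_arm x

/-- Each arm is joined to `v` through the point where the two orbits merge. -/
lemma isConnected_basinSet (hL : L.IsTGraph) (hv : σ.IsStuck v) : IsConnected (σ.basinSet v) := by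
  refine ⟨⟨v, hv.mem_basinSet⟩, isPreconnected_of_forall (v : ℂ) fun z hz => ?_⟩
  obtain ⟨x, hx, hzx⟩ := mem_iUnion₂.1 hz
  obtain ⟨x₀, hx₀, hvx₀⟩ := hv.exists_inner
  obtain ⟨a, b, hab⟩ := hx
  obtain ⟨t, ht, h1, h2, h3⟩ := hv.exists_joining hL a ⟨a, b, hab⟩
  obtain ⟨t', ht', h1', h2', h3'⟩ := hv.exists_joining hL b hx₀
  rw [← hvx₀] at h1' h2'
  refine ⟨(t' ∪ t) ∪ σ.arm x, union_subset (union_subset ht' ht)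
    (arm_subset_basinSet ⟨a, b, hab⟩), Or.inl (Or.inl h1'), Or.inr hzx, ?_⟩
  exact (h3'.union _ h2' (hab ▸ h2) h3).union _ (Or.inr h1) (σ.inner_mem_arm x)
    (σ.isPreconnected_arm x)

/-- The arms of a vertex outside of the basin do not meet those in the basin. -/
lemma disjoint_arm (hL : L.IsTGraph) {y : D.Inner} (hy : y ∉ σ.basin v) :
    Disjoint (σ.arm y) (σ.basinSet v) := by
  rw [disjoint_left]
  intro z hzy hz
  obtain ⟨x, hx, hzx⟩ := mem_iUnion₂.1 hz
  have hne : y ≠ x := by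
    rintro rfl
    exact hy hx
  obtain ⟨w, rfl⟩ := σ.exists_vert_of_mem_arm_inter hL hne hzy hzx
  have key : ∀ {x}, (w : ℂ) ∈ σ.arm x → ∃ a, σ.step^[a] (D.inner x) = w := by
    intro x hwx
    rcases σ.vert_mem_arm_iff.1 hwx with rfl | rfl
    · exact ⟨0, rfl⟩
    · exact ⟨1, σ.step_inner hL x⟩
  obtain ⟨a, ha⟩ := key hzy
  obtain ⟨b, hb⟩ := key hzx
  obtain ⟨c, d, hcd⟩ := hx
  exact hy (mem_basin_of_merge (ha.trans hb.symm) hcd)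

/-- There is a periodic vertex that is reached from everywhere in the basin. -/
lemma exists_periodic (hv : σ.IsStuck v) :
    ∃ x ∈ σ.basin v, ∀ y ∈ σ.basin v, ∃ m, σ.step^[m] (D.inner y) = D.inner x := by
  obtain ⟨a, b, hab, heq⟩ : ∃ a b, a < b ∧ σ.step^[a] v = σ.step^[b] v := by
    have := not_injective_infinite_finite fun N => σ.step^[N] v
    simp only [Function.Injective, not_forall] at this
    obtain ⟨a, b, h, hne⟩ := this
    rcases lt_or_gt_of_ne hne with h' | h'
    · exact ⟨a, b, h', h⟩
    · exact ⟨b, a, h', h.symm⟩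
  obtain ⟨x, hx⟩ := D.not_isRoot_iff.1 (hv a)
  have hper : σ.step^[b - a] (D.inner x) = D.inner x := by
    rw [← hx, ← Function.iterate_add_apply, Nat.sub_add_cancel hab.le, heq]
  refine ⟨x, ⟨0, a, hx.symm⟩, ?_⟩
  rintro y ⟨c, d, hcd⟩
  have hper' : ∀ k, σ.step^[k * (b - a)] (D.inner x) = D.inner x := by
    intro k
    rw [mul_comm, Function.iterate_mul]
    exact Function.iterate_fixed hper k
  have hd : d ≤ a + d * (b - a) := by
    have : d * 1 ≤ d * (b - a) := Nat.mul_le_mul_left _ (by omega)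
    omega
  -- The `d` extra periods make the time along the orbit of `v` at least `d`, where the orbit of `y`
  -- has merged with it, and do not change the arrival at `x`.
  refine ⟨(a + d * (b - a) - d) + c, ?_⟩
  rw [Function.iterate_add_apply, hcd, ← Function.iterate_add_apply, Nat.sub_add_cancel hd,
    add_comm, Function.iterate_add_apply, hx, hper']

/-- The arms of a basin enclose a bounded region. -/
lemma exists_isBounded_component (hL : L.IsTGraph) (S : D.SideData C)
    (hv : σ.IsStuck v) : ∃ p ∉ σ.basinSet v,
      Bornology.IsBounded (connectedComponentIn (σ.basinSet v)ᶜ p) := by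
  obtain ⟨x, hx, hreach⟩ := hv.exists_periodic
  set e : D.Piece := ⟨x.1, (σ x.1).succAbove x.2⟩ with he
  -- Leave out the arm of the periodic vertex `x`. Every other vertex of the basin, `σ.next x` among
  -- them, still reaches `x` through the other arms, so `Q` is connected and contains both ends of
  -- the omitted arm.
  set Q : Set ℂ := ⋃ y ∈ σ.basin v \ {x}, σ.arm y with hQ
  have hQsub : Q ⊆ σ.basinSet v := biUnion_subset_biUnion_left sdiff_subset
  have harm : ∀ {y}, y ∈ σ.basin v → y ≠ x → σ.arm y ⊆ Q := fun {y} hy hyx =>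
    subset_biUnion_of_mem (u := σ.arm) (show y ∈ σ.basin v \ {x} from ⟨hy, hyx⟩)
  have hjoin : ∀ (m : ℕ) (y : D.Inner), y ∈ σ.basin v → y ≠ x →
      σ.step^[m] (D.inner y) = D.inner x →
      ∃ t ⊆ Q, (D.inner x : ℂ) ∈ t ∧ (D.inner y : ℂ) ∈ t ∧ IsPreconnected t := by
    intro m
    induction m with
    | zero =>
      intro y _ hyx h
      exact absurd (D.inner_injective hL h) hyx
    | succ m ih =>
      intro y hy hyx h
      obtain ⟨z, hz, hyz⟩ := hv.exists_next hL hy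
      by_cases hzx : z = x
      · subst hzx
        exact ⟨σ.arm y, harm hy hyx, hyz ▸ σ.next_mem_arm y, σ.inner_mem_arm y,
          σ.isPreconnected_arm y⟩
      · rw [Function.iterate_succ_apply, σ.step_inner hL, hyz] at h
        obtain ⟨t, ht, h1, h2, h3⟩ := ih z hz hzx h
        exact ⟨t ∪ σ.arm y, union_subset ht (harm hy hyx), Or.inl h1, Or.inr (σ.inner_mem_arm y),
          h3.union (D.inner z : ℂ) h2 (hyz ▸ σ.next_mem_arm y) (σ.isPreconnected_arm y)⟩
  obtain ⟨z, hz, hxz⟩ := hv.exists_next hL hx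
  have hzx : z ≠ x := by
    rintro rfl
    exact σ.next_ne z hxz
  obtain ⟨m, hm⟩ := hreach z hz
  obtain ⟨t, ht, h1, h2, -⟩ := hjoin m z hz hzx hm
  have hxQ : (D.inner x : ℂ) ∈ Q := ht h1
  have hnQ : (σ.next x : ℂ) ∈ Q := by rw [hxz]; exact ht h2
  have hQcl : IsClosed Q := (toFinite _).isClosed_biUnion fun y _ => σ.isClosed_arm y
  have hQc : IsPreconnected Q := by
    refine isPreconnected_of_forall (D.inner x : ℂ) fun w hw => ?_
    obtain ⟨y, ⟨hy, hyx⟩, hwy⟩ := mem_iUnion₂.1 hw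
    obtain ⟨m, hm⟩ := hreach y hy
    obtain ⟨t, ht, h1, h2, h3⟩ := hjoin m y hy hyx hm
    exact ⟨t ∪ σ.arm y, union_subset ht (harm hy hyx), Or.inl h1, Or.inr hwy,
      h3.union _ h2 (σ.inner_mem_arm y) (σ.isPreconnected_arm y)⟩
  have hdisj : Disjoint (D.piece e) Q := by
    rw [disjoint_left]
    intro w hwe hw
    obtain ⟨y, ⟨hy, hyx⟩, hwy⟩ := mem_iUnion₂.1 hw
    obtain ⟨u, rfl⟩ := σ.exists_vert_of_mem_arm_inter hL hyx hwy
      (D.piece_subset_closedPiece e hwe)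
    exact D.vert_notMem_piece u e hwe
  have hends : (D.pt e.1 e.2.castSucc : ℂ) ∈ Q ∧ (D.pt e.1 e.2.succ : ℂ) ∈ Q := by
    have h := σ.edge_succAbove x
    rw [edge, Sym2.eq_iff] at h
    rcases h with ⟨h1, h2⟩ | ⟨h1, h2⟩
    · rw [h1, h2]
      exact ⟨hxQ, hnQ⟩
    · rw [h1, h2]
      exact ⟨hnQ, hxQ⟩
  have hun : Q ∪ D.piece e = σ.basinSet v := by
    rw [piece, union_openSegment_eq hends.1 hends.2]
    apply Subset.antisymm
    · exact union_subset hQsub (arm_subset_basinSet hx)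
    · intro w hw
      obtain ⟨y, hy, hwy⟩ := mem_iUnion₂.1 hw
      by_cases hyx : y = x
      · subst hyx
        exact Or.inr hwy
      · exact Or.inl (harm hy hyx hwy)
  have hK : σ.basinSet v ⊆ L.carrier ∪ C :=
    (hv.basinSet_subset_carrier hL).trans subset_union_left
  obtain ⟨p, hp⟩ := (S.left e).nonempty
  obtain ⟨q, hq⟩ := (S.right e).nonempty
  have hsep := S.separated e Q (hQsub.trans hK) hQcl hQc hdisj hends.1 hends.2 p hp q hq
  rw [hun] at hsep
  have hpK : p ∉ σ.basinSet v := fun h => (S.left e).subset_compl hp (hK h)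
  have hqK : q ∉ σ.basinSet v := fun h => (S.right e).subset_compl hq (hK h)
  -- The omitted arm closes a loop, so its two sides are separated by the basin; they cannot both
  -- lie in the unique unbounded component.
  by_contra hno
  push Not at hno
  apply hsep
  rw [mem_component_of_unbounded (isBounded_basinSet v) (hno p hpK) (hno q hqK)]
  exact mem_connectedComponentIn hqK

/-- The curve does not enter the regions enclosed by a basin. -/
lemma disjoint_curve (hL : L.IsTGraph) (hC : L.IsEncircledBy C) (hv : σ.IsStuck v) {p : ℂ}
    (hb : Bornology.IsBounded (connectedComponentIn (σ.basinSet v)ᶜ p)) {x : ℂ} (hx : x ∈ C) :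
    x ∉ connectedComponentIn (σ.basinSet v)ᶜ p := by
  intro hxU
  have hCU : C ⊆ connectedComponentIn (σ.basinSet v)ᶜ p := by
    refine subset_component_of_inter hC.isConnected.isPreconnected ?_ ⟨x, hx, hxU⟩
    intro y hy hyv
    exact (hC.inside y (hv.basinSet_subset_carrier hL hyv)).1 hy
  have hvU : (v : ℂ) ∉ connectedComponentIn (σ.basinSet v)ᶜ p := fun h =>
    connectedComponentIn_subset _ _ h hv.mem_basinSet
  -- If the curve lay in a bounded region of the basin, then `v`, which is outside that region,
  -- would be connected to infinity off the curve, although it is encircled by it.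
  exact not_isBounded_component_of_notMem (isClosed_basinSet v) (hv.isConnected_basinSet hL) hb hCU
    hvU (hC.inside _ (hv.basinSet_subset_carrier hL hv.mem_basinSet)).2

end IsStuck

end Selection
end Subdivision
end SegmentFamily

/-! ### Matchable selections are good -/

namespace SegmentFamily
namespace Subdivision
namespace Selection

open Set

variable {n : ℕ} {L : SegmentFamily n} {C : Set ℂ} {D : L.Subdivision} {σ : D.Selection}

/-- In an innermost region enclosed by a basin, there is nothing but removed pieces. -/
lemma IsStuck.exists_innermost (hL : L.IsTGraph) (hC : L.IsEncircledBy C) (S : D.SideData C)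
    {v : L.Vert} (hv : σ.IsStuck v) :
    ∃ (v : L.Vert) (p : ℂ), σ.IsStuck v ∧ p ∉ σ.basinSet v ∧
      Bornology.IsBounded (connectedComponentIn (σ.basinSet v)ᶜ p) ∧
      ∀ x ∈ L.carrier ∪ C, x ∈ connectedComponentIn (σ.basinSet v)ᶜ p →
        ∃ i, x ∈ D.piece ⟨i, σ i⟩ := by
  obtain ⟨p, hp, hb⟩ := hv.exists_isBounded_component hL S
  -- Descend on the number of vertices in the enclosed region.
  induction hm : {w : L.Vert | (w : ℂ) ∈ connectedComponentIn (σ.basinSet v)ᶜ p}.ncard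
    using Nat.strong_induction_on generalizing v p with
  | _ m ih =>
  subst hm
  set U := connectedComponentIn (σ.basinSet v)ᶜ p with hU
  have hCU : ∀ x ∈ C, x ∉ U := fun x hx => hv.disjoint_curve hL hC hb hx
  by_cases hother : ∃ y : D.Inner, y ∉ σ.basin v ∧ (D.inner y : ℂ) ∈ U ∧ σ.IsStuck (D.inner y)
  · obtain ⟨y, hy, hyU, hstuck⟩ := hother
    have hdis : Disjoint (σ.basinSet (D.inner y)) (σ.basinSet v) := by
      rw [basinSet, disjoint_iUnion₂_left]
      rintro z ⟨a, b, hab⟩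
      apply IsStuck.disjoint_arm hL
      rintro ⟨c, d, hcd⟩
      exact hy (mem_basin_of_merge hab.symm hcd)
    have hsub : σ.basinSet (D.inner y) ⊆ U :=
      subset_component_of_inter (hstuck.isConnected_basinSet hL).isPreconnected
        hdis.subset_compl_right ⟨_, hstuck.mem_basinSet, hyU⟩
    obtain ⟨q, hq, hqb⟩ := hstuck.exists_isBounded_component hL S
    -- Points outside `U` are connected to infinity off the second basin, so the region it encloses
    -- is inside `U`. It does not contain the vertex `y`, hence has fewer vertices.
    have hVU : connectedComponentIn (σ.basinSet (D.inner y))ᶜ q ⊆ U := by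
      intro z hz
      by_contra hzU
      apply not_isBounded_component_of_notMem (isClosed_basinSet v) (hv.isConnected_basinSet hL) hb
        hsub hzU
      rwa [← connectedComponentIn_eq hz]
    refine ih _ ?_ hstuck q hq hqb rfl
    apply ncard_lt_ncard _ (toFinite _)
    refine ⟨fun w hw => hVU hw, fun h => ?_⟩
    exact connectedComponentIn_subset _ _ (h hyU : D.inner y ∈ {w : L.Vert | (w : ℂ) ∈ _})
      hstuck.mem_basinSet
  · refine ⟨v, p, hv, hp, hb, fun x hxK hxU => ?_⟩
    rcases σ.mem_of_mem_figure hxK with h | ⟨y, h⟩ | h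
    · exact absurd hxU (hCU x h)
    · exfalso
      have harmU : ∀ {y : D.Inner}, y ∉ σ.basin v → (σ.arm y ∩ U).Nonempty → σ.arm y ⊆ U :=
        fun {y} hy hne => subset_component_of_inter (σ.isPreconnected_arm y)
          (IsStuck.disjoint_arm hL hy).subset_compl_right hne
      have hy : y ∉ σ.basin v := fun hy =>
        connectedComponentIn_subset _ _ hxU (arm_subset_basinSet hy h)
      have hyU : (D.inner y : ℂ) ∈ U := harmU hy ⟨x, h, hxU⟩ (σ.inner_mem_arm y)
      have hns : ¬ σ.IsStuck (D.inner y) := fun hs => hother ⟨y, hy, hyU, hs⟩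
      -- An orbit starting in `U` outside the basin can leave `U` only by entering the basin, which
      -- a vertex that is not stuck never does. It would then reach a root in `U`, but roots lie on
      -- the curve.
      have hiter : ∀ m, (σ.step^[m] (D.inner y) : ℂ) ∈ U := by
        intro m
        induction m with
        | zero => exact hyU
        | succ m ihm =>
          rw [Function.iterate_succ_apply']
          by_cases hr : L.IsRoot (σ.step^[m] (D.inner y))
          · rwa [σ.step_of_isRoot hr]
          · obtain ⟨z, hz⟩ := D.not_isRoot_iff.1 hr
            rw [hz] at ihm ⊢
            rw [σ.step_inner hL]
            refine harmU (fun hzb => hns ?_) ⟨_, σ.inner_mem_arm z, ihm⟩ (σ.next_mem_arm z)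
            exact IsStuck.of_iterate (m := m) (hz ▸ hv.of_mem_basin hzb)
      simp only [IsStuck, not_forall, not_not] at hns
      obtain ⟨N, hN⟩ := hns
      exact hCU _ (hC.roots hN) (hiter N)
    · exact h

/-- If the removed pieces can be matched with the faces other than the dual root, then the
selection is good. -/
lemma isGood_of_endMatching (hL : L.IsTGraph) (hC : L.IsEncircledBy C) (S : D.SideData C)
    {root : L.Face C} (hroot : IsOuter root) {φ : Fin n → L.Face C}
    (hφ : IsEndMatching (fun i : Fin n => S.left ⟨i, σ i⟩) (fun i : Fin n => S.right ⟨i, σ i⟩)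
      root φ) (hsurj : ∀ F, F ≠ root → ∃ i, φ i = F) : σ.IsGood := by
  by_contra hng
  obtain ⟨v₀, hv₀⟩ : ∃ v, σ.IsStuck v := by
    simp only [IsGood, not_forall, not_exists] at hng
    exact hng
  obtain ⟨v, p, hv, hp, hb, hcover⟩ := hv₀.exists_innermost hL hC S
  have hQK : σ.basinSet v ⊆ L.carrier ∪ C :=
    (hv.basinSet_subset_carrier hL).trans subset_union_left
  have hQ := isClosed_basinSet (σ := σ) v
  have hdisj : ∀ i, Disjoint (D.piece ⟨i, σ i⟩) (σ.basinSet v) := by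
    intro i
    rw [basinSet, disjoint_iUnion₂_right]
    exact fun x _ => σ.disjoint_removed_arm hL i x
  have hverts : ∀ i (w : L.Vert), (w : ℂ) ∈ closure (D.piece ⟨i, σ i⟩) →
      D.piece ⟨i, σ i⟩ ⊆ connectedComponentIn (σ.basinSet v)ᶜ p → (w : ℂ) ∈ σ.basinSet v := by
    intro i w hw hsub
    rcases closure_component_subset hQ p (closure_mono hsub hw) with h | h
    · obtain ⟨j, hj⟩ := hcover w (hC.vert_mem w) h
      exact absurd hj (D.vert_notMem_piece w _)
    · exact h
  have htree := S.isTreeLike hL hC σ hQK hQ (hv.isConnected_basinSet hL).isPreconnected hdisj hb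
    hcover (fun i hi => by
      have hcl : closure (D.piece ⟨i, σ i⟩) = D.closedPiece ⟨i, σ i⟩ := closure_openSegment _ _
      exact ⟨hverts i _ (hcl ▸ left_mem_segment _ _ _) hi,
        hverts i _ (hcl ▸ right_mem_segment _ _ _) hi⟩)
  -- An outer face accumulates at a point of the curve, which is neither in `U` nor on the basin.
  have hrootU : ¬ root.1 ⊆ connectedComponentIn (σ.basinSet v)ᶜ p := by
    intro h
    obtain ⟨c, hc, hcC, -⟩ := hroot
    rcases closure_component_subset hQ p (closure_mono h (frontier_subset_closure hc)) with h' | h'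
    · exact hv.disjoint_curve hL hC hb hcC h'
    · exact (hC.inside c (hv.basinSet_subset_carrier hL h')).1 hcC
  have hside : ∀ i, (φ i).1 ⊆ connectedComponentIn (σ.basinSet v)ᶜ p ↔
      D.piece ⟨i, σ i⟩ ⊆ connectedComponentIn (σ.basinSet v)ᶜ p := by
    intro i
    rcases hφ.mem_ends i with h | h
    · rw [h]
      exact face_subset_component_iff _ (S.left_frontier _) hQK hQ (hdisj i) p
    · rw [h]
      exact face_subset_component_iff _ (S.right_frontier _) hQK hQ (hdisj i) p
  have hW : Nonempty {F : L.Face C // F.1 ⊆ connectedComponentIn (σ.basinSet v)ᶜ p} := by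
    have hpU : p ∈ connectedComponentIn (σ.basinSet v)ᶜ p := mem_connectedComponentIn hp
    by_cases hpK : p ∈ L.carrier ∪ C
    · obtain ⟨i, hi⟩ := hcover p hpK hpU
      exact ⟨⟨φ i, (hside i).2 (subset_component_of_inter (D.isPreconnected_piece _)
        (hdisj i).subset_compl_right ⟨p, hi, hpU⟩)⟩⟩
    · have hsub := connectedComponentIn_mono p (compl_subset_compl.2 hQK)
      exact ⟨⟨⟨_, ⟨p, hpK, rfl⟩, hb.subset hsub⟩, hsub⟩⟩
  obtain ⟨w⟩ := hW
  have hcard := htree.card_eq w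
  let Φ : {i : Fin n // D.piece ⟨i, σ i⟩ ⊆ connectedComponentIn (σ.basinSet v)ᶜ p} →
      {F : L.Face C // F.1 ⊆ connectedComponentIn (σ.basinSet v)ᶜ p} :=
    fun i => ⟨φ i.1, (hside i.1).2 i.2⟩
  -- Every face in `U` is matched with a removed piece in `U`, so there are at most as many faces as
  -- pieces; the tree structure requires one face more.
  have hΦ : Function.Surjective Φ := by
    rintro ⟨F, hF⟩
    obtain ⟨i, rfl⟩ := hsurj F (by rintro rfl; exact hrootU hF)
    exact ⟨⟨i, (hside i).1 hF⟩, rfl⟩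
  have := Nat.card_le_card_of_surjective Φ hΦ
  omega

end Selection
end Subdivision
end SegmentFamily

namespace SegmentFamily
namespace Subdivision

open Set

variable {n : ℕ} {L : SegmentFamily n} {C : Set ℂ} {D : L.Subdivision}

/-! ### Lengths -/

/-- The length of a piece. -/
def len (e : D.Piece) : ℝ := L.edgeLength (D.edge e)

lemma len_eq (e : D.Piece) : len e = dist (D.pt e.1 e.2.castSucc : ℂ) (D.pt e.1 e.2.succ) := rfl

lemma len_pos (e : D.Piece) : 0 < len e := dist_pos.2 (D.pt_castSucc_ne_pt_succ e)

lemma piece_eq_sdiff (e : D.Piece) : D.piece e =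
    D.closedPiece e \ {(D.pt e.1 e.2.castSucc : ℂ), (D.pt e.1 e.2.succ : ℂ)} := by
  rw [closedPiece_eq]
  ext x
  constructor
  · intro hx
    refine ⟨Or.inr (Or.inr hx), ?_⟩
    rintro (rfl | rfl)
    · exact D.vert_notMem_piece _ e hx
    · exact D.vert_notMem_piece _ e hx
  · rintro ⟨rfl | rfl | hx, h⟩
    · exact absurd (Or.inl rfl) h
    · exact absurd (Or.inr rfl) h
    · exact hx

lemma measurableSet_piece (e : D.Piece) : MeasurableSet (D.piece e) := by
  rw [piece_eq_sdiff]
  exact (D.isCompact_closedPiece e).isClosed.measurableSet.diff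
    ((toFinite _).measurableSet)

lemma hausdorffMeasure_finite {s : Set ℂ} (hs : s.Finite) : μH[1] s = 0 := by
  have := Measure.nullSingletonClass_hausdorff ℂ (d := 1) one_pos
  exact hs.measure_zero _

lemma hausdorffMeasure_piece (e : D.Piece) : μH[1] (D.piece e) = ENNReal.ofReal (len e) := by
  rw [piece_eq_sdiff, measure_sdiff_null (hausdorffMeasure_finite (toFinite _)), closedPiece,
    hausdorffMeasure_segment, edist_dist, len_eq]

namespace SideData

variable (S : D.SideData C)

/-- The face lies at one of the two sides of the piece. -/
def IsSide (F : L.Face C) (e : D.Piece) : Prop := F = S.left e ∨ F = S.right e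

variable {S}

lemma IsSide.piece_subset_frontier {F : L.Face C} {e : D.Piece} (h : S.IsSide F e) :
    D.piece e ⊆ frontier F.1 := by
  rcases h with rfl | rfl
  exacts [S.left_frontier e, S.right_frontier e]

lemma isSide_iff {F : L.Face C} {e : D.Piece} :
    S.IsSide F e ↔ D.piece e ⊆ portion (F, e.1) := by
  constructor
  · intro h
    exact subset_inter (D.piece_subset_seg e) h.piece_subset_frontier
  · intro h
    obtain ⟨m, hm⟩ := D.piece_nonempty e
    exact S.eq_or_eq_of_mem_frontier hm (h hm).2

lemma exists_isSide_of_mem_portion {F : L.Face C} {i : Fin n} {x : ℂ} (hx : x ∈ portion (F, i)) :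
    (∃ j, S.IsSide F ⟨i, j⟩ ∧ x ∈ D.piece ⟨i, j⟩) ∨ x ∈ L.vertexSet := by
  rcases D.exists_mem_of_mem_seg hx.1 with ⟨j, hj⟩ | ⟨j, rfl⟩
  · exact Or.inl ⟨j, S.eq_or_eq_of_mem_frontier hj hx.2, hj⟩
  · exact Or.inr (Subtype.coe_prop _)

open Classical in
variable (S) in
/-- The weight of an edge of the dimer graph is the total length of the pieces at the face. -/
lemma edgeWeight_eq (hL : L.IsTGraph) (F : L.Face C) (i : Fin n) :
    edgeWeight (F, i) = ∑ j with S.IsSide F ⟨i, j⟩, len (D := D) ⟨i, j⟩ := by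
  set t : Finset (Fin (D.k i + 1)) := Finset.univ.filter fun j => S.IsSide F ⟨i, j⟩ with ht
  have h1 : (⋃ j ∈ t, D.piece ⟨i, j⟩) ⊆ portion (F, i) := by
    intro x hx
    obtain ⟨j, hj, hx⟩ := mem_iUnion₂.1 hx
    exact isSide_iff.1 (Finset.mem_filter.1 hj).2 hx
  have h2 : portion (F, i) ⊆ (⋃ j ∈ t, D.piece ⟨i, j⟩) ∪ L.vertexSet := by
    intro x hx
    rcases S.exists_isSide_of_mem_portion hx with ⟨j, hj, hx⟩ | hx
    · exact Or.inl (mem_iUnion₂.2 ⟨j, Finset.mem_filter.2 ⟨Finset.mem_univ j, hj⟩, hx⟩)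
    · exact Or.inr hx
  have h3 : μH[1] (portion (F, i)) = μH[1] (⋃ j ∈ t, D.piece ⟨i, j⟩) := by
    refine le_antisymm ((measure_mono h2).trans ((measure_union_le _ _).trans ?_))
      (measure_mono h1)
    rw [hausdorffMeasure_finite L.finite_vertexSet, add_zero]
  rw [edgeWeight, h3, measure_biUnion_finset ?_ fun j _ => measurableSet_piece _]
  · simp only [hausdorffMeasure_piece]
    rw [ENNReal.toReal_sum fun j _ => ENNReal.ofReal_ne_top]
    exact Finset.sum_congr rfl fun j _ => ENNReal.toReal_ofReal (len_pos _).le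
  · intro j _ j' _ hne
    exact D.disjoint_piece hL fun h => hne (by simpa using h)

lemma edgeWeight_pos (hL : L.IsTGraph) {F : L.Face C} {i : Fin n} {j : Fin (D.k i + 1)}
    (h : S.IsSide F ⟨i, j⟩) : 0 < edgeWeight (F, i) := by
  classical
  rw [S.edgeWeight_eq hL]
  exact Finset.sum_pos (fun j _ => len_pos _) ⟨j, Finset.mem_filter.2 ⟨Finset.mem_univ j, h⟩⟩

/-- A nondegenerate segment is infinite, so it contains a point that is no vertex and hence lies in
a piece at the face. Conversely, any closed segment inside such a piece serves. -/
lemma mem_dimerEdges_iff {root F : L.Face C} {i : Fin n} :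
    (F, i) ∈ dimerEdges root ↔ F ≠ root ∧ ∃ j, S.IsSide F ⟨i, j⟩ := by
  refine and_congr_right fun _ => ⟨?_, ?_⟩
  · rintro ⟨x, y, hxy, hsub⟩
    have hinf : (segment ℝ x y).Infinite := by
      intro hfin
      have h1 := hausdorffMeasure_finite hfin
      rw [hausdorffMeasure_segment] at h1
      exact hxy (edist_eq_zero.1 h1)
    obtain ⟨z, hz, hzv⟩ := (hinf.sdiff L.finite_vertexSet).nonempty
    rcases S.exists_isSide_of_mem_portion (hsub hz) with ⟨j, hj, -⟩ | h
    · exact ⟨j, hj⟩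
    · exact absurd h hzv
  · rintro ⟨j, hj⟩
    have h1 := D.piece_eq ⟨i, j⟩
    have hlt := D.pos_castSucc_lt_succ i j
    obtain ⟨s, hs1, hs2⟩ := exists_between hlt
    obtain ⟨t, ht1, ht2⟩ := exists_between hs2
    refine ⟨L.line i s, L.line i t, fun h => ht1.ne (L.line_injective i h), ?_⟩
    rw [L.segment_line i ht1]
    refine Subset.trans ?_ (isSide_iff.1 hj)
    rw [h1]
    exact image_mono (Icc_subset_Ioo hs1 ht2)

end SideData

/-! ### The weight of a forest -/

namespace Selection

/-- The product of the lengths of the removed pieces. -/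
def removedLength (σ : D.Selection) : ℝ := ∏ i, len (D := D) ⟨i, σ i⟩

lemma dist_next (σ : D.Selection) (x : D.Inner) :
    dist (D.inner x : ℂ) (σ.next x) = len (D := D) ⟨x.1, (σ x.1).succAbove x.2⟩ := by
  rw [len, edge_succAbove]
  rfl

end Selection

variable (D)

/-- The normalization of the transition probabilities. -/
lemma outSum_pos (hL : L.IsTGraph) (x : D.Inner) :
    0 < ∑ᶠ w ∈ {w | L.Out (D.inner x) w}, (dist (D.inner x : ℂ) w)⁻¹ := by
  have h : {w | L.Out (D.inner x) w} =
      {D.pt x.1 x.2.castSucc.castSucc, D.pt x.1 x.2.succ.succ} := by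
    ext w
    exact D.out_inner_iff hL
  have hpos : ∀ w, L.Out (D.inner x) w → 0 < (dist (D.inner x : ℂ) w)⁻¹ := by
    intro w hw
    exact inv_pos.2 (dist_pos.2 fun h => hw.1.1 (Subtype.ext h))
  rw [h, finsum_mem_pair (D.pt_down_ne_up x)]
  exact add_pos (hpos _ ((D.out_inner_iff hL).2 (Or.inl rfl)))
    (hpos _ ((D.out_inner_iff hL).2 (Or.inr rfl)))

/-- The normalization of a transition depends only on its tail, and the remaining factors are the
inverse lengths of the kept pieces. Their product is the inverse length of all pieces together times
that of the removed ones uninverted. -/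
lemma exists_forestWeight_eq (hL : L.IsTGraph) : ∃ c : ℝ, c ≠ 0 ∧
    ∀ σ : D.Selection, L.forestWeight σ.arcs = c * σ.removedLength := by
  refine ⟨(∏ x : D.Inner, ∑ᶠ w ∈ {w | L.Out (D.inner x) w}, (dist (D.inner x : ℂ) w)⁻¹)⁻¹ *
    ∏ i, ∏ j, (len (D := D) ⟨i, j⟩)⁻¹, ?_, fun σ => ?_⟩
  · apply mul_ne_zero
    · exact inv_ne_zero (Finset.prod_ne_zero_iff.2 fun x _ => (D.outSum_pos hL x).ne')
    · exact Finset.prod_ne_zero_iff.2 fun i _ => Finset.prod_ne_zero_iff.2 fun j _ =>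
        inv_ne_zero (len_pos _).ne'
  · have harcs : σ.arcs = range fun x : D.Inner => (D.inner x, σ.next x) := by
      ext e
      rw [σ.mem_arcs_iff hL]
      exact ⟨fun ⟨x, h⟩ => ⟨x, h.symm⟩, fun ⟨x, h⟩ => ⟨x, h.symm⟩⟩
    have hinj : Function.Injective fun x : D.Inner => (D.inner x, σ.next x) := fun x y h =>
      D.inner_injective hL (congrArg Prod.fst h)
    rw [forestWeight, harcs, finprod_mem_range hinj, finprod_eq_prod_of_fintype]
    simp only [transition, σ.dist_next, div_eq_mul_inv]
    rw [Finset.prod_mul_distrib, Finset.prod_inv_distrib (f := fun x : D.Inner =>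
      ∑ᶠ w ∈ {w | L.Out (D.inner x) w}, (dist (D.inner x : ℂ) w)⁻¹), Fintype.prod_sigma, mul_comm,
      mul_assoc]
    congr 1
    rw [Selection.removedLength, ← Finset.prod_mul_distrib]
    refine Finset.prod_congr rfl fun i _ => ?_
    rw [Fin.prod_univ_succAbove (fun j => (len (D := D) ⟨i, j⟩)⁻¹) (σ i), mul_comm, ← mul_assoc,
      mul_inv_cancel₀ (len_pos _).ne', one_mul]

/-! ### Marked matchings -/

variable {D}

/-- The faces other than the dual root are matched with the removed pieces at their sides. -/
structure IsFaceMatching (S : D.SideData C) (root : L.Face C) (σ : D.Selection)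
    (φ : Fin n → L.Face C) : Prop where
  isEndMatching : IsEndMatching (fun i : Fin n => S.left ⟨i, σ i⟩)
    (fun i : Fin n => S.right ⟨i, σ i⟩) root φ
  surj : ∀ F, F ≠ root → ∃ i, φ i = F

lemma IsFaceMatching.isSide {S : D.SideData C} {root : L.Face C} {σ : D.Selection}
    {φ : Fin n → L.Face C} (h : IsFaceMatching S root σ φ) (i : Fin n) :
    S.IsSide (φ i) ⟨i, σ i⟩ := h.isEndMatching.mem_ends i

lemma Selection.IsGood.exists_isFaceMatching (hL : L.IsTGraph) (hC : L.IsEncircledBy C)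
    (S : D.SideData C) (root : L.Face C) {σ : D.Selection} (hσ : σ.IsGood) :
    ∃ φ, IsFaceMatching S root σ φ := by
  have htree := hσ.isTreeLike hL hC S root
  obtain ⟨φ, hφ⟩ := htree.exists_endMatching root
  exact ⟨φ, hφ, fun F hF => hφ.surjOn htree hF⟩

lemma IsFaceMatching.unique (hL : L.IsTGraph) (hC : L.IsEncircledBy C) {S : D.SideData C}
    {root : L.Face C} {σ : D.Selection} {φ ψ : Fin n → L.Face C} (hσ : σ.IsGood)
    (h : IsFaceMatching S root σ φ) (h' : IsFaceMatching S root σ ψ) : φ = ψ :=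
  (hσ.isTreeLike hL hC S root).endMatching_unique h.isEndMatching h'.isEndMatching

lemma IsFaceMatching.isGood (hL : L.IsTGraph) (hC : L.IsEncircledBy C) {S : D.SideData C}
    {root : L.Face C} (hroot : IsOuter root) {σ : D.Selection} {φ : Fin n → L.Face C}
    (h : IsFaceMatching S root σ φ) : σ.IsGood :=
  Selection.isGood_of_endMatching hL hC S hroot h.isEndMatching h.surj

/-- Adjacency in the dimer graph means that some piece of the complete edge lies at the face;
choosing one for each pair gives the selection. -/
lemma isMatching_range_iff (S : D.SideData C) {root : L.Face C} {φ : Fin n → L.Face C} :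
    IsMatching root (range fun i => (φ i, i)) ↔ ∃ σ : D.Selection, IsFaceMatching S root σ φ := by
  constructor
  · intro h
    have hmem : ∀ i, φ i ≠ root ∧ ∃ j, S.IsSide (φ i) ⟨i, j⟩ := fun i =>
      SideData.mem_dimerEdges_iff.1 (h.subset ⟨i, rfl⟩)
    choose σ hσ using fun i => (hmem i).2
    refine ⟨σ, ⟨hσ, ?_, fun i => (hmem i).1⟩, ?_⟩
    · intro i j hij
      have h1 := (h.white (φ i) (hmem i).1).unique ⟨⟨i, rfl⟩, rfl⟩ ⟨⟨j, rfl⟩, hij.symm⟩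
      exact congrArg Prod.snd h1
    · intro F hF
      obtain ⟨e, ⟨⟨i, rfl⟩, hi⟩, -⟩ := h.white F hF
      exact ⟨i, hi⟩
  · rintro ⟨σ, hσ⟩
    refine ⟨?_, ?_, ?_⟩
    · rintro _ ⟨i, rfl⟩
      exact SideData.mem_dimerEdges_iff.2 ⟨hσ.isEndMatching.ne_root i, σ i, hσ.isSide i⟩
    · intro i
      refine ⟨(φ i, i), ⟨⟨i, rfl⟩, rfl⟩, ?_⟩
      rintro _ ⟨⟨j, rfl⟩, rfl⟩
      rfl
    · intro F hF
      obtain ⟨i, rfl⟩ := hσ.surj F hF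
      refine ⟨(φ i, i), ⟨⟨i, rfl⟩, rfl⟩, ?_⟩
      rintro _ ⟨⟨j, rfl⟩, hj⟩
      rw [hσ.isEndMatching.injective hj]

lemma exists_eq_range_of_isMatching {root : L.Face C} {M : Set (L.Face C × Fin n)}
    (h : IsMatching root M) : ∃ φ : Fin n → L.Face C, M = range fun i => (φ i, i) := by
  choose e he huniq using h.black
  refine ⟨fun i => (e i).1, ?_⟩
  ext ⟨F, i⟩
  constructor
  · intro hm
    refine ⟨i, ?_⟩
    have h1 := huniq i (F, i) ⟨hm, rfl⟩
    simp only [← h1]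
  · rintro ⟨j, hj⟩
    obtain ⟨rfl, rfl⟩ := Prod.ext_iff.1 hj
    have h1 : ((e j).1, j) = e j := Prod.ext rfl (he j).2.symm
    simp only
    rw [h1]
    exact (he j).1

/-- The marked matching consists of the faces `φ` and the marked pieces `σ`. -/
structure Describes {root : L.Face C} (M : MarkedMatching root) (φ : Fin n → L.Face C)
    (σ : D.Selection) : Prop where
  edges_eq : M.edges = range fun i => (φ i, i)
  mark_eq : ∀ e : M.edges, M.mark e = D.edge ⟨e.1.2, σ e.1.2⟩

lemma exists_describes (hL : L.IsTGraph) (S : D.SideData C) {root : L.Face C}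
    (M : MarkedMatching root) :
    ∃ φ, ∃ σ : D.Selection, Describes M φ σ ∧ IsFaceMatching S root σ φ := by
  obtain ⟨φ, hφ⟩ := exists_eq_range_of_isMatching M.isMatching
  have hmem : ∀ i, (φ i, i) ∈ M.edges := fun i => hφ ▸ ⟨i, rfl⟩
  have hmark : ∀ i, ∃ j, M.mark ⟨(φ i, i), hmem i⟩ = D.edge ⟨i, j⟩ ∧ S.IsSide (φ i) ⟨i, j⟩ := by
    intro i
    obtain ⟨⟨i', j⟩, he⟩ := D.mem_edgeSet_iff.1 (M.mark_mem ⟨(φ i, i), hmem i⟩)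
    have h1 := M.mark_subset ⟨(φ i, i), hmem i⟩
    rw [← he, subsegment_edge] at h1
    obtain ⟨x, hx⟩ := D.piece_nonempty ⟨i', j⟩
    -- A marked piece lies in the portion, thus on the complete edge of its pair.
    obtain rfl : i' = i := seg_index_unique hL (D.piece_subset_seg _ hx) (h1 hx).1
    exact ⟨j, he.symm, SideData.isSide_iff.2 h1⟩
  choose σ hσ hside using hmark
  have hM := M.isMatching
  rw [hφ] at hM
  obtain ⟨σ', hσ'⟩ := (isMatching_range_iff S).1 hM
  refine ⟨φ, σ, ⟨hφ, ?_⟩, ⟨hside, hσ'.isEndMatching.injective, hσ'.isEndMatching.ne_root⟩,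
    hσ'.surj⟩
  rintro ⟨e, he⟩
  obtain ⟨i, rfl⟩ : e ∈ range fun i => (φ i, i) := hφ ▸ he
  exact hσ i

lemma Describes.eq {root : L.Face C} {M M' : MarkedMatching root} {φ : Fin n → L.Face C}
    {σ : D.Selection} (h : Describes M φ σ) (h' : Describes M' φ σ) : M = M' := by
  obtain ⟨E, hE, m, hm, hs⟩ := M
  obtain ⟨E', hE', m', hm', hs'⟩ := M'
  obtain rfl : E = E' := h.edges_eq.trans h'.edges_eq.symm
  obtain rfl : m = m' := funext fun e => (h.mark_eq e).trans (h'.mark_eq e).symm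
  rfl

lemma IsFaceMatching.exists_describes {S : D.SideData C} {root : L.Face C}
    {σ : D.Selection} {φ : Fin n → L.Face C} (h : IsFaceMatching S root σ φ) :
    ∃ M : MarkedMatching root, Describes M φ σ := by
  refine ⟨⟨range fun i => (φ i, i), (isMatching_range_iff S).2 ⟨σ, h⟩,
    fun e => D.edge ⟨e.1.2, σ e.1.2⟩, fun e => D.mem_edgeSet_iff.2 ⟨_, rfl⟩, ?_⟩, rfl, fun _ => rfl⟩
  rintro ⟨_, i, rfl⟩
  rw [subsegment_edge]
  exact SideData.isSide_iff.1 (h.isSide i)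

lemma Describes.undirectedForest_eq (hL : L.IsTGraph) {root : L.Face C} {M : MarkedMatching root}
    {φ : Fin n → L.Face C} {σ : D.Selection} (h : Describes M φ σ) :
    M.undirectedForest = σ.graph := by
  have hrange : range M.mark = range fun i => D.edge ⟨i, σ i⟩ := by
    ext s
    constructor
    · rintro ⟨e, rfl⟩
      exact ⟨e.1.2, (h.mark_eq e).symm⟩
    · rintro ⟨i, rfl⟩
      exact ⟨⟨(φ i, i), h.edges_eq ▸ ⟨i, rfl⟩⟩, h.mark_eq _⟩
  ext u v
  rw [σ.graph_adj_iff_exists_piece hL, MarkedMatching.undirectedForest,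
    SimpleGraph.deleteEdges_adj, hrange, ← SimpleGraph.mem_edgeSet, D.mem_edgeSet_iff]
  constructor
  · rintro ⟨⟨⟨i, j⟩, he⟩, hno⟩
    refine ⟨⟨i, j⟩, ?_, he⟩
    rintro (rfl : j = σ i)
    exact hno ⟨i, he⟩
  · rintro ⟨e, hne, he⟩
    refine ⟨⟨e, he⟩, ?_⟩
    rintro ⟨i, hi⟩
    have h1 := D.edge_injective hL (he.trans hi.symm)
    subst h1
    exact hne rfl

lemma Describes.forest_eq (hL : L.IsTGraph) {root : L.Face C} {M : MarkedMatching root}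
    {φ : Fin n → L.Face C} {σ : D.Selection} (h : Describes M φ σ) (hσ : σ.IsGood) :
    M.forest = σ.arcs :=
  hσ.arcs_eq_of_graph_eq hL (h.undirectedForest_eq hL)

/-! ### Probabilities -/

lemma pair_injective (φ : Fin n → L.Face C) : Function.Injective fun i => (φ i, i) :=
  fun _ _ h => congrArg Prod.snd h

lemma matchingWeight_range (φ : Fin n → L.Face C) :
    matchingWeight (range fun i => (φ i, i)) = ∏ i, edgeWeight (φ i, i) := by
  rw [matchingWeight, finprod_mem_range (pair_injective φ), finprod_eq_prod_of_fintype]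

open Classical in
-- Spanning forests are parametrized by the good selections, and the common constant of their
-- weights cancels.
lemma forestProb_eq (hL : L.IsTGraph) (σ : D.Selection) :
    L.forestProb σ.arcs = σ.removedLength / ∑ τ : D.Selection with τ.IsGood, τ.removedLength := by
  obtain ⟨c, hc, hw⟩ := D.exists_forestWeight_eq hL
  have himage : {F | L.IsSpanningForest F} =
      (fun τ : D.Selection => τ.arcs) '' {τ | τ.IsGood} := by
    ext F
    constructor
    · intro hF
      obtain ⟨τ, hτ, rfl⟩ := D.exists_selection_of_isSpanningForest hL hF
      exact ⟨τ, hτ, rfl⟩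
    · rintro ⟨τ, hτ, rfl⟩
      exact hτ.isSpanningForest hL
  have hsum : ∑ᶠ F' ∈ {F' | L.IsSpanningForest F'}, L.forestWeight F' =
      c * ∑ τ : D.Selection with τ.IsGood, τ.removedLength := by
    rw [himage, finsum_mem_image (D.arcs_injective hL).injOn, Finset.mul_sum]
    simp only [hw]
    exact finsum_mem_eq_finite_toFinset_sum _ (toFinite _) |>.trans
      (Finset.sum_congr (by ext; simp) fun _ _ => rfl)
  rw [forestProb, hsum, hw, mul_div_mul_left _ _ hc]

open Classical in
-- A portion length is a sum of piece lengths. Expanding the products gives a sum over marked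
-- matchings, that is, over pairs of `φ` and `τ`, and these correspond to the good `τ` alone.
lemma sum_matchingWeight_eq (hL : L.IsTGraph) (hC : L.IsEncircledBy C) (S : D.SideData C)
    {root : L.Face C} (hroot : IsOuter root) :
    ∑ᶠ M ∈ {M | IsMatching root M}, matchingWeight M =
      ∑ τ : D.Selection with τ.IsGood, τ.removedLength := by
  obtain ⟨σ₀, hσ₀⟩ := D.exists_isGood hL
  -- One good selection makes the faces a tree with `n` edges, so there are finitely many.
  have hfin : Finite (L.Face C) := (hσ₀.isTreeLike hL hC S root).finite root
  have : Fintype (L.Face C) := Fintype.ofFinite _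
  set Φ : Finset (Fin n → L.Face C) :=
    Finset.univ.filter fun φ => ∃ σ, IsFaceMatching S root σ φ with hΦ
  have himage : {M | IsMatching root M} =
      (fun (φ : Fin n → L.Face C) => range fun i => (φ i, i)) '' (Φ : Set (Fin n → L.Face C)) := by
    ext M
    constructor
    · intro hM
      obtain ⟨φ, rfl⟩ := exists_eq_range_of_isMatching hM
      exact ⟨φ, by simpa [hΦ] using (isMatching_range_iff S).1 hM, rfl⟩
    · rintro ⟨φ, hφ, rfl⟩
      exact (isMatching_range_iff S).2 (by simpa [hΦ] using hφ)
  have hinj : Function.Injective fun (φ : Fin n → L.Face C) => range fun i => (φ i, i) := by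
    intro φ ψ h
    funext i
    have h1 : (φ i, i) ∈ range fun i => (ψ i, i) := by
      rw [← show (range fun i => (φ i, i)) = range fun i => (ψ i, i) from h]
      exact ⟨i, rfl⟩
    obtain ⟨j, hj⟩ := h1
    obtain ⟨h2, rfl⟩ := Prod.ext_iff.1 hj
    exact h2.symm
  rw [himage, finsum_mem_image hinj.injOn, finsum_mem_coe_finset]
  simp only [matchingWeight_range, S.edgeWeight_eq hL]
  simp only [Finset.prod_univ_sum]
  rw [Finset.sum_sigma']
  refine Finset.sum_nbij (fun x => x.2) ?_ ?_ ?_ ?_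
  · rintro ⟨φ, τ⟩ hx
    simp only [Finset.mem_sigma, hΦ, Finset.mem_filter, Finset.mem_univ, true_and,
      Fintype.mem_piFinset] at hx ⊢
    obtain ⟨⟨σ, hσ⟩, hτ⟩ := hx
    exact IsFaceMatching.isGood hL hC hroot (S := S) (φ := φ)
      ⟨⟨hτ, hσ.isEndMatching.injective, hσ.isEndMatching.ne_root⟩, hσ.surj⟩
  · rintro ⟨φ, τ⟩ hx ⟨ψ, τ'⟩ hx' heq
    simp only [Finset.mem_coe, Finset.mem_sigma, hΦ, Finset.mem_filter,
      Finset.mem_univ, true_and, Fintype.mem_piFinset] at hx hx' heq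
    subst heq
    obtain ⟨⟨σ, hσ⟩, hτ⟩ := hx
    obtain ⟨⟨σ', hσ'⟩, hτ'⟩ := hx'
    have h1 : IsFaceMatching S root τ φ :=
      ⟨⟨hτ, hσ.isEndMatching.injective, hσ.isEndMatching.ne_root⟩, hσ.surj⟩
    have h2 : IsFaceMatching S root τ ψ :=
      ⟨⟨hτ', hσ'.isEndMatching.injective, hσ'.isEndMatching.ne_root⟩, hσ'.surj⟩
    rw [h1.unique hL hC (h1.isGood hL hC hroot) h2]
  · intro τ hτ
    have hτ' : τ.IsGood := by simpa using hτ
    obtain ⟨φ, hφ⟩ := hτ'.exists_isFaceMatching hL hC S root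
    refine ⟨⟨φ, τ⟩, ?_, rfl⟩
    simp only [Finset.mem_coe, Finset.mem_sigma, hΦ, Finset.mem_filter,
      Finset.mem_univ, true_and, Fintype.mem_piFinset]
    exact ⟨⟨τ, hφ⟩, hφ.isSide⟩
  · intro x _
    rfl

open Classical in
-- The portion lengths in the weight of the matching cancel against the denominators of the marking
-- probabilities.
lemma Describes.prob_eq (hL : L.IsTGraph) (hC : L.IsEncircledBy C) {S : D.SideData C}
    {root : L.Face C} (hroot : IsOuter root) {M : MarkedMatching root}
    {φ : Fin n → L.Face C} {σ : D.Selection} (h : Describes M φ σ)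
    (hφ : IsFaceMatching S root σ φ) :
    M.prob = σ.removedLength / ∑ τ : D.Selection with τ.IsGood, τ.removedLength := by
  have hmem : ∀ i, (φ i, i) ∈ M.edges := fun i => h.edges_eq ▸ ⟨i, rfl⟩
  have hbij : Function.Bijective fun i : Fin n => (⟨(φ i, i), hmem i⟩ : M.edges) := by
    constructor
    · intro i j hij
      exact congrArg (fun e : M.edges => e.1.2) hij
    · rintro ⟨e, he⟩
      obtain ⟨i, rfl⟩ : e ∈ range fun i => (φ i, i) := h.edges_eq ▸ he
      exact ⟨i, rfl⟩
  have hprod : ∏ᶠ e : M.edges, L.edgeLength (M.mark e) / edgeWeight e.1 =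
      ∏ i, len (D := D) ⟨i, σ i⟩ / edgeWeight (φ i, i) := by
    rw [← finprod_eq_prod_of_fintype]
    symm
    apply finprod_eq_of_bijective _ hbij
    intro i
    rw [h.mark_eq]
    rfl
  have hne : ∏ i, edgeWeight (φ i, i) ≠ 0 :=
    Finset.prod_ne_zero_iff.2 fun i _ => (SideData.edgeWeight_pos hL (hφ.isSide i)).ne'
  rw [MarkedMatching.prob, matchingProb, sum_matchingWeight_eq hL hC S hroot, hprod, h.edges_eq,
    matchingWeight_range, Finset.prod_div_distrib, div_mul_div_comm, mul_comm (∏ i, edgeWeight _),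
    mul_div_mul_right _ _ hne]
  rfl

end Subdivision
end SegmentFamily
end

/-! ### The bijection and the equality of measures -/

theorem mainTheorem1 {n : ℕ} (L : SegmentFamily n) (hL : L.IsTGraph)
    (C : Set ℂ) (hC : L.IsEncircledBy C)
    (root : L.Face C) (hroot : SegmentFamily.IsOuter root) :
    Nonempty (SegmentFamily.MarkedMatching root) ∧
    Set.BijOn (fun M : SegmentFamily.MarkedMatching root => M.forest) Set.univ
      {F | L.IsSpanningForest F} ∧
    ∀ M : SegmentFamily.MarkedMatching root, M.prob = L.forestProb M.forest := by
  obtain ⟨D⟩ := L.nonempty_subdivision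
  obtain ⟨S⟩ := D.nonempty_sideData hL hC
  have hex : ∀ σ : D.Selection, σ.IsGood →
      ∃ M : SegmentFamily.MarkedMatching root, M.forest = σ.arcs := by
    intro σ hσ
    obtain ⟨φ, hφ⟩ := hσ.exists_isFaceMatching hL hC S root
    obtain ⟨M, hM⟩ := hφ.exists_describes
    exact ⟨M, hM.forest_eq hL hσ⟩
  refine ⟨?_, ⟨?_, ?_, ?_⟩, ?_⟩
  · obtain ⟨σ, hσ⟩ := D.exists_isGood hL
    obtain ⟨M, -⟩ := hex σ hσ
    exact ⟨M⟩
  · intro M _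
    obtain ⟨φ, σ, hM, hφ⟩ := SegmentFamily.Subdivision.exists_describes hL S M
    have hσ := hφ.isGood hL hC hroot
    simp only [hM.forest_eq hL hσ]
    exact hσ.isSpanningForest hL
  · intro M _ M' _ h
    obtain ⟨φ, σ, hM, hφ⟩ := SegmentFamily.Subdivision.exists_describes hL S M
    obtain ⟨φ', σ', hM', hφ'⟩ := SegmentFamily.Subdivision.exists_describes hL S M'
    have hσ := hφ.isGood hL hC hroot
    simp only [hM.forest_eq hL hσ, hM'.forest_eq hL (hφ'.isGood hL hC hroot)] at h
    obtain rfl : σ = σ' := D.arcs_injective hL h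
    obtain rfl : φ = φ' := hφ.unique hL hC hσ hφ'
    exact hM.eq hM'
  · intro F hF
    obtain ⟨σ, hσ, rfl⟩ := D.exists_selection_of_isSpanningForest hL hF
    obtain ⟨M, hM⟩ := hex σ hσ
    exact ⟨M, Set.mem_univ M, hM⟩
  · intro M
    obtain ⟨φ, σ, hM, hφ⟩ := SegmentFamily.Subdivision.exists_describes hL S M
    rw [hM.forest_eq hL (hφ.isGood hL hC hroot), SegmentFamily.Subdivision.forestProb_eq hL,
      hM.prob_eq hL hC hroot hφ]
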